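/- Let $d\ge 1$, $\alpha>0$, $\beta>0$, and let $\pi:\mathbb{R}^d\to(0,\infty)$ be a $C^1$ function such that, for some constants $R$ and $K$, $\pi(x)=K\exp(-\alpha\|x\|^{\beta})$ whenever $\|x\|>R$ (Euclidean norm). Write $U=-\log\pi$, and write $\bar\pi$ for the probability measure whose Lebesgue density is proportional to $\pi$. Hamiltonian Monte Carlo (HMC) with step size $\varepsilon>0$, unit mass matrix, and a position-independent law $\mathfrak{L}$ on $\{0,1,2,\dots\}$ for the number of leapfrog steps is the Markov chain on $\mathbb{R}^d$ with the following transition from $x$. Draw independently $p\sim N(0,I)$, $L\sim\mathfrak{L}$ and $u\sim U[0,1]$. Apply $L$ times, starting from $(x,p)$, the leapfrog step $$p\leftarrow p-\tfrac{\varepsilon}{2}\nabla U(x),\qquad x\leftarrow x+\varepsilon p,\qquad p\leftarrow p-\tfrac{\varepsilon}{2}\nabla U(x),$$ and call the result $(x',p')$. Move to $x'$ if $\log u<H(x,p)-H(x',p')$, where $H(x,p)=U(x)+\tfrac12\|p\|^2$; otherwise stay at $x$. Let $P$ be its transition kernel. The chain is called geometrically ergodic if there are $\rho\in(0,1)$ and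 a $\bar\pi$-a.e. finite function $M:\mathbb{R}^d\to[0,\infty]$ such that $$\|P^n(x,\cdot)-\bar\pi\|_{TV}\le M(x)\rho^n\qquad\text{for all }x\in\mathbb{R}^d,\ n\ge 0,$$ where $\|\mu-\nu\|_{TV}=\sup_{|f|\le 1}|\mathbb{E}_\mu f-\mathbb{E}_\nu f|$. Then the following hold for every probability law $\mathfrak{L}$ on $\{0,1,2,\dots\}$. (i) Suppose $\mathfrak{L}(\{1\})>0$. If $1\le\beta<2$, then HMC is geometrically ergodic for every $\varepsilon>0$. If $\beta=2$, then there is $\varepsilon_0>0$ such that HMC is geometrically ergodic for every $\varepsilon\in(0,\varepsilon_0)$. (ii) If $\beta<1$ or $\beta>2$, then HMC is not geometrically ergodic, for any $\varepsilon>0$. -/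

import Mathlib

open MeasureTheory ProbabilityTheory
open scoped ENNReal

namespace HMC

/-- The state space `ℝ^d` with its Euclidean norm. -/
abbrev X (d : ℕ) : Type := EuclideanSpace ℝ (Fin d)

/-- The potential `U = -log π` of a positive density `π`. -/
noncomputable def potential {d : ℕ} (π : X d → ℝ) (x : X d) : ℝ := -Real.log (π x)

/-- The Hamiltonian `H(x, p) = U(x) + ‖p‖² / 2` (unit mass matrix). -/
noncomputable def hamiltonian {d : ℕ} (U : X d → ℝ) (z : X d × X d) : ℝ :=
  U z.1 + ‖z.2‖ ^ 2 / 2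

/-- Half-step update of the momentum: `p - (ε / 2) ∇U(x)`. -/
noncomputable def kick {d : ℕ} (U : X d → ℝ) (ε : ℝ) (z : X d × X d) : X d × X d :=
  (z.1, z.2 - (ε / 2) • gradient U z.1)

/-- Full-step update of the position: `x + ε p`. -/
noncomputable def drift {d : ℕ} (ε : ℝ) (z : X d × X d) : X d × X d :=
  (z.1 + ε • z.2, z.2)

/-- One step of the leapfrog (Störmer–Verlet) scheme with step size `ε`. -/
noncomputable def leapfrogStep {d : ℕ} (U : X d → ℝ) (ε : ℝ) (z : X d × X d) : X d × X d :=
  kick U ε (drift ε (kick U ε z))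

/-- `L` leapfrog steps: the approximate flow over the integration time `L ε`. -/
noncomputable def leapfrog {d : ℕ} (U : X d → ℝ) (ε : ℝ) (L : ℕ) : X d × X d → X d × X d :=
  (leapfrogStep U ε)^[L]

open Classical in
/-- One iteration of Hamiltonian Monte Carlo from `x`, as a function of the random input
`θ = (p, L, u)`: momentum, number of leapfrog steps, and uniform variable. The proposal is
accepted when `log u < H(x, p) - H(leapfrog (x, p))`. -/
noncomputable def update {d : ℕ} (U : X d → ℝ) (ε : ℝ) (x : X d) (θ : X d × ℕ × ℝ) : X d :=
  if θ.2.2 < Real.exp (hamiltonian U (x, θ.1) - hamiltonian U (leapfrog U ε θ.2.1 (x, θ.1)))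
  then (leapfrog U ε θ.2.1 (x, θ.1)).1 else x

/-- The law of `θ = (p, L, u)`: independent `p ∼ N(0, I)`, `L ∼ ℒ`, `u ∼ U[0, 1]`. -/
noncomputable def inputLaw (d : ℕ) (ℒ : Measure ℕ) : Measure (X d × ℕ × ℝ) :=
  (stdGaussian (X d)).prod (ℒ.prod (volume.restrict (Set.Icc (0 : ℝ) 1)))

theorem measurable_gradient {d : ℕ} (U : X d → ℝ) : Measurable (gradient U) :=
  (InnerProductSpace.toDual ℝ (X d)).symm.continuous.measurable.comp (measurable_fderiv ℝ U)

theorem measurable_kick {d : ℕ} (U : X d → ℝ) (ε : ℝ) : Measurable (kick U ε) :=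
  measurable_fst.prodMk
    (measurable_snd.sub (((measurable_gradient U).comp measurable_fst).const_smul (ε / 2)))

theorem measurable_drift {d : ℕ} (ε : ℝ) : Measurable (drift (d := d) ε) :=
  (measurable_fst.add (measurable_snd.const_smul ε)).prodMk measurable_snd

theorem measurable_leapfrog {d : ℕ} (U : X d → ℝ) (ε : ℝ) (L : ℕ) :
    Measurable (leapfrog U ε L) :=
  ((measurable_kick U ε).comp ((measurable_drift ε).comp (measurable_kick U ε))).iterate L

theorem measurable_hamiltonian {d : ℕ} {U : X d → ℝ} (hU : Measurable U) :
    Measurable (hamiltonian U) :=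
  (hU.comp measurable_fst).add ((measurable_snd.norm.pow_const 2).div_const 2)

theorem measurable_update {d : ℕ} {U : X d → ℝ} (hU : Measurable U) (ε : ℝ) :
    Measurable (Function.uncurry (update U ε)) := by
  have hz : Measurable (fun q : X d × X d × ℕ × ℝ => (q.1, q.2.1)) := by fun_prop
  have hfl : Measurable
      (fun q : X d × X d × ℕ × ℝ => leapfrog U ε q.2.2.1 (q.1, q.2.1)) := by
    have h : Measurable (fun r : (X d × X d) × ℕ => leapfrog U ε r.2 r.1) :=
      measurable_from_prod_countable_left (fun L => measurable_leapfrog U ε L)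
    have h2 : Measurable
        (fun q : X d × X d × ℕ × ℝ => (((q.1, q.2.1), q.2.2.1) : (X d × X d) × ℕ)) := by
      fun_prop
    exact h.comp h2
  have hu : Measurable (fun q : X d × X d × ℕ × ℝ => q.2.2.2) := by fun_prop
  have hH := measurable_hamiltonian hU
  exact Measurable.ite
    (measurableSet_lt hu (((hH.comp hz).sub (hH.comp hfl)).exp))
    hfl.fst measurable_fst

instance isProbabilityMeasure_inputLaw (d : ℕ) (ℒ : Measure ℕ) [IsProbabilityMeasure ℒ] :
    IsProbabilityMeasure (inputLaw d ℒ) := by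
  have : IsProbabilityMeasure (volume.restrict (Set.Icc (0 : ℝ) 1)) :=
    ⟨by simp⟩
  unfold inputLaw
  infer_instance

theorem measurable_potential {d : ℕ} {π : X d → ℝ} (hπ : Measurable π) :
    Measurable (potential π) :=
  hπ.log.neg

/-- The transition kernel of Hamiltonian Monte Carlo for the density `π` (known up to a constant),
with step size `ε` and position-independent law `ℒ` of the number of leapfrog steps:
`P(x, ·)` is the law of `update U ε x θ`. -/
noncomputable def kernel {d : ℕ} (π : X d → ℝ) (hπ : Measurable π) (ε : ℝ)
    (ℒ : Measure ℕ) [IsProbabilityMeasure ℒ] : Kernel (X d) (X d) where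
  toFun x := (inputLaw d ℒ).map (update (potential π) ε x)
  measurable' := by
    have hm := measurable_update (measurable_potential hπ) ε
    have h : (fun x => (inputLaw d ℒ).map (update (potential π) ε x)) =
        fun x => ((inputLaw d ℒ).map (Prod.mk x)).map
          (Function.uncurry (update (potential π) ε)) := by
      funext x
      rw [Measure.map_map hm measurable_prodMk_left]
      rfl
    rw [h]
    exact (Measure.measurable_map _ hm).comp Measurable.map_prodMk_left

instance isMarkovKernel_kernel {d : ℕ} (π : X d → ℝ) (hπ : Measurable π) (ε : ℝ)
    (ℒ : Measure ℕ) [IsProbabilityMeasure ℒ] : IsMarkovKernel (kernel π hπ ε ℒ) :=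
  ⟨fun _ => Measure.isProbabilityMeasure_map
    ((measurable_update (measurable_potential hπ) ε).comp measurable_prodMk_left).aemeasurable⟩

/-- The probability measure with Lebesgue density proportional to `π`. -/
noncomputable def target {d : ℕ} (π : X d → ℝ) : Measure (X d) :=
  (volume.withDensity (fun x => ENNReal.ofReal (π x)) Set.univ)⁻¹ •
    volume.withDensity (fun x => ENNReal.ofReal (π x))

/-- Total variation distance `sup_{|f| ≤ 1} |E_μ f - E_ν f|`, over measurable `f`. -/
noncomputable def tvDist {E : Type*} [MeasurableSpace E] (μ ν : Measure E) : ℝ≥0∞ :=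
  ⨆ (f : E → ℝ) (_ : Measurable f) (_ : ∀ x, |f x| ≤ 1),
    ENNReal.ofReal |∫ x, f x ∂μ - ∫ x, f x ∂ν|

/-- Geometric ergodicity: `‖P^n(x, ·) - μ‖_TV ≤ M(x) ρ^n` for some `ρ < 1` and some
`μ`-a.e. finite `M : E → [0, ∞]`. -/
def GeometricallyErgodic {E : Type*} [MeasurableSpace E] (P : Kernel E E) (μ : Measure E) :
    Prop :=
  ∃ (ρ : ℝ) (M : E → ℝ≥0∞), 0 < ρ ∧ ρ < 1 ∧ (∀ᵐ x ∂μ, M x < ∞) ∧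
    ∀ (x : E) (n : ℕ), tvDist ((P ^ n) x) μ ≤ M x * ENNReal.ofReal (ρ ^ n)

/-- The exponential family class with tail parameters `α`, `β`: positive `C¹` densities (up to a
normalising constant) with `π(x) ∝ exp(-α ‖x‖^β)` outside some ball. -/
structure IsExpFamily {d : ℕ} (α β : ℝ) (π : X d → ℝ) : Prop where
  contDiff : ContDiff ℝ 1 π
  pos : ∀ x, 0 < π x
  tail : ∃ R K : ℝ, ∀ x, R < ‖x‖ → π x = K * Real.exp (-α * ‖x‖ ^ β)

theorem IsExpFamily.measurable {d : ℕ} {α β : ℝ} {π : X d → ℝ} (h : IsExpFamily α β π) :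
    Measurable π :=
  h.contDiff.continuous.measurable

end HMC

/-! The chain is reversible. Each leapfrog step preserves volume and is undone by a momentum flip,
so the accepted moves form a symmetric measure for each number of steps separately
(`acceptedFlow_symm`). All cases rest on this or on the behaviour of single moves in the tails.

For `1 ≤ β ≤ 2` only accepted moves with `L = 1` are studied. They satisfy a drift inequality for `V
= exp (s‖x‖)`. A Dirichlet form only grows when further moves are added, so this yields coercivity
outside a ball for the whole kernel, whatever the trajectories with `L ≠ 1` do; a Lyapunov function
for the full kernel would have to control them all. With a minorization on the ball, the spectrum on
mean-zero functions stays away from `1` and `-1` (`coercive_of_integral_eq_zero`, `coercive_add`).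
To pass from `L²` to pointwise bounds, the regeneration part `δ 1_C ⊗ μ|_C` is removed. What is left
is a positive operator, still an `L²` contraction, and a recursion driven by it dominates all `|P^n
f - μ(f)|` at once; a weighted sum of the dominating functions is `M`
(`DriftMinorization.geometricallyErgodic`).

The drift itself: the deterministic part `x - (ε²/2)∇U(x)` of a step shortens `‖x‖` by at least a
constant, because `β ≥ 1` and the step does not overshoot, while the Gaussian part changes the norm
on average only to second order. Rejection does no harm: inward moves that stay in the tail are
always accepted (`TailBound.hamiltonian_le`), since the trapezoidal rule underestimates integrals of
the concave function `s^(β-1)`, and rejecting outward moves only helps.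

For `β > 2` the gradient is superlinear, leapfrog trajectories at least double the norm, and such
proposals are almost surely rejected far out. Holding probabilities close to `1` exclude a geometric
rate. For `β < 1` the gradient is bounded, so increments are tight, while the density is nearly
constant along bounded translations in the tail. A far half-space then has little of its mass near
its boundary, and the flow out of it is too small for the bound of
`GeometricallyErgodic.exists_flow_ge`. -/

namespace HMC

/-! ### `L²` inequalities for bounded measurable functions. -/

section Bounded

variable {E : Type*} [MeasurableSpace E]

/-- Bounded measurable real functions. -/
def bddMeas (E : Type*) [MeasurableSpace E] : Submodule ℝ (E → ℝ) where
  carrier := {f | Measurable f ∧ ∃ c, ∀ x, |f x| ≤ c}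
  add_mem' := by
    rintro f g ⟨hf, c, hc⟩ ⟨hg, c', hc'⟩
    exact ⟨hf.add hg, c + c', fun x => (abs_add_le _ _).trans (add_le_add (hc x) (hc' x))⟩
  zero_mem' := ⟨measurable_zero, 0, fun x => by simp⟩
  smul_mem' := by
    rintro a f ⟨hf, c, hc⟩
    refine ⟨hf.const_smul a, |a| * c, fun x => ?_⟩
    simpa [abs_mul] using mul_le_mul_of_nonneg_left (hc x) (abs_nonneg a)

theorem mem_bddMeas_mul {f g : E → ℝ} (hf : f ∈ bddMeas E) (hg : g ∈ bddMeas E) :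
    (fun x => f x * g x) ∈ bddMeas E := by
  obtain ⟨hf, c, hc⟩ := hf
  obtain ⟨hg, c', hc'⟩ := hg
  refine ⟨hf.mul hg, c * c', fun x => ?_⟩
  rw [abs_mul]
  exact mul_le_mul (hc x) (hc' x) (abs_nonneg _) ((abs_nonneg _).trans (hc x))

theorem mem_bddMeas_abs {f : E → ℝ} (hf : f ∈ bddMeas E) : (fun x => |f x|) ∈ bddMeas E := by
  obtain ⟨hf, c, hc⟩ := hf
  exact ⟨hf.abs, c, fun x => by simpa using hc x⟩

theorem mem_bddMeas_const (c : ℝ) : (fun _ => c) ∈ bddMeas E :=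
  ⟨measurable_const, |c|, fun _ => le_rfl⟩

theorem mem_bddMeas_sub_const {f : E → ℝ} (hf : f ∈ bddMeas E) (c : ℝ) :
    (fun x => f x - c) ∈ bddMeas E :=
  (bddMeas E).sub_mem hf (mem_bddMeas_const c)

theorem mem_bddMeas_indicator {s : Set E} (hs : MeasurableSet s) (c : ℝ) :
    s.indicator (fun _ => c) ∈ bddMeas E := by
  refine ⟨measurable_const.indicator hs, |c|, fun x => ?_⟩
  by_cases hx : x ∈ s <;> simp [hx]

theorem mem_bddMeas_comp {F : Type*} [MeasurableSpace F] {f : E → ℝ} (hf : f ∈ bddMeas E)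
    {g : F → E} (hg : Measurable g) : (fun x => f (g x)) ∈ bddMeas F :=
  ⟨hf.1.comp hg, hf.2.imp fun _ hc x => hc (g x)⟩

theorem integrable_of_mem_bddMeas {f : E → ℝ} (hf : f ∈ bddMeas E) (ν : Measure E)
    [IsFiniteMeasure ν] : Integrable f ν := by
  obtain ⟨hf, c, hc⟩ := hf
  exact Integrable.of_bound hf.aestronglyMeasurable c (ae_of_all _ hc)

theorem integral_add_mul_add_mul {μ : Measure E} {a b c : E → ℝ} (ha : Integrable a μ)
    (hb : Integrable b μ) (hc : Integrable c μ) (t u : ℝ) :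
    ∫ x, (a x + t * b x + u * c x) ∂μ
      = (∫ x, a x ∂μ) + t * (∫ x, b x ∂μ) + u * ∫ x, c x ∂μ := by
  have h := integral_add (ha.add (hb.const_mul t)) (hc.const_mul u)
  have h' := integral_add ha (hb.const_mul t)
  simp only [Pi.add_apply] at h
  rw [h, h', integral_const_mul, integral_const_mul]

/-- The quadratic polynomial `t ↦ ∫ (f + t g)²` is nonnegative, so its discriminant is not positive.
-/
theorem sq_integral_mul_le {μ : Measure E} [IsFiniteMeasure μ] {f g : E → ℝ}
    (hf : f ∈ bddMeas E) (hg : g ∈ bddMeas E) :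
    (∫ x, f x * g x ∂μ) ^ 2 ≤ (∫ x, f x * f x ∂μ) * ∫ x, g x * g x ∂μ := by
  have iff := integrable_of_mem_bddMeas (mem_bddMeas_mul hf hf) μ
  have ifg := integrable_of_mem_bddMeas (mem_bddMeas_mul hf hg) μ
  have igg := integrable_of_mem_bddMeas (mem_bddMeas_mul hg hg) μ
  have key : ∀ t : ℝ, 0 ≤ (∫ x, g x * g x ∂μ) * (t * t) + (2 * ∫ x, f x * g x ∂μ) * t
      + ∫ x, f x * f x ∂μ := by
    intro t
    have h : ∫ x, (f x + t * g x) ^ 2 ∂μ = (∫ x, g x * g x ∂μ) * (t * t)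
        + (2 * ∫ x, f x * g x ∂μ) * t + ∫ x, f x * f x ∂μ := by
      rw [show (fun x => (f x + t * g x) ^ 2) = fun x => f x * f x
        + (2 * t) * (f x * g x) + (t * t) * (g x * g x) from by ext x; ring]
      refine (integral_add_mul_add_mul iff ifg igg _ _).trans ?_
      ring
    rw [← h]
    exact integral_nonneg fun x => sq_nonneg _
  have := discrim_le_zero key
  unfold discrim at this
  nlinarith

theorem sq_integral_le {μ : Measure E} [IsProbabilityMeasure μ] {f : E → ℝ}
    (hf : f ∈ bddMeas E) : (∫ x, f x ∂μ) ^ 2 ≤ ∫ x, f x * f x ∂μ := by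
  simpa using sq_integral_mul_le (μ := μ) hf (mem_bddMeas_const (1 : ℝ))

/-- A symmetric operator whose quadratic form is bounded by `ρ` is a `ρ`-contraction of `L²`. -/
theorem sq_norm_le_of_quadratic_le {μ : Measure E} [IsFiniteMeasure μ]
    {D : Submodule ℝ (E → ℝ)} (hD : D ≤ bddMeas E) {T : (E → ℝ) → E → ℝ}
    (hT : ∀ f ∈ D, T f ∈ D)
    (hlin : ∀ f ∈ D, ∀ g ∈ D, ∀ c : ℝ, T (f + c • g) = T f + c • T g)
    (hsymm : ∀ f ∈ D, ∀ g ∈ D, ∫ x, f x * T g x ∂μ = ∫ x, g x * T f x ∂μ)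
    {ρ : ℝ} (hρ : 0 < ρ) (hq : ∀ f ∈ D, |∫ x, f x * T f x ∂μ| ≤ ρ * ∫ x, f x * f x ∂μ)
    {f : E → ℝ} (hf : f ∈ D) :
    ∫ x, T f x * T f x ∂μ ≤ ρ ^ 2 * ∫ x, f x * f x ∂μ := by
  have hint : ∀ f ∈ D, ∀ g ∈ D, Integrable (fun x => f x * g x) μ := fun f hf g hg =>
    integrable_of_mem_bddMeas (mem_bddMeas_mul (hD hf) (hD hg)) μ
  have hg := hT f hf
  have expand : ∀ a ∈ D, ∀ b ∈ D, ∀ a' ∈ D, ∀ b' ∈ D, ∀ t : ℝ,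
      ∫ x, (a + t • b) x * (a' + t • b') x ∂μ = (∫ x, a x * a' x ∂μ)
        + t * ((∫ x, a x * b' x ∂μ) + ∫ x, b x * a' x ∂μ) + t ^ 2 * ∫ x, b x * b' x ∂μ := by
    intro a ha b hb a' ha' b' hb' t
    rw [show (fun x => (a + t • b) x * (a' + t • b') x) = fun x => a x * a' x
      + t * (a x * b' x + b x * a' x) + t ^ 2 * (b x * b' x) from by
        ext x; simp only [Pi.add_apply, Pi.smul_apply, smul_eq_mul]; ring]
    have h1 := hint a ha a' ha'
    have h2 := hint a ha b' hb'
    have h3 := hint b hb a' ha'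
    have h4 := hint b hb b' hb'
    refine (integral_add_mul_add_mul h1 (h2.add h3) h4 _ _).trans ?_
    simp only [Pi.add_apply]
    rw [integral_add h2 h3]
  have hq' : ∀ t : ℝ, |(∫ x, f x * T f x ∂μ) + t * (2 * ∫ x, T f x * T f x ∂μ)
      + t ^ 2 * ∫ x, T f x * T (T f) x ∂μ| ≤ ρ * ((∫ x, f x * f x ∂μ)
      + t * (2 * ∫ x, f x * T f x ∂μ) + t ^ 2 * ∫ x, T f x * T f x ∂μ) := by
    intro t
    have h := hq (f + t • T f) (D.add_mem hf (D.smul_mem t hg))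
    rw [hlin f hf _ hg, expand f hf _ hg _ hg _ (hT _ hg), expand f hf _ hg f hf _ hg,
      hsymm f hf _ hg] at h
    rw [show ∫ x, T f x * f x ∂μ = ∫ x, f x * T f x ∂μ from by simp_rw [mul_comm]] at h
    convert h using 2
    · ring_nf
    · ring
  -- Polarization: the forms at `f ± ρ⁻¹ T f` differ by `4 ρ⁻¹ ‖T f‖²`, and the parallelogram law
  -- bounds the right-hand sides by `2ρ(‖f‖² + ρ⁻²‖T f‖²)`. The choice of `t` balances these two
  -- terms.
  have h1 := (abs_le.1 (hq' ρ⁻¹)).2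
  have h2 := (abs_le.1 (hq' (-ρ⁻¹))).1
  set G := ∫ x, T f x * T f x ∂μ
  have h3 : 4 * (ρ⁻¹ * G) ≤ 2 * (ρ * ∫ x, f x * f x ∂μ) + 2 * (ρ * (ρ⁻¹ ^ 2 * G)) := by linarith
  have h4 : ρ * (ρ⁻¹ ^ 2 * G) = ρ⁻¹ * G := by field_simp
  rw [h4] at h3
  have h5 : ρ⁻¹ * G ≤ ρ * ∫ x, f x * f x ∂μ := by linarith
  calc G = ρ * (ρ⁻¹ * G) := by field_simp
    _ ≤ ρ * (ρ * ∫ x, f x * f x ∂μ) := by gcongr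
    _ = _ := by ring

end Bounded

/-! ### Markov operators and their Dirichlet forms under reversibility. -/

section Markov

variable {E : Type*} [MeasurableSpace E] {P : Kernel E E} [IsMarkovKernel P] {μ : Measure E}
  [IsProbabilityMeasure μ]

/-- The action of a kernel on functions. -/
noncomputable def op (P : Kernel E E) (f : E → ℝ) (x : E) : ℝ := ∫ y, f y ∂(P x)

omit [IsMarkovKernel P] in
theorem measurable_op {f : E → ℝ} (hf : Measurable f) : Measurable (op P f) :=
  hf.stronglyMeasurable.integral_kernel.measurable

theorem abs_op_le {f : E → ℝ} {c : ℝ} (hc : ∀ x, |f x| ≤ c) (x : E) : |op P f x| ≤ c := by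
  have := norm_integral_le_of_norm_le_const (μ := P x) (f := f) (ae_of_all _ hc)
  simpa [op] using this

theorem op_mem_bddMeas {f : E → ℝ} (hf : f ∈ bddMeas E) : op P f ∈ bddMeas E :=
  ⟨measurable_op hf.1, hf.2.imp fun _ hc => abs_op_le hc⟩

theorem op_add_smul {f g : E → ℝ} (hf : f ∈ bddMeas E) (hg : g ∈ bddMeas E) (c : ℝ) :
    op P (f + c • g) = op P f + c • op P g := by
  ext x
  simp only [op, Pi.add_apply, Pi.smul_apply, smul_eq_mul]
  rw [integral_add (integrable_of_mem_bddMeas hf _)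
    ((integrable_of_mem_bddMeas hg _).const_mul c), integral_const_mul]

theorem integral_compProd_of_mem_bddMeas {F : E × E → ℝ} (hF : F ∈ bddMeas (E × E)) :
    ∫ z, F z ∂(μ ⊗ₘ P) = ∫ x, ∫ y, F (x, y) ∂(P x) ∂μ :=
  Measure.integral_compProd (integrable_of_mem_bddMeas hF _)

theorem integral_mul_op {f g : E → ℝ} (hf : f ∈ bddMeas E) (hg : g ∈ bddMeas E) :
    ∫ x, f x * op P g x ∂μ = ∫ z, f z.1 * g z.2 ∂(μ ⊗ₘ P) := by
  rw [integral_compProd_of_mem_bddMeas (mem_bddMeas_mul (mem_bddMeas_comp hf measurable_fst)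
    (mem_bddMeas_comp hg measurable_snd))]
  simp only [op, integral_const_mul]

theorem integral_pow_eq {f : E → ℝ} (hf : f ∈ bddMeas E) (n : ℕ) (x : E) :
    ∫ y, f y ∂((P ^ n) x) = (op P)^[n] f x := by
  induction n generalizing x with
  | zero =>
    have h : (P ^ 0) x = Measure.dirac x := by rw [pow_zero]; rfl
    rw [h, integral_dirac' _ _ hf.1.stronglyMeasurable]; rfl
  | succ n ih =>
    have : IsMarkovKernel (P ^ n) := by
      clear ih
      induction n with
      | zero => rw [pow_zero]; exact (inferInstance : IsMarkovKernel (Kernel.id : Kernel E E))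
      | succ n ih =>
        rw [pow_succ]
        exact (inferInstance : IsMarkovKernel ((P ^ n) ∘ₖ P))
    have h : (P ^ (n + 1)) = (P ^ n) ∘ₖ P := pow_succ P n
    rw [h, Kernel.integral_comp (integrable_of_mem_bddMeas hf _), Function.iterate_succ_apply']
    simp_rw [ih]
    rfl

theorem iterate_op_mem_bddMeas {f : E → ℝ} (hf : f ∈ bddMeas E) (n : ℕ) :
    (op P)^[n] f ∈ bddMeas E := by
  induction n with
  | zero => exact hf
  | succ n ih => rw [Function.iterate_succ_apply']; exact op_mem_bddMeas ih

theorem op_sub_const {f : E → ℝ} (hf : f ∈ bddMeas E) (c : ℝ) :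
    op P (fun x => f x - c) = fun x => op P f x - c := by
  ext x
  simp only [op]
  rw [integral_sub (integrable_of_mem_bddMeas hf _) (integrable_const _)]
  simp

theorem iterate_op_sub_const {f : E → ℝ} (hf : f ∈ bddMeas E) (c : ℝ) (n : ℕ) :
    (op P)^[n] (fun x => f x - c) = fun x => (op P)^[n] f x - c := by
  induction n with
  | zero => rfl
  | succ n ih =>
    rw [Function.iterate_succ_apply', ih, op_sub_const (iterate_op_mem_bddMeas hf n),
      Function.iterate_succ_apply']

theorem integral_fst_compProd {f : E → ℝ} (hf : f ∈ bddMeas E) :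
    ∫ z, f z.1 ∂(μ ⊗ₘ P) = ∫ x, f x ∂μ := by
  rw [integral_compProd_of_mem_bddMeas (mem_bddMeas_comp hf measurable_fst)]
  simp

theorem integral_swap_of_symm {J : Measure (E × E)} (hJ : J.map Prod.swap = J) {F : E × E → ℝ}
    (hF : Measurable F) : ∫ z, F z.swap ∂J = ∫ z, F z ∂J := by
  conv_rhs => rw [← hJ]
  rw [integral_map measurable_swap.aemeasurable hF.aestronglyMeasurable]

variable (hsymm : (μ ⊗ₘ P).map Prod.swap = μ ⊗ₘ P)

include hsymm

theorem integral_mul_op_comm {f g : E → ℝ} (hf : f ∈ bddMeas E) (hg : g ∈ bddMeas E) :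
    ∫ x, f x * op P g x ∂μ = ∫ x, g x * op P f x ∂μ := by
  have h := integral_swap_of_symm hsymm (F := fun z => f z.1 * g z.2)
    ((hf.1.comp measurable_fst).mul (hg.1.comp measurable_snd))
  rw [integral_mul_op hf hg, integral_mul_op hg hf, ← h]
  simp [mul_comm]

theorem integral_snd_compProd {f : E → ℝ} (hf : f ∈ bddMeas E) :
    ∫ z, f z.2 ∂(μ ⊗ₘ P) = ∫ x, f x ∂μ := by
  rw [← integral_fst_compProd (P := P) hf]
  exact integral_swap_of_symm hsymm (F := fun z => f z.1) (hf.1.comp measurable_fst)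

theorem integral_op {f : E → ℝ} (hf : f ∈ bddMeas E) : ∫ x, op P f x ∂μ = ∫ x, f x ∂μ := by
  rw [← integral_snd_compProd hsymm hf,
    integral_compProd_of_mem_bddMeas (mem_bddMeas_comp hf measurable_snd)]
  rfl

/-- The Dirichlet form, and its analogue with a plus sign. -/
theorem integral_sq_add_mul {f : E → ℝ} (hf : f ∈ bddMeas E) (σ : ℝ) (hσ : σ ^ 2 = 1) :
    ∫ z, (f z.1 + σ * f z.2) ^ 2 ∂(μ ⊗ₘ P)
      = 2 * ((∫ x, f x * f x ∂μ) + σ * ∫ x, f x * op P f x ∂μ) := by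
  have h1 := mem_bddMeas_mul hf hf
  have m1 := mem_bddMeas_comp h1 (measurable_fst (α := E) (β := E))
  have m2 := mem_bddMeas_comp h1 (measurable_snd (α := E) (β := E))
  have m3 := mem_bddMeas_mul (mem_bddMeas_comp hf (measurable_fst (α := E) (β := E)))
    (mem_bddMeas_comp hf (measurable_snd (α := E) (β := E)))
  have i1 := integrable_of_mem_bddMeas m1 (μ ⊗ₘ P)
  have i2 := integrable_of_mem_bddMeas m2 (μ ⊗ₘ P)
  have i3 := integrable_of_mem_bddMeas m3 (μ ⊗ₘ P)
  rw [show (fun z : E × E => (f z.1 + σ * f z.2) ^ 2) = fun z => f z.1 * f z.1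
    + 1 * (f z.2 * f z.2) + (2 * σ) * (f z.1 * f z.2) from by
      ext z; linear_combination (f z.2) ^ 2 * hσ]
  refine (integral_add_mul_add_mul i1 i2 i3 _ _).trans ?_
  rw [integral_fst_compProd h1, integral_snd_compProd hsymm h1, integral_mul_op hf hf]
  ring

end Markov

/-! ### From drift and minorization to coercivity of the Dirichlet form. -/

section Drift

open scoped NNReal

variable {E : Type*} [MeasurableSpace E] {P : Kernel E E} [IsMarkovKernel P] {μ : Measure E}
  [IsProbabilityMeasure μ]

omit [IsMarkovKernel P] [IsProbabilityMeasure μ] in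
/-- A Lyapunov function for a part of a symmetric measure controls its Dirichlet form. -/
theorem lintegral_sq_le_of_drift {J₁ J : Measure (E × E)} (hJ₁ : J₁.map Prod.swap = J₁)
    (hle : J₁ ≤ J) [IsFiniteMeasure J] {V : E → ℝ} (hV : Measurable V) (hVpos : ∀ x, 0 < V x)
    {C : Set E} {lam b : ℝ≥0} [IsFiniteMeasure μ]
    (hdrift : ∀ h : E → ℝ≥0∞, Measurable h →
      ∫⁻ z, h z.1 * ENNReal.ofReal (V z.2 / V z.1) ∂J₁ + lam * ∫⁻ x, h x ∂μ
        ≤ ∫⁻ z, h z.1 ∂J₁ + b * ∫⁻ x in C, h x ∂μ)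
    {f : E → ℝ} (hf : f ∈ bddMeas E) :
    2 * (lam * ∫⁻ x, ENNReal.ofReal (f x * f x) ∂μ)
      ≤ ∫⁻ z, ENNReal.ofReal ((f z.1 + (-1) * f z.2) ^ 2) ∂J
        + 2 * (b * ∫⁻ x in C, ENNReal.ofReal (f x * f x) ∂μ) := by
  have hfin1 : IsFiniteMeasure J₁ := isFiniteMeasure_of_le J hle
  set h : E → ℝ≥0∞ := fun x => ENNReal.ofReal (f x * f x) with hh
  have hm : Measurable h := (hf.1.mul hf.1).ennreal_ofReal
  have hm1 : Measurable fun z : E × E => h z.1 := hm.comp measurable_fst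
  have hm2 : Measurable fun z : E × E => h z.2 := hm.comp measurable_snd
  have hW : Measurable fun z : E × E => ENNReal.ofReal (V z.2 / V z.1) :=
    ((hV.comp measurable_snd).div (hV.comp measurable_fst)).ennreal_ofReal
  have hW' : Measurable fun z : E × E => ENNReal.ofReal (V z.1 / V z.2) :=
    ((hV.comp measurable_fst).div (hV.comp measurable_snd)).ennreal_ofReal
  have hswap : ∀ F : E × E → ℝ≥0∞, Measurable F → ∫⁻ z, F z.swap ∂J₁ = ∫⁻ z, F z ∂J₁ := by
    intro F hF
    conv_rhs => rw [← hJ₁]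
    rw [lintegral_map hF measurable_swap]
  set A := ∫⁻ z, h z.1 ∂J₁
  set B := ∫⁻ z, h z.1 * ENNReal.ofReal (V z.2 / V z.1) ∂J₁
  have hA2 : ∫⁻ z, h z.2 ∂J₁ = A := hswap (fun z => h z.1) hm1
  have hB2 : ∫⁻ z, h z.2 * ENNReal.ofReal (V z.1 / V z.2) ∂J₁ = B :=
    hswap (fun z => h z.1 * ENNReal.ofReal (V z.2 / V z.1)) (hm1.mul hW)
  obtain ⟨c, hc⟩ := hf.2
  have hbd : ∀ x, h x ≤ ENNReal.ofReal (c * c) := fun x =>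
    ENNReal.ofReal_le_ofReal (by
      rw [← abs_mul_abs_self (f x)]
      exact mul_self_le_mul_self (abs_nonneg _) (hc x))
  have hfinA : A ≠ ∞ := by
    refine ((lintegral_mono fun z : E × E => hbd z.1).trans_lt ?_).ne
    rw [lintegral_const]
    exact ENNReal.mul_lt_top ENNReal.ofReal_lt_top (measure_lt_top _ _)
  have hfinC : ∫⁻ x in C, h x ∂μ ≠ ∞ := by
    refine ((lintegral_mono hbd).trans_lt ?_).ne
    rw [lintegral_const]
    exact ENNReal.mul_lt_top ENNReal.ofReal_lt_top (measure_lt_top _ _)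
  have hd := hdrift h hm
  have hfinB : B ≠ ∞ := by
    refine ((le_self_add.trans hd).trans_lt ?_).ne
    exact ENNReal.add_lt_top.2 ⟨hfinA.lt_top, ENNReal.mul_lt_top ENNReal.coe_lt_top hfinC.lt_top⟩
  -- With `t = V y / V x`, this is `f(x)² t + f(y)² / t ≥ 2 f(x) f(y)`, where `2 f(x) f(y) = f(x)² +
  -- f(y)² - (f(x) - f(y))²`.
  have hpt : ∀ z : E × E, h z.1 + h z.2 ≤ h z.1 * ENNReal.ofReal (V z.2 / V z.1)
      + h z.2 * ENNReal.ofReal (V z.1 / V z.2)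
      + ENNReal.ofReal ((f z.1 + (-1) * f z.2) ^ 2) := by
    intro z
    have h1 := hVpos z.1
    have h2 := hVpos z.2
    rw [hh]
    simp only
    rw [← ENNReal.ofReal_mul (mul_self_nonneg _), ← ENNReal.ofReal_mul (mul_self_nonneg _),
      ← ENNReal.ofReal_add (mul_self_nonneg _) (mul_self_nonneg _),
      ← ENNReal.ofReal_add (mul_nonneg (mul_self_nonneg _) (by positivity))
        (mul_nonneg (mul_self_nonneg _) (by positivity)),
      ← ENNReal.ofReal_add (add_nonneg (mul_nonneg (mul_self_nonneg _) (by positivity))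
        (mul_nonneg (mul_self_nonneg _) (by positivity))) (sq_nonneg _)]
    refine ENNReal.ofReal_le_ofReal ?_
    have key : f z.1 * f z.1 * (V z.2 / V z.1) + f z.2 * f z.2 * (V z.1 / V z.2)
        - 2 * f z.1 * f z.2 = (f z.1 * V z.2 - f z.2 * V z.1) ^ 2 / (V z.1 * V z.2) := by
      field_simp
      ring
    have : 0 ≤ (f z.1 * V z.2 - f z.2 * V z.1) ^ 2 / (V z.1 * V z.2) := by positivity
    nlinarith
  have hint := lintegral_mono (μ := J₁) hpt
  have hm3 : Measurable fun z : E × E => h z.1 * ENNReal.ofReal (V z.2 / V z.1) := hm1.mul hW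
  have hm4 : Measurable fun z : E × E => h z.1 * ENNReal.ofReal (V z.2 / V z.1)
      + h z.2 * ENNReal.ofReal (V z.1 / V z.2) := hm3.add (hm2.mul hW')
  rw [lintegral_add_left hm1, lintegral_add_left hm4, lintegral_add_left hm3, hA2, hB2] at hint
  -- The square is nonnegative, so `J₁` may be enlarged to `J`. This is why moves outside `J₁` need
  -- no drift.
  have hint2 : A + A ≤ B + B + ∫⁻ z, ENNReal.ofReal ((f z.1 + (-1) * f z.2) ^ 2) ∂J :=
    hint.trans (by gcongr)
  refine (ENNReal.add_le_add_iff_left (ENNReal.add_ne_top.2 ⟨hfinB, hfinB⟩)).1 ?_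
  calc B + B + 2 * (lam * ∫⁻ x, h x ∂μ)
      = 2 * (B + lam * ∫⁻ x, h x ∂μ) := by ring
    _ ≤ 2 * (A + b * ∫⁻ x in C, h x ∂μ) := by gcongr
    _ = A + A + 2 * (b * ∫⁻ x in C, h x ∂μ) := by ring
    _ ≤ B + B + ∫⁻ z, ENNReal.ofReal ((f z.1 + (-1) * f z.2) ^ 2) ∂J
        + 2 * (b * ∫⁻ x in C, h x ∂μ) := by gcongr
    _ = _ := by ring

/-- A reversible kernel `P` with a drift condition for a symmetric part `J₁` of `μ ⊗ P`, and a
minorization condition on `C`. -/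
structure DriftMinorization (P : Kernel E E) (μ : Measure E) (J₁ : Measure (E × E)) (C : Set E)
    (V : E → ℝ) (lam b δ : ℝ≥0) : Prop where
  symm : (μ ⊗ₘ P).map Prod.swap = μ ⊗ₘ P
  symm_part : J₁.map Prod.swap = J₁
  part_le : J₁ ≤ μ ⊗ₘ P
  measurableSet : MeasurableSet C
  measure_pos : 0 < μ C
  measurable : Measurable V
  pos : ∀ x, 0 < V x
  lam_pos : 0 < lam
  δ_pos : 0 < δ
  drift : ∀ h : E → ℝ≥0∞, Measurable h →
    ∫⁻ z, h z.1 * ENNReal.ofReal (V z.2 / V z.1) ∂J₁ + lam * ∫⁻ x, h x ∂μ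
      ≤ ∫⁻ z, h z.1 ∂J₁ + b * ∫⁻ x in C, h x ∂μ
  minorization : ∀ x ∈ C, δ • μ.restrict C ≤ P x

namespace DriftMinorization

variable {J₁ : Measure (E × E)} {C : Set E} {V : E → ℝ} {lam b δ : ℝ≥0}
  (H : DriftMinorization P μ J₁ C V lam b δ)

include H

theorem dirichlet_drift {f : E → ℝ} (hf : f ∈ bddMeas E) :
    lam * ∫ x, f x * f x ∂μ ≤ (∫ x, f x * f x ∂μ) - (∫ x, f x * op P f x ∂μ)
      + b * ∫ x in C, f x * f x ∂μ := by
  have h := lintegral_sq_le_of_drift H.symm_part H.part_le H.measurable H.pos H.drift hf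
  have hff := mem_bddMeas_mul hf hf
  have hD : (fun z : E × E => (f z.1 + (-1) * f z.2) ^ 2) ∈ bddMeas (E × E) := by
    have h1 := mem_bddMeas_comp hf (measurable_fst (α := E) (β := E))
    have h2 := mem_bddMeas_comp hf (measurable_snd (α := E) (β := E))
    have h3 := (bddMeas (E × E)).add_mem h1 ((bddMeas (E × E)).smul_mem (-1) h2)
    have h4 := mem_bddMeas_mul h3 h3
    simpa [sq] using h4
  have hsq := integral_sq_add_mul H.symm hf (-1) (by norm_num)
  rw [← ofReal_integral_eq_lintegral_ofReal (integrable_of_mem_bddMeas hff _)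
      (ae_of_all _ fun x => mul_self_nonneg _),
    ← ofReal_integral_eq_lintegral_ofReal (integrable_of_mem_bddMeas hff _)
      (ae_of_all _ fun x => mul_self_nonneg _),
    ← ofReal_integral_eq_lintegral_ofReal (integrable_of_mem_bddMeas hD _)
      (ae_of_all _ fun x => sq_nonneg _), hsq] at h
  have n1 : 0 ≤ ∫ x, f x * f x ∂μ := integral_nonneg fun x => mul_self_nonneg _
  have n2 : 0 ≤ ∫ x in C, f x * f x ∂μ := integral_nonneg fun x => mul_self_nonneg _
  have n3 : 0 ≤ 2 * ((∫ x, f x * f x ∂μ) + -1 * ∫ x, f x * op P f x ∂μ) := by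
    rw [← hsq]
    exact integral_nonneg fun x => sq_nonneg _
  have h' := ENNReal.toReal_mono (by finiteness) h
  rw [ENNReal.toReal_add (by finiteness) (by finiteness)] at h'
  simp only [ENNReal.toReal_mul, ENNReal.toReal_ofReal n1, ENNReal.toReal_ofReal n2,
    ENNReal.toReal_ofReal n3, ENNReal.toReal_ofNat, ENNReal.coe_toReal] at h'
  linarith

/-- Restrict both variables to `C` and replace `P x` by `δ μ|_C`; the remaining double integral is
explicit. The sign `σ = -1` serves the gap at `1`, and `σ = 1` the gap at `-1`. -/
theorem dirichlet_minorization {f : E → ℝ} (hf : f ∈ bddMeas E) (σ : ℝ) (hσ : σ ^ 2 = 1) :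
    δ * (μ.real C * (∫ x in C, f x * f x ∂μ) + σ * (∫ x in C, f x ∂μ) ^ 2)
      ≤ (∫ x, f x * f x ∂μ) + σ * ∫ x, f x * op P f x ∂μ := by
  have hff := mem_bddMeas_mul hf hf
  have hD : (fun z : E × E => (f z.1 + σ * f z.2) ^ 2) ∈ bddMeas (E × E) := by
    have h1 := mem_bddMeas_comp hf (measurable_fst (α := E) (β := E))
    have h2 := mem_bddMeas_comp hf (measurable_snd (α := E) (β := E))
    have h3 := (bddMeas (E × E)).add_mem h1 ((bddMeas (E × E)).smul_mem σ h2)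
    have h4 := mem_bddMeas_mul h3 h3
    simpa [sq] using h4
  have hsq := integral_sq_add_mul H.symm hf σ hσ
  rw [integral_compProd_of_mem_bddMeas hD] at hsq
  simp only at hsq
  set S := ∫ x in C, f x ∂μ
  set Q := ∫ x in C, f x * f x ∂μ
  have iff : Integrable (fun x => f x * f x) (μ.restrict C) := integrable_of_mem_bddMeas hff _
  have jf : Integrable f (μ.restrict C) := integrable_of_mem_bddMeas hf _
  have hx : ∀ x, ∫ y in C, (f x + σ * f y) ^ 2 ∂μ
      = μ.real C * (f x * f x) + 2 * σ * S * f x + Q := by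
    intro x
    rw [show (fun y => (f x + σ * f y) ^ 2) = fun y => f x * f x + (2 * σ * f x) * f y
      + 1 * (f y * f y) from by ext y; linear_combination (f y) ^ 2 * hσ]
    refine (integral_add_mul_add_mul (integrable_const _) jf iff _ _).trans ?_
    simp only [integral_const, smul_eq_mul, measureReal_restrict_apply_univ]
    ring
  have hsec : ∀ x, (fun y => (f x + σ * f y) ^ 2) ∈ bddMeas E := fun x =>
    mem_bddMeas_comp hD measurable_prodMk_left
  have hxC : ∀ x ∈ C, δ * (μ.real C * (f x * f x) + 2 * σ * S * f x + Q)
      ≤ ∫ y, (f x + σ * f y) ^ 2 ∂(P x) := by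
    intro x hxC
    rw [← hx]
    have := integral_mono_measure (H.minorization x hxC)
      (ae_of_all _ fun y => sq_nonneg (f x + σ * f y)) (integrable_of_mem_bddMeas (hsec x) _)
    rwa [integral_smul_nnreal_measure] at this
  have hmem : (fun x => ∫ y, (f x + σ * f y) ^ 2 ∂(P x)) ∈ bddMeas E := by
    refine ⟨(hD.1.stronglyMeasurable.integral_kernel_prod_right' (κ := P)).measurable, ?_⟩
    obtain ⟨c, hc⟩ := hD.2
    refine ⟨c, fun x => ?_⟩
    have := norm_integral_le_of_norm_le_const (μ := P x)
      (f := fun y => (f x + σ * f y) ^ 2) (ae_of_all _ fun y => hc (x, y))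
    simpa using this
  have hint : ∫ x in C, (δ : ℝ) * (μ.real C * (f x * f x) + 2 * σ * S * f x + Q) ∂μ
      = δ * (2 * (μ.real C * Q + σ * S ^ 2)) := by
    rw [integral_const_mul]
    rw [show (fun x => μ.real C * (f x * f x) + 2 * σ * S * f x + Q) = fun x => Q
      + (2 * σ * S) * f x + μ.real C * (f x * f x) from by ext; ring]
    rw [integral_add_mul_add_mul (integrable_const _) jf iff]
    simp only [integral_const, smul_eq_mul, measureReal_restrict_apply_univ]
    ring
  have hcomp : ∫ x in C, (δ : ℝ) * (μ.real C * (f x * f x) + 2 * σ * S * f x + Q) ∂μ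
      ≤ ∫ x in C, ∫ y, (f x + σ * f y) ^ 2 ∂(P x) ∂μ := by
    refine setIntegral_mono_on ?_ (integrable_of_mem_bddMeas hmem _) H.measurableSet hxC
    exact (((iff.const_mul _).add (jf.const_mul _)).add (integrable_const _)).const_mul _
  have hset : ∫ x in C, ∫ y, (f x + σ * f y) ^ 2 ∂(P x) ∂μ
      ≤ ∫ x, ∫ y, (f x + σ * f y) ^ 2 ∂(P x) ∂μ :=
    setIntegral_le_integral (integrable_of_mem_bddMeas hmem _)
      (ae_of_all _ fun x => integral_nonneg fun y => sq_nonneg _)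
  rw [hint] at hcomp
  linarith

omit [IsMarkovKernel P] in
theorem measureReal_pos : 0 < μ.real C :=
  ENNReal.toReal_pos H.measure_pos.ne' (measure_ne_top _ _)

omit [IsMarkovKernel P] in
/-- Combines the drift and the minorization inequality. -/
theorem combine {F G X : ℝ} (hX : δ * (μ.real C * G) ≤ X) (hF : lam * F ≤ X + b * G) :
    lam / (1 + b / (δ * μ.real C)) * F ≤ X := by
  have hm := H.measureReal_pos
  have hδ : (0 : ℝ) < δ := H.δ_pos
  have hb : (0 : ℝ) ≤ b := b.2
  have h1 : b * G ≤ b / (δ * μ.real C) * X := by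
    rw [div_mul_eq_mul_div, le_div_iff₀ (by positivity)]
    nlinarith
  have h2 : lam * F ≤ (1 + b / (δ * μ.real C)) * X := by linarith
  rw [div_mul_eq_mul_div, div_le_iff₀ (by positivity)]
  linarith

/-- The right-hand side is `‖f‖² - ⟨f, R f⟩` with `R` the residual operator introduced below, so
this also bounds the form of `R`. -/
theorem coercive {f : E → ℝ} (hf : f ∈ bddMeas E) :
    lam / (1 + b / (δ * μ.real C)) * ∫ x, f x * f x ∂μ
      ≤ (∫ x, f x * f x ∂μ) - (∫ x, f x * op P f x ∂μ) + δ * (∫ x in C, f x ∂μ) ^ 2 := by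
  have h1 := H.dirichlet_drift hf
  have h2 := H.dirichlet_minorization hf (-1) (by norm_num)
  have h3 : 0 ≤ δ * (∫ x in C, f x ∂μ) ^ 2 := by positivity
  exact H.combine (G := ∫ x in C, f x * f x ∂μ) (by linarith) (by linarith)

/-- Subtracting from `f` its mean over `C` kills the term `(∫_C f)²`. The Dirichlet form ignores
constants, and for mean-zero `f` the shift can only increase the `L²` norm. -/
theorem coercive_of_integral_eq_zero {f : E → ℝ} (hf : f ∈ bddMeas E) (h0 : ∫ x, f x ∂μ = 0) :
    lam / (1 + b / (δ * μ.real C)) * ∫ x, f x * f x ∂μ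
      ≤ (∫ x, f x * f x ∂μ) - (∫ x, f x * op P f x ∂μ) := by
  have hm := H.measureReal_pos
  set c := (∫ x in C, f x ∂μ) / μ.real C with hc
  have hg := mem_bddMeas_sub_const hf c
  have h := H.coercive hg
  have e1 := integral_sq_add_mul H.symm hf (-1) (by norm_num)
  have e2 := integral_sq_add_mul H.symm hg (-1) (by norm_num)
  have e3 : ∫ x in C, (f x - c) ∂μ = 0 := by
    rw [integral_sub (integrable_of_mem_bddMeas hf _) (integrable_const _)]
    simp only [integral_const, smul_eq_mul, measureReal_restrict_apply_univ]
    rw [hc]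
    field_simp
    ring
  have e4 : ∫ x, (f x - c) * (f x - c) ∂μ = (∫ x, f x * f x ∂μ) + c ^ 2 := by
    rw [show (fun x => (f x - c) * (f x - c)) = fun x => f x * f x + (-2 * c) * f x
      + c * c from by ext; ring]
    rw [integral_add_mul_add_mul (integrable_of_mem_bddMeas (mem_bddMeas_mul hf hf) _)
      (integrable_of_mem_bddMeas hf _) (integrable_const _), h0]
    simp
    ring
  have e5 : (fun z : E × E => (f z.1 - c + -1 * (f z.2 - c)) ^ 2)
      = fun z => (f z.1 + -1 * f z.2) ^ 2 := by ext; ring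
  rw [e5, e1] at e2
  rw [e3] at h
  have hκ : 0 ≤ (lam : ℝ) / (1 + b / (δ * μ.real C)) := by positivity
  have : lam / (1 + b / (δ * μ.real C)) * ∫ x, f x * f x ∂μ
      ≤ lam / (1 + b / (δ * μ.real C)) * ∫ x, (f x - c) * (f x - c) ∂μ := by
    rw [e4]
    exact mul_le_mul_of_nonneg_left (by nlinarith [sq_nonneg c]) hκ
  linarith

/-- The drift bound is used for `|f|`, whose form satisfies `⟨|f|, P|f|⟩ ≥ -⟨f, P f⟩`. With `σ = 1`
the term `(∫_C f)²` has the good sign, so no mean-zero condition is needed. -/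
theorem coercive_add {f : E → ℝ} (hf : f ∈ bddMeas E) :
    lam / (1 + b / (δ * μ.real C)) * ∫ x, f x * f x ∂μ
      ≤ (∫ x, f x * f x ∂μ) + ∫ x, f x * op P f x ∂μ := by
  have h1 := H.dirichlet_drift (mem_bddMeas_abs hf)
  have h2 := H.dirichlet_minorization hf 1 (by norm_num)
  simp only [abs_mul_abs_self] at h1
  have h3 : 0 ≤ δ * (∫ x in C, f x ∂μ) ^ 2 := by positivity
  have h4 : -(∫ x, f x * op P f x ∂μ) ≤ ∫ x, |f x| * op P (fun x => |f x|) x ∂μ := by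
    rw [integral_mul_op hf hf, integral_mul_op (mem_bddMeas_abs hf) (mem_bddMeas_abs hf),
      ← integral_neg]
    have m1 := mem_bddMeas_comp hf (measurable_fst (α := E) (β := E))
    have m2 := mem_bddMeas_comp hf (measurable_snd (α := E) (β := E))
    refine integral_mono (integrable_of_mem_bddMeas (mem_bddMeas_mul m1 m2) _).neg
      (integrable_of_mem_bddMeas (mem_bddMeas_mul (mem_bddMeas_abs m1) (mem_bddMeas_abs m2)) _) ?_
    intro z
    simp only [← abs_mul]
    exact neg_le_abs _
  exact H.combine (G := ∫ x in C, f x * f x ∂μ) (by linarith) (by linarith)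

end DriftMinorization

end Drift

/-! ### From the `L²` gap to geometric ergodicity with an a.e. finite `M`. -/

section Gap

open scoped NNReal

variable {E : Type*} [MeasurableSpace E] {P : Kernel E E} [IsMarkovKernel P] {μ : Measure E}
  [IsProbabilityMeasure μ]

/-- The residual operator, after removal of the regeneration part `δ 1_C ⊗ μ|_C`. -/
noncomputable def residual (P : Kernel E E) (μ : Measure E) (C : Set E) (δ : ℝ) (f : E → ℝ)
    (x : E) : ℝ :=
  op P f x - C.indicator (fun _ => δ * ∫ y in C, f y ∂μ) x

theorem sqrt_integral_add_le {f g : E → ℝ} (hf : f ∈ bddMeas E) (hg : g ∈ bddMeas E) :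
    √(∫ x, (f x + g x) * (f x + g x) ∂μ) ≤ √(∫ x, f x * f x ∂μ) + √(∫ x, g x * g x ∂μ) := by
  have nf : 0 ≤ ∫ x, f x * f x ∂μ := integral_nonneg fun x => mul_self_nonneg _
  have ng : 0 ≤ ∫ x, g x * g x ∂μ := integral_nonneg fun x => mul_self_nonneg _
  have hcs : ∫ x, f x * g x ∂μ ≤ √(∫ x, f x * f x ∂μ) * √(∫ x, g x * g x ∂μ) := by
    rw [← Real.sqrt_mul nf]
    exact Real.le_sqrt_of_sq_le (sq_integral_mul_le hf hg)
  rw [Real.sqrt_le_left (by positivity)]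
  rw [show (fun x => (f x + g x) * (f x + g x)) = fun x => f x * f x + 2 * (f x * g x)
    + 1 * (g x * g x) from by ext; ring]
  rw [integral_add_mul_add_mul (integrable_of_mem_bddMeas (mem_bddMeas_mul hf hf) _)
    (integrable_of_mem_bddMeas (mem_bddMeas_mul hf hg) _)
    (integrable_of_mem_bddMeas (mem_bddMeas_mul hg hg) _)]
  nlinarith [Real.sq_sqrt nf, Real.sq_sqrt ng]

namespace DriftMinorization

variable {J₁ : Measure (E × E)} {C : Set E} {V : E → ℝ} {lam b δ : ℝ≥0}
  (H : DriftMinorization P μ J₁ C V lam b δ)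

include H

omit [IsProbabilityMeasure μ] in
theorem residual_mem {f : E → ℝ} (hf : f ∈ bddMeas E) : residual P μ C δ f ∈ bddMeas E :=
  (bddMeas E).sub_mem (op_mem_bddMeas hf) (mem_bddMeas_indicator H.measurableSet _)

omit [IsProbabilityMeasure μ] in
-- Positivity of the residual operator is exactly the minorization condition.
theorem residual_nonneg {f : E → ℝ} (hf : f ∈ bddMeas E) (h0 : ∀ x, 0 ≤ f x) (x : E) :
    0 ≤ residual P μ C δ f x := by
  unfold residual
  by_cases hx : x ∈ C
  · have := integral_mono_measure (H.minorization x hx) (ae_of_all _ h0)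
      (integrable_of_mem_bddMeas hf _)
    rw [integral_smul_nnreal_measure] at this
    simp only [hx, Set.indicator_of_mem, sub_nonneg]
    exact this
  · have : 0 ≤ op P f x := integral_nonneg h0
    simpa [hx] using this

omit [IsMarkovKernel P] [IsProbabilityMeasure μ] H in
theorem residual_add_smul [IsMarkovKernel P] [IsFiniteMeasure μ] {f g : E → ℝ}
    (hf : f ∈ bddMeas E) (hg : g ∈ bddMeas E) (c : ℝ) :
    residual P μ C δ (f + c • g) = residual P μ C δ f + c • residual P μ C δ g := by
  have h : ∫ y in C, (f + c • g) y ∂μ = (∫ y in C, f y ∂μ) + c * ∫ y in C, g y ∂μ := by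
    simp only [Pi.add_apply, Pi.smul_apply, smul_eq_mul]
    rw [integral_add (integrable_of_mem_bddMeas hf _)
      ((integrable_of_mem_bddMeas hg _).const_mul c), integral_const_mul]
  ext x
  simp only [residual, op_add_smul hf hg, h]
  simp only [residual, Pi.add_apply, Pi.smul_apply, smul_eq_mul]
  by_cases hx : x ∈ C
  · simp only [hx, Set.indicator_of_mem]
    ring
  · simp [hx]

theorem residual_mono {f g : E → ℝ} (hf : f ∈ bddMeas E) (hg : g ∈ bddMeas E)
    (hfg : ∀ x, f x ≤ g x) (x : E) : residual P μ C δ f x ≤ residual P μ C δ g x := by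
  have h := H.residual_nonneg ((bddMeas E).add_mem hg ((bddMeas E).smul_mem (-1) hf))
    (fun x => by simpa using hfg x) x
  rw [residual_add_smul hg hf] at h
  simpa using h

theorem abs_residual_le {f : E → ℝ} (hf : f ∈ bddMeas E) (x : E) :
    |residual P μ C δ f x| ≤ residual P μ C δ (fun x => |f x|) x := by
  have h1 := H.residual_mono hf (mem_bddMeas_abs hf) (fun x => le_abs_self _) x
  have h2 := H.residual_mono ((bddMeas E).add_mem (bddMeas E).zero_mem
    ((bddMeas E).smul_mem (-1) hf)) (mem_bddMeas_abs hf)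
    (fun x => by simpa using neg_le_abs _) x
  rw [residual_add_smul (bddMeas E).zero_mem hf] at h2
  have h0 : residual P μ C δ (0 : E → ℝ) x = 0 := by
    simp [residual, op]
  simp only [Pi.add_apply, h0, Pi.smul_apply, smul_eq_mul] at h2
  exact abs_le.2 ⟨by linarith, h1⟩

theorem integral_mul_residual {f g : E → ℝ} (hf : f ∈ bddMeas E) (hg : g ∈ bddMeas E) :
    ∫ x, f x * residual P μ C δ g x ∂μ = (∫ x, f x * op P g x ∂μ)
      - δ * ((∫ x in C, f x ∂μ) * ∫ x in C, g x ∂μ) := by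
  have h : ∀ x, f x * residual P μ C δ g x = f x * op P g x
      - C.indicator (fun x => f x * (δ * ∫ y in C, g y ∂μ)) x := by
    intro x
    unfold residual
    by_cases hx : x ∈ C
    · simp [hx]
      ring
    · simp [hx]
  simp_rw [h]
  rw [integral_sub (integrable_of_mem_bddMeas (mem_bddMeas_mul hf (op_mem_bddMeas hg)) _)
    (((integrable_of_mem_bddMeas hf _).mul_const _).indicator H.measurableSet),
    integral_indicator H.measurableSet, integral_mul_const]
  ring

/-- A common `L²` contraction rate of the residual operator, and of `P` on mean-zero functions. -/
theorem exists_contraction : ∃ ρ : ℝ, 0 < ρ ∧ ρ < 1 ∧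
    (∀ f ∈ bddMeas E, ∫ x, residual P μ C δ f x * residual P μ C δ f x ∂μ
      ≤ ρ ^ 2 * ∫ x, f x * f x ∂μ) ∧
    (∀ f ∈ bddMeas E, ∫ x, f x ∂μ = 0 → ∫ x, op P f x * op P f x ∂μ
      ≤ ρ ^ 2 * ∫ x, f x * f x ∂μ) := by
  set κ : ℝ := lam / (1 + b / (δ * μ.real C)) with hκ
  have hκ0 : 0 < κ := by
    have h1 : (0 : ℝ) < lam := H.lam_pos
    have h2 := H.measureReal_pos
    have h3 : (0 : ℝ) < δ := H.δ_pos
    positivity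
  -- The value `1 / 2` only keeps the rate positive.
  set ρ : ℝ := max (1 / 2) (1 - κ)
  have hρ0 : 0 < ρ := lt_max_of_lt_left (by norm_num)
  have hρ1 : ρ < 1 := max_lt (by norm_num) (by linarith)
  have hκρ : 1 - κ ≤ ρ := le_max_right _ _
  refine ⟨ρ, hρ0, hρ1, fun f hf => ?_, fun f hf h0 => ?_⟩
  · refine sq_norm_le_of_quadratic_le le_rfl (fun f hf => H.residual_mem hf)
      (fun f hf g hg c => residual_add_smul hf hg c) (fun f hf g hg => ?_) hρ0
      (fun f hf => ?_) hf
    · rw [H.integral_mul_residual hf hg, H.integral_mul_residual hg hf,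
        integral_mul_op_comm H.symm hf hg]
      ring
    · have ha := mem_bddMeas_abs hf
      have h1 := H.coercive ha
      have h2 := H.integral_mul_residual ha ha
      simp only [abs_mul_abs_self] at h1
      -- A positive operator has its form at `f` bounded by its form at `|f|`, so the upper bound
      -- from `coercive` controls both signs.
      have h3 : |∫ x, f x * residual P μ C δ f x ∂μ|
          ≤ ∫ x, |f x| * residual P μ C δ (fun x => |f x|) x ∂μ := by
        refine abs_integral_le_integral_abs.trans ?_
        refine integral_mono (integrable_of_mem_bddMeas (mem_bddMeas_abs (mem_bddMeas_mul hf
          (H.residual_mem hf))) _) (integrable_of_mem_bddMeas (mem_bddMeas_mul ha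
          (H.residual_mem ha)) _) (fun x => ?_)
        simp only [abs_mul]
        exact mul_le_mul_of_nonneg_left (H.abs_residual_le hf x) (abs_nonneg _)
      have h4 : 0 ≤ ∫ x, f x * f x ∂μ := integral_nonneg fun x => mul_self_nonneg _
      have h5 := mul_le_mul_of_nonneg_right hκρ h4
      nlinarith
  · let D : Submodule ℝ (E → ℝ) :=
      { carrier := {f | f ∈ bddMeas E ∧ ∫ x, f x ∂μ = 0}
        add_mem' := by
          rintro f g ⟨hf, h⟩ ⟨hg, h'⟩
          refine ⟨(bddMeas E).add_mem hf hg, ?_⟩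
          simp only [Pi.add_apply]
          rw [integral_add (integrable_of_mem_bddMeas hf _) (integrable_of_mem_bddMeas hg _),
            h, h', add_zero]
        zero_mem' := ⟨(bddMeas E).zero_mem, by simp⟩
        smul_mem' := by
          rintro c f ⟨hf, h⟩
          refine ⟨(bddMeas E).smul_mem c hf, ?_⟩
          simp only [Pi.smul_apply, smul_eq_mul]
          rw [integral_const_mul, h, mul_zero] }
    refine sq_norm_le_of_quadratic_le (D := D) (fun f hf => hf.1)
      (fun f hf => ⟨op_mem_bddMeas hf.1, ?_⟩)
      (fun f hf g hg c => op_add_smul hf.1 hg.1 c)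
      (fun f hf g hg => integral_mul_op_comm H.symm hf.1 hg.1) hρ0
      (fun f hf => ?_) ⟨hf, h0⟩
    · rw [integral_op H.symm hf.1, hf.2]
    · have h1 := H.coercive_of_integral_eq_zero hf.1 hf.2
      have h2 := H.coercive_add hf.1
      have h4 : 0 ≤ ∫ x, f x * f x ∂μ := integral_nonneg fun x => mul_self_nonneg _
      have h5 := mul_le_mul_of_nonneg_right hκρ h4
      exact abs_le.2 ⟨by nlinarith, by nlinarith⟩

end DriftMinorization

/-- Dominating functions for `|P^n f - μ(f)|`, `|f| ≤ 1`. -/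
noncomputable def dominating (P : Kernel E E) (μ : Measure E) (C : Set E) (δ ρ : ℝ) :
    ℕ → E → ℝ
  | 0 => fun _ => 2
  | n + 1 => residual P μ C δ (dominating P μ C δ ρ n)
      + C.indicator fun _ => δ * (2 * ρ ^ n)

namespace DriftMinorization

variable {J₁ : Measure (E × E)} {C : Set E} {V : E → ℝ} {lam b δ : ℝ≥0}
  (H : DriftMinorization P μ J₁ C V lam b δ)

include H

omit [IsProbabilityMeasure μ] in
theorem dominating_mem (ρ : ℝ) (n : ℕ) : dominating P μ C δ ρ n ∈ bddMeas E := by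
  induction n with
  | zero => exact mem_bddMeas_const 2
  | succ n ih =>
    exact (bddMeas E).add_mem (H.residual_mem ih) (mem_bddMeas_indicator H.measurableSet _)

/-- Split `P` into residual and rank-one part. Monotonicity handles the first; the second sees only
`|∫_C P^n f| ≤ ‖P^n f‖₂ ≤ 2ρ^n`. The resulting bound is independent of `f`, as total variation
requires. -/
theorem abs_iterate_op_le_dominating {ρ : ℝ}
    (hP : ∀ f ∈ bddMeas E, ∫ x, f x ∂μ = 0 → ∫ x, op P f x * op P f x ∂μ
      ≤ ρ ^ 2 * ∫ x, f x * f x ∂μ) (hρ : 0 < ρ)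
    {f : E → ℝ} (hf : f ∈ bddMeas E) (h0 : ∫ x, f x ∂μ = 0) (h2 : ∀ x, |f x| ≤ 2) (n : ℕ) :
    ∀ x, |(op P)^[n] f x| ≤ dominating P μ C δ ρ n x := by
  have hmean : ∀ n, ∫ x, (op P)^[n] f x ∂μ = 0 := by
    intro n
    induction n with
    | zero => exact h0
    | succ n ih =>
      rw [Function.iterate_succ_apply', integral_op H.symm (iterate_op_mem_bddMeas hf n), ih]
  have hnorm : ∀ n, ∫ x, (op P)^[n] f x * (op P)^[n] f x ∂μ ≤ (2 * ρ ^ n) ^ 2 := by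
    intro n
    induction n with
    | zero =>
      have : ∫ x, f x * f x ∂μ ≤ ∫ _, (4 : ℝ) ∂μ :=
        integral_mono (integrable_of_mem_bddMeas (mem_bddMeas_mul hf hf) _)
          (integrable_const _) fun x => by
            have := abs_le.1 (h2 x)
            simp only
            nlinarith
      simpa using this.trans (by norm_num)
    | succ n ih =>
      rw [Function.iterate_succ_apply']
      refine (hP _ (iterate_op_mem_bddMeas hf n) (hmean n)).trans ?_
      calc _ ≤ ρ ^ 2 * (2 * ρ ^ n) ^ 2 := by gcongr
        _ = _ := by ring
  induction n with
  | zero => exact h2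
  | succ n ih =>
    intro x
    have hu := iterate_op_mem_bddMeas (P := P) hf n
    set u := (op P)^[n] f with hudef
    rw [Function.iterate_succ_apply', ← hudef]
    have hint : |∫ y in C, u y ∂μ| ≤ 2 * ρ ^ n := by
      refine abs_integral_le_integral_abs.trans ?_
      refine (setIntegral_le_integral (integrable_of_mem_bddMeas (mem_bddMeas_abs hu) _)
        (ae_of_all _ fun x => abs_nonneg _)).trans ?_
      refine abs_le_of_sq_le_sq' ?_ (by positivity) |>.2
      refine (sq_integral_le (mem_bddMeas_abs hu)).trans ?_
      simp only [abs_mul_abs_self]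
      exact hnorm n
    have h3 : op P u x = residual P μ C δ u x + C.indicator (fun _ => δ * ∫ y in C, u y ∂μ) x := by
      simp [residual]
    rw [h3]
    refine (abs_add_le _ _).trans ?_
    refine add_le_add ((H.abs_residual_le hu x).trans
      (H.residual_mono (mem_bddMeas_abs hu) (H.dominating_mem ρ n) ih x)) ?_
    by_cases hx : x ∈ C
    · simp only [hx, Set.indicator_of_mem, abs_mul, NNReal.abs_eq]
      gcongr
    · simp [hx]

omit [IsProbabilityMeasure μ] in
theorem dominating_nonneg {ρ : ℝ} (hρ : 0 < ρ) (n : ℕ) (x : E) :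
    0 ≤ dominating P μ C δ ρ n x := by
  induction n generalizing x with
  | zero => simp [dominating]
  | succ n ih =>
    refine add_nonneg (H.residual_nonneg (H.dominating_mem ρ n) ih x)
      (Set.indicator_nonneg (fun _ _ => by positivity) _)

/-- In `L²`, one step of the recursion multiplies by at most `ρ` and adds at most `2δρ^n`, which
produces a factor linear in `n`. -/
theorem integral_dominating_le {ρ : ℝ} (hρ : 0 < ρ)
    (hR : ∀ f ∈ bddMeas E, ∫ x, residual P μ C δ f x * residual P μ C δ f x ∂μ
      ≤ ρ ^ 2 * ∫ x, f x * f x ∂μ) (n : ℕ) :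
    ∫ x, dominating P μ C δ ρ n x ∂μ ≤ ρ ^ n * (2 + 2 * δ / ρ * n) := by
  have key : √(∫ x, dominating P μ C δ ρ n x * dominating P μ C δ ρ n x ∂μ)
      ≤ ρ ^ n * (2 + 2 * δ / ρ * n) := by
    induction n with
    | zero =>
      simp [dominating]
    | succ n ih =>
      have hw := H.dominating_mem ρ n
      refine (sqrt_integral_add_le (H.residual_mem hw)
        (mem_bddMeas_indicator H.measurableSet _)).trans ?_
      have h1 : √(∫ x, residual P μ C δ (dominating P μ C δ ρ n) x
          * residual P μ C δ (dominating P μ C δ ρ n) x ∂μ)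
          ≤ ρ * (ρ ^ n * (2 + 2 * δ / ρ * n)) := by
        refine (Real.sqrt_le_sqrt (hR _ hw)).trans ?_
        rw [Real.sqrt_mul (by positivity), Real.sqrt_sq hρ.le]
        gcongr
      have h2 : √(∫ x, C.indicator (fun _ => (δ : ℝ) * (2 * ρ ^ n)) x
          * C.indicator (fun _ => (δ : ℝ) * (2 * ρ ^ n)) x ∂μ) ≤ δ * (2 * ρ ^ n) := by
        rw [Real.sqrt_le_left (by positivity)]
        have : ∫ x, C.indicator (fun _ => (δ : ℝ) * (2 * ρ ^ n)) x
            * C.indicator (fun _ => (δ : ℝ) * (2 * ρ ^ n)) x ∂μ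
            ≤ ∫ _, ((δ : ℝ) * (2 * ρ ^ n)) ^ 2 ∂μ := by
          have hm := mem_bddMeas_indicator H.measurableSet ((δ : ℝ) * (2 * ρ ^ n))
          refine integral_mono (integrable_of_mem_bddMeas (mem_bddMeas_mul hm hm) _)
            (integrable_const _) fun x => ?_
          by_cases hx : x ∈ C
          · simp [hx, sq]
          · simp only [hx, not_false_eq_true, Set.indicator_of_notMem, mul_zero]
            positivity
        simpa using this
      refine (add_le_add h1 h2).trans (le_of_eq ?_)
      push_cast
      field_simp
      ring
  refine le_trans ?_ key
  exact Real.le_sqrt_of_sq_le (sq_integral_le (H.dominating_mem ρ n))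

/-- Drift and minorization for a reversible kernel imply geometric ergodicity. -/
theorem geometricallyErgodic : GeometricallyErgodic P μ := by
  obtain ⟨ρ, hρ0, hρ1, hR, hP⟩ := H.exists_contraction
  -- Any rate strictly between `ρ` and `1` absorbs the linear factor, so `∑ w_n r⁻ⁿ` is integrable
  -- and hence a.e. finite.
  set r : ℝ := (ρ + 1) / 2 with hr
  have hr0 : 0 < r := by linarith
  have hrρ : ρ < r := by linarith
  set w := dominating P μ C δ ρ with hw
  refine ⟨r, fun x => ∑' n, ENNReal.ofReal (w n x * (r⁻¹) ^ n), hr0, by linarith, ?_, ?_⟩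
  · refine ae_lt_top' ?_ ?_
    · exact (Measurable.tsum fun n =>
        ((H.dominating_mem ρ n).1.mul_const _).ennreal_ofReal).aemeasurable
    · rw [lintegral_tsum fun n =>
        ((H.dominating_mem ρ n).1.mul_const _).ennreal_ofReal.aemeasurable]
      have hle : ∀ n, ∫⁻ x, ENNReal.ofReal (w n x * (r⁻¹) ^ n) ∂μ
          ≤ ENNReal.ofReal (2 * (ρ / r) ^ n + 2 * δ / ρ * (n * (ρ / r) ^ n)) := by
        intro n
        rw [← ofReal_integral_eq_lintegral_ofReal
          ((integrable_of_mem_bddMeas (H.dominating_mem ρ n) _).mul_const _)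
          (ae_of_all _ fun x => mul_nonneg (H.dominating_nonneg hρ0 n x) (by positivity)),
          integral_mul_const]
        refine ENNReal.ofReal_le_ofReal ?_
        calc _ ≤ ρ ^ n * (2 + 2 * δ / ρ * n) * r⁻¹ ^ n := by
              gcongr
              exact H.integral_dominating_le hρ0 hR n
          _ = _ := by rw [div_pow, inv_pow]; field_simp
      have hq : ‖ρ / r‖ < 1 := by
        rw [Real.norm_of_nonneg (by positivity)]
        exact (div_lt_one hr0).2 hrρ
      have hs : Summable fun n : ℕ => 2 * (ρ / r) ^ n + 2 * δ / ρ * (n * (ρ / r) ^ n) := by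
        refine ((summable_geometric_of_norm_lt_one hq).mul_left 2).add (Summable.mul_left _ ?_)
        simpa using summable_pow_mul_geometric_of_norm_lt_one 1 hq
      exact ((ENNReal.tsum_le_tsum hle).trans_lt hs.tsum_ofReal_lt_top).ne
  · intro x n
    unfold tvDist
    refine iSup_le fun f => iSup_le fun hf => iSup_le fun hf1 => ?_
    have hfb : f ∈ bddMeas E := ⟨hf, 1, hf1⟩
    set c := ∫ y, f y ∂μ with hc
    have hc1 : |c| ≤ 1 := by
      have := norm_integral_le_of_norm_le_const (μ := μ) (f := f) (ae_of_all _ hf1)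
      simpa using this
    have hfc := mem_bddMeas_sub_const hfb c
    have h0 : ∫ y, (f y - c) ∂μ = 0 := by
      rw [integral_sub (integrable_of_mem_bddMeas hfb _) (integrable_const _)]
      simp [hc]
    have h2 : ∀ y, |f y - c| ≤ 2 := fun y => (abs_sub _ _).trans (by linarith [hf1 y])
    have hmain := H.abs_iterate_op_le_dominating hP hρ0 hfc h0 h2 n x
    rw [iterate_op_sub_const hfb] at hmain
    rw [integral_pow_eq hfb]
    calc ENNReal.ofReal |(op P)^[n] f x - c| ≤ ENNReal.ofReal (w n x) :=
          ENNReal.ofReal_le_ofReal hmain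
      _ = ENNReal.ofReal (w n x * r⁻¹ ^ n) * ENNReal.ofReal (r ^ n) := by
          rw [← ENNReal.ofReal_mul (mul_nonneg (H.dominating_nonneg hρ0 n x) (by positivity)),
            mul_assoc, ← mul_pow, inv_mul_cancel₀ hr0.ne', one_pow, mul_one]
      _ ≤ _ := by
          gcongr
          exact ENNReal.le_tsum n

end DriftMinorization

end Gap

/-! ### Lebesgue density of the standard Gaussian. -/

section Gaussian

variable {d : ℕ}

/-- Normalising constant of the standard Gaussian density. -/
noncomputable def gaussConst (d : ℕ) : ℝ := (∫ p : X d, Real.exp (-(1 / 2) * ‖p‖ ^ 2))⁻¹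

theorem integral_exp_neg_sq_pos : 0 < ∫ p : X d, Real.exp (-(1 / 2) * ‖p‖ ^ 2) := by
  rw [GaussianFourier.integral_rexp_neg_mul_sq_norm (by norm_num)]
  positivity

theorem gaussConst_pos : 0 < gaussConst d := inv_pos.2 integral_exp_neg_sq_pos

theorem integrable_exp_neg_sq : Integrable fun p : X d => Real.exp (-(1 / 2) * ‖p‖ ^ 2) :=
  Integrable.of_integral_ne_zero integral_exp_neg_sq_pos.ne'

/-- The Lebesgue density of the standard Gaussian law. -/
noncomputable def gaussDensity (p : X d) : ℝ := gaussConst d * Real.exp (-(1 / 2) * ‖p‖ ^ 2)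

theorem measurable_gaussDensity : Measurable (gaussDensity (d := d)) := by
  unfold gaussDensity
  fun_prop

theorem gaussDensity_pos (p : X d) : 0 < gaussDensity p :=
  mul_pos gaussConst_pos (Real.exp_pos _)

/-- Both measures are finite, so comparing characteristic functions suffices. -/
theorem stdGaussian_eq_withDensity :
    stdGaussian (X d) = volume.withDensity fun p => ENNReal.ofReal (gaussDensity p) := by
  have hfin : IsFiniteMeasure (volume.withDensity fun p : X d => ENNReal.ofReal (gaussDensity p)) :=
    isFiniteMeasure_withDensity_ofReal (integrable_exp_neg_sq.const_mul _).2
  refine Measure.ext_of_charFun ?_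
  ext t
  rw [charFun_stdGaussian, charFun_apply, integral_withDensity_eq_integral_toReal_smul
    measurable_gaussDensity.ennreal_ofReal (ae_of_all _ fun _ => ENNReal.ofReal_lt_top)]
  have h1 := GaussianFourier.integral_cexp_neg_mul_sq_norm_add (V := X d) (b := (1 / 2 : ℂ))
    (by norm_num) Complex.I t
  have h2 := GaussianFourier.integral_rexp_neg_mul_sq_norm (V := X d) (b := (1 / 2 : ℝ))
    (by norm_num)
  have h3 : ∀ p : X d, (ENNReal.ofReal (gaussDensity p)).toReal
      • Complex.exp (inner ℝ p t * Complex.I)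
      = (gaussConst d : ℂ) * Complex.exp (-(1 / 2 : ℂ) * ‖p‖ ^ 2
        + Complex.I * (inner ℝ t p : ℝ)) := by
    intro p
    rw [ENNReal.toReal_ofReal (gaussDensity_pos p).le, Complex.exp_add, real_inner_comm]
    simp only [gaussDensity, Complex.real_smul]
    push_cast
    ring_nf
  simp_rw [h3]
  rw [integral_const_mul, h1, gaussConst, h2]
  have h4 : (Complex.I ^ 2 * (‖t‖ : ℂ) ^ 2 / (4 * (1 / 2))) = -(‖t‖ : ℂ) ^ 2 / 2 := by
    rw [Complex.I_sq]; ring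
  rw [h4, ← mul_assoc]
  have h5 : (((Real.pi / (1 / 2)) ^ ((Module.finrank ℝ (X d) : ℝ) / 2))⁻¹ : ℝ)
      * ((Real.pi : ℂ) / (1 / 2)) ^ ((Module.finrank ℝ (X d) : ℂ) / 2) = 1 := by
    have h6 : ((Real.pi : ℂ) / (1 / 2)) ^ ((Module.finrank ℝ (X d) : ℂ) / 2)
        = (((Real.pi / (1 / 2)) ^ ((Module.finrank ℝ (X d) : ℝ) / 2) : ℝ) : ℂ) := by
      rw [Complex.ofReal_cpow (by positivity)]
      push_cast
      rfl
    rw [h6, ← Complex.ofReal_mul, inv_mul_cancel₀ (by positivity), Complex.ofReal_one]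
  rw [h5, one_mul]

end Gaussian

/-! ### Volume preservation, time reversal and detailed balance. -/

section Leapfrog

variable {d : ℕ} (U : X d → ℝ) (ε : ℝ)

/-- A kick is a shear: for fixed position it translates the momentum. -/
theorem measurePreserving_kick : MeasurePreserving (kick U ε) := by
  refine MeasurePreserving.skew_product (g := fun x p => p - (ε / 2) • gradient U x)
    (MeasurePreserving.id _) ?_ (ae_of_all _ fun x => ?_)
  · exact measurable_snd.sub
      (((measurable_gradient U).comp measurable_fst).const_smul (ε / 2))
  · exact (measurePreserving_sub_right volume _).map_eq

theorem measurePreserving_drift : MeasurePreserving (drift (d := d) ε) := by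
  have h : MeasurePreserving (fun z : X d × X d => (z.1, z.2 + ε • z.1))
      (volume.prod volume) (volume.prod volume) := by
    refine MeasurePreserving.skew_product (g := fun p x => x + ε • p)
      (MeasurePreserving.id _) ?_ (ae_of_all _ fun x => ?_)
    · exact measurable_snd.add (measurable_fst.const_smul ε)
    · exact (measurePreserving_add_right volume _).map_eq
  exact (Measure.measurePreserving_swap.comp (h.comp Measure.measurePreserving_swap))

theorem measurePreserving_leapfrog (L : ℕ) : MeasurePreserving (leapfrog U ε L) :=
  ((measurePreserving_kick U ε).comp
    ((measurePreserving_drift ε).comp (measurePreserving_kick U ε))).iterate L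

/-- Momentum flip. -/
def flip (z : X d × X d) : X d × X d := (z.1, -z.2)

theorem flip_flip (z : X d × X d) : flip (flip z) = z := by simp [flip]

theorem measurePreserving_flip : MeasurePreserving (flip (d := d)) :=
  (MeasurePreserving.id _).prod (Measure.measurePreserving_neg _)

theorem hamiltonian_flip (z : X d × X d) : hamiltonian U (flip z) = hamiltonian U z := by
  simp [hamiltonian, flip]

/-- The step is the palindrome kick, drift, kick, and each factor is inverted by conjugation with
the flip. -/
theorem flip_leapfrogStep (z : X d × X d) :
    flip (leapfrogStep U ε (flip (leapfrogStep U ε z))) = z := by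
  obtain ⟨x, p⟩ := z
  simp only [flip, leapfrogStep, kick, drift]
  refine Prod.ext ?_ ?_
  · simp only
    module
  · have : x + ε • (p - (ε / 2) • gradient U x)
      + ε • (-(p - (ε / 2) • gradient U x - (ε / 2) • gradient U (x + ε • (p - (ε / 2) •
        gradient U x))) - (ε / 2) • gradient U (x + ε • (p - (ε / 2) • gradient U x))) = x := by
      module
    simp only [this]
    module

theorem flip_leapfrog (L : ℕ) (z : X d × X d) :
    flip (leapfrog U ε L (flip (leapfrog U ε L z))) = z := by
  have h : Function.LeftInverse (fun z => flip (leapfrogStep U ε (flip z))) (leapfrogStep U ε) :=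
    flip_leapfrogStep U ε
  have hs : Function.Semiconj flip (fun z => flip (leapfrogStep U ε (flip z)))
      (leapfrogStep U ε) := fun z => flip_flip _
  have h1 := h.iterate L z
  have h2 := (hs.iterate_right L).eq (leapfrog U ε L z)
  rw [leapfrog] at h2 ⊢
  rw [h1] at h2
  rw [← h2, flip_flip]

/-- Acceptance probability. -/
noncomputable def accept (L : ℕ) (z : X d × X d) : ℝ :=
  min 1 (Real.exp (hamiltonian U z - hamiltonian U (leapfrog U ε L z)))

theorem accept_nonneg (L : ℕ) (z : X d × X d) : 0 ≤ accept U ε L z :=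
  le_min zero_le_one (Real.exp_pos _).le

theorem accept_le_one (L : ℕ) (z : X d × X d) : accept U ε L z ≤ 1 := min_le_left _ _

variable {U}

theorem measurable_accept (hU : Measurable U) (L : ℕ) : Measurable (accept U ε L) :=
  measurable_const.min ((measurable_hamiltonian hU).sub
    ((measurable_hamiltonian hU).comp (measurable_leapfrog U ε L))).exp

theorem measurable_accept_uncurry (hU : Measurable U) :
    Measurable fun q : (X d × X d) × ℕ => accept U ε q.2 q.1 :=
  measurable_from_prod_countable_left fun L => measurable_accept ε hU L

theorem measurable_leapfrog_uncurry :
    Measurable fun q : (X d × X d) × ℕ => leapfrog U ε q.2 q.1 :=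
  measurable_from_prod_countable_left fun L => measurable_leapfrog U ε L

/-- Detailed balance for a fixed number of leapfrog steps. -/
theorem lintegral_detailed_balance (hU : Measurable U) (L : ℕ) {c : ℝ} (hc : 0 ≤ c)
    {G : X d × X d → ℝ≥0∞} (hG : Measurable G) :
    ∫⁻ z, ENNReal.ofReal (c * Real.exp (-hamiltonian U z)) * (ENNReal.ofReal (accept U ε L z)
        * G (z.1, (leapfrog U ε L z).1))
      = ∫⁻ z, ENNReal.ofReal (c * Real.exp (-hamiltonian U z)) * (ENNReal.ofReal (accept U ε L z)
        * G ((leapfrog U ε L z).1, z.1)) := by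
  have hH := measurable_hamiltonian hU
  have hΦ := measurable_leapfrog U ε L
  -- Target weight times acceptance is the minimum of two Boltzmann weights, symmetric in the two
  -- endpoints. The change of variables is then the volume-preserving involution "leapfrog, then
  -- flip", which exchanges the endpoints.
  have hmin : ∀ z, ENNReal.ofReal (c * Real.exp (-hamiltonian U z))
      * ENNReal.ofReal (accept U ε L z) = ENNReal.ofReal (c * min (Real.exp (-hamiltonian U z))
        (Real.exp (-hamiltonian U (leapfrog U ε L z)))) := by
    intro z
    rw [← ENNReal.ofReal_mul (by positivity), accept, mul_assoc,
      mul_min_of_nonneg _ _ (Real.exp_pos _).le, mul_one, ← Real.exp_add]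
    ring_nf
  simp_rw [← mul_assoc, hmin]
  have hΨ : MeasurePreserving (fun z => flip (leapfrog U ε L z)) :=
    measurePreserving_flip.comp (measurePreserving_leapfrog U ε L)
  have hmeas : Measurable fun z : X d × X d => ENNReal.ofReal (c *
      min (Real.exp (-hamiltonian U z)) (Real.exp (-hamiltonian U (leapfrog U ε L z))))
      * G (z.1, (leapfrog U ε L z).1) := by
    refine Measurable.mul ?_ (hG.comp (measurable_fst.prodMk hΦ.fst))
    exact ((hH.neg.exp.min (hH.comp hΦ).neg.exp).const_mul c).ennreal_ofReal
  rw [← hΨ.lintegral_comp hmeas]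
  refine lintegral_congr fun z => ?_
  have h1 : hamiltonian U (leapfrog U ε L (flip (leapfrog U ε L z))) = hamiltonian U z := by
    rw [← hamiltonian_flip, flip_leapfrog]
  have h2 : (leapfrog U ε L (flip (leapfrog U ε L z))).1 = z.1 :=
    (congrArg Prod.fst (flip_leapfrog U ε L z) :)
  simp only [hamiltonian_flip, h1, h2, min_comm]
  rfl

end Leapfrog

/-! ### The joint law of two successive states and its reversibility. -/

section Flow

variable {d : ℕ}

/-- The proposal position, next to the current one. -/
noncomputable def proposal (U : X d → ℝ) (ε : ℝ) (q : X d × X d × ℕ × ℝ) : X d × X d :=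
  (q.1, (leapfrog U ε q.2.2.1 (q.1, q.2.1)).1)

/-- The event that the proposal is accepted. -/
def acceptSet (U : X d → ℝ) (ε : ℝ) : Set (X d × X d × ℕ × ℝ) :=
  {q | q.2.2.2 < Real.exp (hamiltonian U (q.1, q.2.1)
    - hamiltonian U (leapfrog U ε q.2.2.1 (q.1, q.2.1)))}

theorem measurable_leapfrog_input (U : X d → ℝ) (ε : ℝ) :
    Measurable fun q : X d × X d × ℕ × ℝ => leapfrog U ε q.2.2.1 (q.1, q.2.1) := by
  have h2 : Measurable
      (fun q : X d × X d × ℕ × ℝ => (((q.1, q.2.1), q.2.2.1) : (X d × X d) × ℕ)) := by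
    fun_prop
  exact (measurable_leapfrog_uncurry (U := U) ε).comp h2

theorem measurable_proposal (U : X d → ℝ) (ε : ℝ) : Measurable (proposal U ε) :=
  measurable_fst.prodMk (measurable_leapfrog_input U ε).fst

theorem measurableSet_acceptSet {U : X d → ℝ} (hU : Measurable U) (ε : ℝ) :
    MeasurableSet (acceptSet U ε) := by
  have hz : Measurable (fun q : X d × X d × ℕ × ℝ => (q.1, q.2.1)) := by fun_prop
  have hu : Measurable (fun q : X d × X d × ℕ × ℝ => q.2.2.2) := by fun_prop
  have hH := measurable_hamiltonian hU
  exact measurableSet_lt hu ((hH.comp hz).sub (hH.comp (measurable_leapfrog_input U ε))).exp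

/-- The part of the joint law of two successive states that comes from accepted proposals, with
`ℒ` the (possibly incomplete) law of the number of leapfrog steps. -/
noncomputable def acceptedFlow (π : X d → ℝ) (ε : ℝ) (ℒ : Measure ℕ) : Measure (X d × X d) :=
  (((target π).prod (inputLaw d ℒ)).restrict (acceptSet (potential π) ε)).map
    (proposal (potential π) ε)

theorem volume_Icc_lt {t : ℝ} :
    volume.restrict (Set.Icc (0 : ℝ) 1) (Set.Iio t) = ENNReal.ofReal (min 1 t) := by
  rw [Measure.restrict_apply measurableSet_Iio]
  rcases le_or_gt t 1 with h | h
  · have : Set.Iio t ∩ Set.Icc (0 : ℝ) 1 = Set.Ico 0 t := by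
      ext u
      simp only [Set.mem_inter_iff, Set.mem_Iio, Set.mem_Icc, Set.mem_Ico]
      constructor
      · rintro ⟨h1, h2, h3⟩; exact ⟨h2, h1⟩
      · rintro ⟨h1, h2⟩; exact ⟨h2, h1, by linarith⟩
    rw [this, Real.volume_Ico, min_eq_right h, sub_zero]
  · have : Set.Iio t ∩ Set.Icc (0 : ℝ) 1 = Set.Icc 0 1 := by
      ext u
      simp only [Set.mem_inter_iff, Set.mem_Iio, Set.mem_Icc, and_iff_right_iff_imp]
      rintro ⟨h1, h2⟩; linarith
    rw [this, Real.volume_Icc, min_eq_left h.le, sub_zero]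

/-- Integrating out the uniform variable turns the acceptance event into the weight `accept`. -/
theorem lintegral_inputLaw_accept {U : X d → ℝ} (hU : Measurable U) (ε : ℝ) (ℒ : Measure ℕ)
    [SFinite ℒ] (x : X d) {g : X d × ℕ → ℝ≥0∞} (hg : Measurable g) :
    ∫⁻ θ in {θ | (x, θ) ∈ acceptSet U ε}, g (θ.1, θ.2.1) ∂(inputLaw d ℒ)
      = ∫⁻ p, ∫⁻ L, ENNReal.ofReal (accept U ε L (x, p)) * g (p, L) ∂ℒ ∂(stdGaussian (X d)) := by
  have hm : MeasurableSet {θ | (x, θ) ∈ acceptSet U ε} :=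
    measurable_prodMk_left (measurableSet_acceptSet hU ε)
  have hgm : Measurable fun θ : X d × ℕ × ℝ => g (θ.1, θ.2.1) := hg.comp (by fun_prop)
  rw [← lintegral_indicator hm]
  have hi := hgm.indicator hm
  unfold inputLaw
  rw [lintegral_prod _ hi.aemeasurable]
  refine lintegral_congr fun p => ?_
  refine (lintegral_prod _ (hi.comp measurable_prodMk_left).aemeasurable).trans ?_
  refine lintegral_congr fun L => ?_
  set t := Real.exp (hamiltonian U (x, p) - hamiltonian U (leapfrog U ε L (x, p))) with ht
  have h : ∀ u : ℝ, {θ | (x, θ) ∈ acceptSet U ε}.indicator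
      (fun θ : X d × ℕ × ℝ => g (θ.1, θ.2.1)) (p, L, u)
      = (Set.Iio t).indicator (fun _ => g (p, L)) u := by
    intro u
    by_cases hu : u < t
    · rw [Set.indicator_of_mem (show u ∈ Set.Iio t from hu), Set.indicator_of_mem]
      exact hu
    · rw [Set.indicator_of_notMem (show u ∉ Set.Iio t from hu), Set.indicator_of_notMem]
      exact hu
  refine (lintegral_congr h).trans ?_
  rw [lintegral_indicator_const measurableSet_Iio, volume_Icc_lt, mul_comm]
  rfl

variable {π : X d → ℝ} (hπ : Measurable π) (ε : ℝ) (ℒ : Measure ℕ)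

include hπ

theorem lintegral_acceptedFlow [SFinite ℒ] [SFinite (target π)] {G : X d × X d → ℝ≥0∞}
    (hG : Measurable G) :
    ∫⁻ z, G z ∂(acceptedFlow π ε ℒ)
      = ∫⁻ x, ∫⁻ p, ∫⁻ L, ENNReal.ofReal (accept (potential π) ε L (x, p))
        * G (x, (leapfrog (potential π) ε L (x, p)).1) ∂ℒ ∂(stdGaussian (X d)) ∂(target π) := by
  have hU := measurable_potential hπ
  have hA := measurableSet_acceptSet hU ε
  have : SFinite (inputLaw d ℒ) := by unfold inputLaw; infer_instance
  have hGp := hG.comp (measurable_proposal (potential π) ε)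
  rw [acceptedFlow, lintegral_map hG (measurable_proposal _ ε), ← lintegral_indicator hA]
  refine (lintegral_prod _ (hGp.indicator hA).aemeasurable).trans ?_
  refine lintegral_congr fun x => ?_
  have hg : Measurable fun r : X d × ℕ => G (x, (leapfrog (potential π) ε r.2 (x, r.1)).1) := by
    refine hG.comp (measurable_const.prodMk ((measurable_leapfrog_uncurry (U := potential π) ε).comp
      (by fun_prop : Measurable fun r : X d × ℕ => (((x, r.1), r.2) : (X d × X d) × ℕ))).fst)
  rw [← lintegral_inputLaw_accept hU ε ℒ x hg]
  exact lintegral_indicator (measurable_prodMk_left hA) _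

theorem target_prod_stdGaussian (hpos : ∀ x, 0 < π x) :
    (target π).prod (stdGaussian (X d))
      = (volume.withDensity (fun x => ENNReal.ofReal (π x)) Set.univ)⁻¹ •
        volume.withDensity fun z => ENNReal.ofReal
          (gaussConst d * Real.exp (-hamiltonian (potential π) z)) := by
  rw [target, Measure.prod_smul_left, stdGaussian_eq_withDensity,
    prod_withDensity hπ.ennreal_ofReal measurable_gaussDensity.ennreal_ofReal]
  congr 2
  ext z
  rw [← ENNReal.ofReal_mul (hpos _).le]
  congr 1
  simp only [gaussDensity, hamiltonian, potential, neg_add, neg_neg, Real.exp_add,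
    Real.exp_log (hpos _)]
  ring_nf

/-- Detailed balance holds for each `L` and is then integrated over `L`. No normalization of `ℒ`
enters, so the result also applies to `ℒ.restrict {1}`. -/
theorem acceptedFlow_symm [SFinite ℒ] [SFinite (target π)] (hpos : ∀ x, 0 < π x) :
    (acceptedFlow π ε ℒ).map Prod.swap = acceptedFlow π ε ℒ := by
  have hU := measurable_potential hπ
  have hform : ∀ G : X d × X d → ℝ≥0∞, Measurable G → ∫⁻ z, G z ∂(acceptedFlow π ε ℒ)
      = ∫⁻ L, (volume.withDensity (fun x => ENNReal.ofReal (π x)) Set.univ)⁻¹ *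
        (∫⁻ z : X d × X d, ENNReal.ofReal (gaussConst d * Real.exp (-hamiltonian (potential π) z))
          * (ENNReal.ofReal (accept (potential π) ε L z)
          * G (z.1, (leapfrog (potential π) ε L z).1))) ∂ℒ := by
    intro G hG
    have hGm : Measurable fun q : (X d × X d) × ℕ => G (q.1.1, (leapfrog (potential π) ε q.2 q.1).1) :=
      hG.comp (measurable_fst.fst.prodMk (measurable_leapfrog_uncurry ε).fst)
    have hm : Measurable fun q : (X d × X d) × ℕ =>
        ENNReal.ofReal (accept (potential π) ε q.2 q.1)
          * G (q.1.1, (leapfrog (potential π) ε q.2 q.1).1) :=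
      (measurable_accept_uncurry ε hU).ennreal_ofReal.mul hGm
    rw [lintegral_acceptedFlow hπ ε ℒ hG, ← lintegral_prod
      (f := fun z : X d × X d => ∫⁻ L, ENNReal.ofReal (accept (potential π) ε L z)
        * G (z.1, (leapfrog (potential π) ε L z).1) ∂ℒ) hm.lintegral_prod_right'.aemeasurable,
      lintegral_lintegral_swap hm.aemeasurable]
    refine lintegral_congr fun L => ?_
    have hmL : Measurable fun z : X d × X d => ENNReal.ofReal (accept (potential π) ε L z)
        * G (z.1, (leapfrog (potential π) ε L z).1) :=
      (measurable_accept ε hU L).ennreal_ofReal.mul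
        (hG.comp (measurable_fst.prodMk (measurable_leapfrog _ ε L).fst))
    have hd : Measurable fun z : X d × X d =>
        ENNReal.ofReal (gaussConst d * Real.exp (-hamiltonian (potential π) z)) :=
      ((measurable_hamiltonian hU).neg.exp.const_mul _).ennreal_ofReal
    rw [target_prod_stdGaussian hπ hpos, lintegral_smul_measure, smul_eq_mul,
      lintegral_withDensity_eq_lintegral_mul _ hd hmL]
    rfl
  refine Measure.ext_of_lintegral _ fun G hG => ?_
  rw [lintegral_map hG measurable_swap, hform (fun z => G z.swap) (hG.comp measurable_swap),
    hform _ hG]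
  refine lintegral_congr fun L => ?_
  congr 1
  exact (lintegral_detailed_balance ε hU L gaussConst_pos.le hG).symm

theorem compProd_kernel_eq [IsProbabilityMeasure ℒ] [SFinite (target π)] :
    target π ⊗ₘ kernel π hπ ε ℒ = ((target π).prod (inputLaw d ℒ)).map
      fun q => (q.1, update (potential π) ε q.1 q.2) := by
  have hm := measurable_update (measurable_potential hπ) ε
  refine Measure.ext_of_lintegral _ fun G hG => ?_
  have hm2 : Measurable fun q : X d × X d × ℕ × ℝ =>
    (q.1, update (potential π) ε q.1 q.2) := measurable_fst.prodMk hm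
  rw [Measure.lintegral_compProd hG, lintegral_map hG hm2]
  refine Eq.trans ?_ (lintegral_prod _ (hG.comp hm2).aemeasurable).symm
  refine lintegral_congr fun x => ?_
  have : kernel π hπ ε ℒ x = (inputLaw d ℒ).map (update (potential π) ε x) := rfl
  rw [this]
  exact lintegral_map (hG.comp measurable_prodMk_left) (hm.comp measurable_prodMk_left)

/-- Rejections live on the diagonal, which the swap fixes; reversibility is thus a matter of
accepted moves only. -/
theorem compProd_kernel_eq_add [IsProbabilityMeasure ℒ] [SFinite (target π)] :
    target π ⊗ₘ kernel π hπ ε ℒ = acceptedFlow π ε ℒ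
      + (((target π).prod (inputLaw d ℒ)).restrict (acceptSet (potential π) ε)ᶜ).map
        fun q => (q.1, q.1) := by
  have hU := measurable_potential hπ
  have hA := measurableSet_acceptSet hU ε
  have hm2 : Measurable fun q : X d × X d × ℕ × ℝ =>
    (q.1, update (potential π) ε q.1 q.2) := measurable_fst.prodMk (measurable_update hU ε)
  rw [compProd_kernel_eq hπ]
  conv_lhs => rw [← Measure.restrict_add_restrict_compl (μ := (target π).prod _) hA]
  rw [Measure.map_add _ _ hm2]
  congr 1
  · refine Measure.map_congr ((ae_restrict_iff' hA).2 (ae_of_all _ fun q hq => ?_))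
    exact Prod.ext rfl (if_pos hq)
  · refine Measure.map_congr ((ae_restrict_iff' hA.compl).2 (ae_of_all _ fun q hq => ?_))
    exact Prod.ext rfl (if_neg hq)

theorem compProd_kernel_symm [IsProbabilityMeasure ℒ] [SFinite (target π)]
    (hpos : ∀ x, 0 < π x) :
    (target π ⊗ₘ kernel π hπ ε ℒ).map Prod.swap = target π ⊗ₘ kernel π hπ ε ℒ := by
  rw [compProd_kernel_eq_add hπ, Measure.map_add _ _ measurable_swap,
    acceptedFlow_symm hπ ε ℒ hpos, Measure.map_map measurable_swap (by fun_prop)]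
  rfl

theorem acceptedFlow_restrict_le [IsProbabilityMeasure ℒ] [SFinite (target π)] (S : Set ℕ) :
    acceptedFlow π ε (ℒ.restrict S) ≤ target π ⊗ₘ kernel π hπ ε ℒ := by
  have h1 : acceptedFlow π ε (ℒ.restrict S) ≤ acceptedFlow π ε ℒ := by
    refine Measure.map_mono (Measure.restrict_mono le_rfl ?_) (measurable_proposal _ ε)
    unfold inputLaw
    exact Measure.prod_mono le_rfl (Measure.prod_mono le_rfl
      (Measure.prod_mono Measure.restrict_le_self le_rfl))
  rw [compProd_kernel_eq_add hπ]
  exact h1.trans (Measure.le_add_right le_rfl)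

end Flow

/-! ### Tail formulas, integrability, and positivity of the target. -/

section Tail

variable {d : ℕ} {α β : ℝ} {π : X d → ℝ}

theorem exists_norm_eq (hd : 1 ≤ d) {r : ℝ} (hr : 0 ≤ r) : ∃ x : X d, ‖x‖ = r :=
  ⟨EuclideanSpace.single ⟨0, hd⟩ r, by simp [abs_of_nonneg hr]⟩

/-- The tail behaviour of a density of the exponential family class. -/
structure TailBound (α β : ℝ) (π : X d → ℝ) (R K : ℝ) : Prop where
  one_le : 1 ≤ R
  pos : 0 < K
  eq : ∀ x, R < ‖x‖ → π x = K * Real.exp (-α * ‖x‖ ^ β)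

/-- Positivity of `K` is read off at one point far out, which exists because `1 ≤ d`. Enlarging `R`
to at least `1` keeps `‖x‖` away from `0` and makes its powers comparable with `1`. -/
theorem IsExpFamily.exists_tailBound (hd : 1 ≤ d) (h : IsExpFamily α β π) :
    ∃ R K, TailBound α β π R K := by
  obtain ⟨R, K, hRK⟩ := h.tail
  have heq : ∀ x : X d, max R 1 < ‖x‖ → π x = K * Real.exp (-α * ‖x‖ ^ β) :=
    fun x hx => hRK x ((le_max_left _ _).trans_lt hx)
  obtain ⟨x, hx⟩ := exists_norm_eq hd (show 0 ≤ max R 1 + 1 by positivity)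
  refine ⟨max R 1, K, le_max_right _ _, ?_, heq⟩
  have h1 := h.pos x
  rw [heq x (by linarith)] at h1
  exact pos_of_mul_pos_left h1 (Real.exp_pos _).le

theorem IsExpFamily.contDiff_potential (h : IsExpFamily α β π) : ContDiff ℝ 1 (potential π) :=
  (h.contDiff.log fun x => (h.pos x).ne').neg

theorem IsExpFamily.continuous_potential (h : IsExpFamily α β π) : Continuous (potential π) :=
  h.contDiff_potential.continuous

theorem IsExpFamily.continuous_gradient (h : IsExpFamily α β π) :
    Continuous (gradient (potential π)) :=
  (InnerProductSpace.toDual ℝ (X d)).symm.continuous.comp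
    (h.contDiff_potential.continuous_fderiv one_ne_zero)

namespace TailBound

variable {R K : ℝ} (T : TailBound α β π R K)

include T

theorem potential_eq {x : X d} (hx : R < ‖x‖) :
    potential π x = α * ‖x‖ ^ β - Real.log K := by
  rw [potential, T.eq x hx, Real.log_mul T.pos.ne' (Real.exp_pos _).ne', Real.log_exp]
  ring

theorem gradient_eq {x : X d} (hx : R < ‖x‖) :
    gradient (potential π) x = (α * β * ‖x‖ ^ (β - 2)) • x := by
  have hx0 : 0 < ‖x‖ := by linarith [T.one_le]
  have h1 : HasFDerivAt (fun y : X d => ‖y‖ ^ 2) (2 • (innerSL ℝ x)) x :=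
    (hasStrictFDerivAt_norm_sq x).hasFDerivAt
  have h2 := h1.rpow_const (p := β / 2) (Or.inl (by positivity))
  have h3 := (h2.const_mul α).sub_const (Real.log K)
  -- Writing `‖y‖^β` as `(‖y‖²)^(β/2)` reduces differentiation to the squared norm.
  have hev : potential π =ᶠ[nhds x] fun y => α * (‖y‖ ^ 2) ^ (β / 2) - Real.log K := by
    have : ∀ᶠ y in nhds x, R < ‖y‖ := continuous_norm.continuousAt.eventually (lt_mem_nhds hx)
    filter_upwards [this] with y hy
    rw [T.potential_eq hy, ← Real.rpow_natCast, ← Real.rpow_mul (norm_nonneg _)]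
    congr 3
    push_cast
    ring
  have h4 := h3.congr_of_eventuallyEq hev
  refine HasGradientAt.gradient ?_
  rw [hasGradientAt_iff_hasFDerivAt]
  convert! h4 using 1
  ext v
  have h5 : (‖x‖ ^ 2) ^ (β / 2 - 1) = ‖x‖ ^ (β - 2) := by
    rw [← Real.rpow_natCast, ← Real.rpow_mul (norm_nonneg _)]
    congr 1
    push_cast
    ring
  simp [h5]
  ring

theorem norm_gradient (hα : 0 < α) (hβ : 0 < β) {x : X d} (hx : R < ‖x‖) :
    ‖gradient (potential π) x‖ = α * β * ‖x‖ ^ (β - 1) := by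
  have hx0 : 0 < ‖x‖ := by linarith [T.one_le]
  rw [T.gradient_eq hx, norm_smul, Real.norm_of_nonneg (by positivity), mul_assoc]
  congr 1
  rw [show β - 1 = (β - 2) + 1 by ring, Real.rpow_add_one hx0.ne']

end TailBound

/-- Far out the density is below a multiple of `(1 + ‖x‖)^(-(d+1))`, integrable in dimension `d`;
the remaining ball is compact. -/
theorem IsExpFamily.integrable (hd : 1 ≤ d) (hα : 0 < α) (hβ : 0 < β) (h : IsExpFamily α β π) :
    Integrable π := by
  obtain ⟨R, K, T⟩ := h.exists_tailBound hd
  have hc := h.contDiff.continuous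
  have hlim : Filter.Tendsto (fun r : ℝ => (1 + r) ^ ((d : ℝ) + 1) * Real.exp (-α * r ^ β))
      Filter.atTop (nhds 0) := by
    have h1 : Filter.Tendsto (fun s : ℝ => s ^ (((d : ℝ) + 1) / β) * Real.exp (-α * s))
        Filter.atTop (nhds 0) := tendsto_rpow_mul_exp_neg_mul_atTop_nhds_zero _ _ hα
    have h2 := (h1.comp (tendsto_rpow_atTop hβ)).const_mul ((2 : ℝ) ^ ((d : ℝ) + 1))
    rw [mul_zero] at h2
    refine squeeze_zero' ?_ ?_ h2
    · filter_upwards [Filter.eventually_ge_atTop 0] with r hr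
      positivity
    · filter_upwards [Filter.eventually_ge_atTop 1] with r hr
      simp only [Function.comp]
      rw [← Real.rpow_mul (by linarith), mul_div_cancel₀ _ hβ.ne', ← mul_assoc,
        ← Real.mul_rpow (by norm_num) (by linarith)]
      gcongr
      linarith
  have hev : ∀ᶠ r : ℝ in Filter.atTop, (1 + r) ^ ((d : ℝ) + 1) * Real.exp (-α * r ^ β) < 1 :=
    hlim.eventually_lt_const one_pos
  obtain ⟨r0, hr0⟩ := Filter.eventually_atTop.1 hev
  set r1 := max (max r0 R) 0 + 1
  have hbig : ∀ x : X d, r1 ≤ ‖x‖ → π x ≤ K * (1 + ‖x‖) ^ (-((d : ℝ) + 1)) := by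
    intro x hx
    have h0 : r0 ≤ ‖x‖ := ((le_max_left r0 R).trans (le_max_left _ 0)).trans (by linarith)
    have h1 : R < ‖x‖ := ((le_max_right r0 R).trans (le_max_left _ 0)).trans_lt (by linarith)
    have h2 := hr0 _ h0
    rw [T.eq x h1]
    have h3 : (0 : ℝ) < 1 + ‖x‖ := by positivity
    rw [Real.rpow_neg h3.le, ← div_eq_mul_inv, le_div_iff₀ (by positivity), mul_assoc]
    have : Real.exp (-α * ‖x‖ ^ β) * (1 + ‖x‖) ^ ((d : ℝ) + 1) ≤ 1 := by linarith
    nlinarith [T.pos]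
  obtain ⟨B, hB⟩ := (isCompact_closedBall (0 : X d) r1).exists_bound_of_continuousOn
    hc.continuousOn
  have hint : Integrable fun x : X d => K * (1 + ‖x‖) ^ (-((d : ℝ) + 1)) :=
    (integrable_one_add_norm (by simp)).const_mul K
  have hint2 : Integrable ((Metric.closedBall (0 : X d) r1).indicator fun _ => B) :=
    (integrable_indicator_iff Metric.isClosed_closedBall.measurableSet).2
      (integrableOn_const measure_closedBall_lt_top.ne)
  refine (hint.add hint2).mono' hc.aestronglyMeasurable (ae_of_all _ fun x => ?_)
  have hp : 0 ≤ K * (1 + ‖x‖) ^ (-((d : ℝ) + 1)) := mul_nonneg T.pos.le (by positivity)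
  simp only [Pi.add_apply]
  by_cases hx : x ∈ Metric.closedBall (0 : X d) r1
  · rw [Set.indicator_of_mem hx]
    linarith [hB x hx]
  · rw [Set.indicator_of_notMem hx, add_zero, Real.norm_of_nonneg (h.pos x).le]
    refine hbig x ?_
    simp only [Metric.mem_closedBall, dist_zero_right, not_le] at hx
    exact hx.le

theorem IsExpFamily.mass_ne_zero (h : IsExpFamily α β π) :
    volume.withDensity (fun x => ENNReal.ofReal (π x)) Set.univ ≠ 0 := by
  rw [withDensity_apply _ MeasurableSet.univ, Measure.restrict_univ, ne_eq,
    lintegral_eq_zero_iff h.measurable.ennreal_ofReal]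
  intro h0
  have : ∀ᵐ _ : X d, False := by
    filter_upwards [h0] with x hx
    simp only [Pi.zero_apply, ENNReal.ofReal_eq_zero] at hx
    exact absurd (h.pos x) (not_lt.2 hx)
  rw [ae_iff] at this
  simp only [not_false_eq_true, Set.ofPred_true] at this
  exact isOpen_univ.measure_ne_zero volume Set.univ_nonempty this

theorem IsExpFamily.mass_ne_top (hd : 1 ≤ d) (hα : 0 < α) (hβ : 0 < β)
    (h : IsExpFamily α β π) :
    volume.withDensity (fun x => ENNReal.ofReal (π x)) Set.univ ≠ ∞ := by
  have := isFiniteMeasure_withDensity_ofReal (h.integrable hd hα hβ).2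
  exact measure_ne_top _ _

theorem IsExpFamily.isProbabilityMeasure_target (hd : 1 ≤ d) (hα : 0 < α) (hβ : 0 < β)
    (h : IsExpFamily α β π) : IsProbabilityMeasure (target π) :=
  ⟨by
    rw [target, Measure.smul_apply, smul_eq_mul]
    exact ENNReal.inv_mul_cancel h.mass_ne_zero (h.mass_ne_top hd hα hβ)⟩

theorem target_absolutelyContinuous : target π ≪ (volume : Measure (X d)) :=
  (withDensity_absolutelyContinuous _ _).smul_left _

theorem target_apply {A : Set (X d)} (hA : MeasurableSet A) :
    target π A = (volume.withDensity (fun x => ENNReal.ofReal (π x)) Set.univ)⁻¹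
      * ∫⁻ x in A, ENNReal.ofReal (π x) := by
  rw [target, Measure.smul_apply, smul_eq_mul, withDensity_apply _ hA]

theorem IsExpFamily.target_pos (hd : 1 ≤ d) (hα : 0 < α) (hβ : 0 < β) (h : IsExpFamily α β π)
    {A : Set (X d)} (hA : IsOpen A) (hne : A.Nonempty) : 0 < target π A := by
  rw [target_apply hA.measurableSet]
  refine ENNReal.mul_pos (ENNReal.inv_ne_zero.2 (h.mass_ne_top hd hα hβ)) ?_
  rw [ne_eq, lintegral_eq_zero_iff h.measurable.ennreal_ofReal]
  intro h0
  have : ∀ᵐ _ : X d ∂(volume.restrict A), False := by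
    filter_upwards [h0] with x hx
    simp only [Pi.zero_apply, ENNReal.ofReal_eq_zero] at hx
    exact absurd (h.pos x) (not_lt.2 hx)
  rw [ae_iff] at this
  simp at this
  exact (hA.measure_pos volume hne).ne' this

end Tail

/-! ### Holding probabilities as an obstruction to geometric ergodicity. -/

section TV

variable {E : Type*} [MeasurableSpace E]

theorem ofReal_abs_sub_le_tvDist (μ ν : Measure E) {A : Set E} (hA : MeasurableSet A) :
    ENNReal.ofReal |μ.real A - ν.real A| ≤ tvDist μ ν := by
  have h : ∀ x, |A.indicator (fun _ => (1 : ℝ)) x| ≤ 1 := by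
    intro x
    by_cases hx : x ∈ A <;> simp [hx]
  have := le_iSup_of_le (f := fun f : E → ℝ => ⨆ (_ : Measurable f) (_ : ∀ x, |f x| ≤ 1),
    ENNReal.ofReal |∫ x, f x ∂μ - ∫ x, f x ∂ν|) (A.indicator fun _ => 1)
    (le_iSup_of_le (measurable_const.indicator hA) (le_iSup_of_le h le_rfl))
  simpa [integral_indicator hA, tvDist] using this

theorem pow_holding_le (P : Kernel E E) [MeasurableSingletonClass E] (x : E) (n : ℕ) :
    (P x {x}) ^ n ≤ (P ^ n) x {x} := by
  induction n with
  | zero =>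
    have h : (P ^ 0) x = Measure.dirac x := by rw [pow_zero]; rfl
    rw [h]
    simp
  | succ n ih =>
    rw [Kernel.pow_succ_apply_eq_lintegral P n x (measurableSet_singleton x)]
    calc (P x {x}) ^ (n + 1) = P x {x} * (P x {x}) ^ n := by ring
      _ ≤ P x {x} * (P ^ n) x {x} := by gcongr
      _ = ∫⁻ y in {x}, P y {x} ∂((P ^ n) x) := by
          rw [lintegral_singleton]
      _ ≤ _ := setLIntegral_le_lintegral _ _

theorem isMarkovKernel_pow (P : Kernel E E) [IsMarkovKernel P] (n : ℕ) :
    IsMarkovKernel (P ^ n) := by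
  induction n with
  | zero => rw [pow_zero]; exact (inferInstance : IsMarkovKernel (Kernel.id : Kernel E E))
  | succ n ih =>
    rw [pow_succ]
    exact (inferInstance : IsMarkovKernel ((P ^ n) ∘ₖ P))

/-- A geometrically ergodic chain cannot have holding probabilities with essential supremum `1`. -/
theorem not_geometricallyErgodic_of_holding (P : Kernel E E) [IsMarkovKernel P] (μ : Measure E)
    [MeasurableSingletonClass E] (hμ : ∀ x, μ {x} = 0)
    (hhold : ∀ ρ : ℝ, ρ < 1 → ∃ A : Set E, 0 < μ A ∧ ∀ x ∈ A, ENNReal.ofReal ρ < P x {x}) :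
    ¬ GeometricallyErgodic P μ := by
  rintro ⟨ρ, M, hρ0, hρ1, hM, hTV⟩
  obtain ⟨A, hA, hAP⟩ := hhold ρ hρ1
  obtain ⟨x, hxA, hxM⟩ : ∃ x ∈ A, M x < ∞ := by
    by_contra! hcon
    refine hA.ne' (measure_mono_null (fun x hx => ?_) hM)
    exact not_lt.2 (hcon x hx)
  have hρ' : ENNReal.ofReal ρ ≠ 0 := (ENNReal.ofReal_pos.2 hρ0).ne'
  set q := P x {x} / ENNReal.ofReal ρ
  have hq : 1 < q := by
    rw [ENNReal.lt_div_iff_mul_lt (Or.inl hρ') (Or.inl ENNReal.ofReal_ne_top), one_mul]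
    exact hAP x hxA
  -- As `μ` has no atoms, the total variation distance at time `n` is at least `(P ^ n) x {x} ≥ (P x
  -- {x}) ^ n`.
  have hbound : ∀ n : ℕ, q ^ n ≤ M x := by
    intro n
    have h1 := (ofReal_abs_sub_le_tvDist ((P ^ n) x) μ (measurableSet_singleton x)).trans (hTV x n)
    have := isMarkovKernel_pow P n
    rw [show μ.real {x} = 0 by simp [Measure.real, hμ], sub_zero,
      abs_of_nonneg measureReal_nonneg, Measure.real, ENNReal.ofReal_toReal (measure_ne_top _ _),
      ENNReal.ofReal_pow hρ0.le] at h1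
    calc q ^ n = (P x {x}) ^ n / ENNReal.ofReal ρ ^ n := by
          simp only [q, div_eq_mul_inv, mul_pow, ENNReal.inv_pow]
      _ ≤ M x := ENNReal.div_le_of_le_mul ((pow_holding_le P x n).trans h1)
  have hqtop : q ≠ ∞ := ENNReal.div_ne_top (measure_ne_top _ _) hρ'
  have hq1 : 1 < q.toReal := by
    rw [← ENNReal.toReal_one]
    exact (ENNReal.toReal_lt_toReal ENNReal.one_ne_top hqtop).2 hq
  obtain ⟨n, hn⟩ := pow_unbounded_of_one_lt (M x).toReal hq1
  have := ENNReal.toReal_mono hxM.ne (hbound n)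
  rw [ENNReal.toReal_pow] at this
  linarith

end TV

/-! ### Instability of leapfrog and sticking in the tails for `β > 2`. -/

section Holding

variable {d : ℕ} {α β : ℝ} {π : X d → ℝ}

theorem target_singleton (hd : 1 ≤ d) (x : X d) : target π {x} = 0 := by
  have : Nontrivial (X d) := by
    have : Nonempty (Fin d) := ⟨⟨0, hd⟩⟩
    infer_instance
  exact target_absolutelyContinuous (measure_singleton x)

theorem kernel_apply (hπ : Measurable π) (ε : ℝ) (ℒ : Measure ℕ) [IsProbabilityMeasure ℒ]
    (x : X d) {A : Set (X d)} (hA : MeasurableSet A) :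
    kernel π hπ ε ℒ x A = inputLaw d ℒ (update (potential π) ε x ⁻¹' A) :=
  Measure.map_apply ((measurable_update (measurable_potential hπ) ε).comp measurable_prodMk_left) hA

/-- Inputs with a bounded momentum and a uniform variable away from `0`. -/
def regularInputs (d n : ℕ) : Set (X d × ℕ × ℝ) := {θ | ‖θ.1‖ ≤ n ∧ Real.exp (-n) ≤ θ.2.2}

/-- The regular inputs increase with `n` to everything except the null event `u ≤ 0`. -/
theorem exists_regularInputs (ℒ : Measure ℕ) [IsProbabilityMeasure ℒ] {ρ : ℝ} (hρ : ρ < 1) :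
    ∃ n, ENNReal.ofReal ρ < inputLaw d ℒ (regularInputs d n) := by
  have hmono : Monotone (regularInputs d) := by
    intro m n hmn θ hθ
    have hmn' : (m : ℝ) ≤ n := Nat.cast_le.2 hmn
    exact ⟨hθ.1.trans hmn', le_trans (Real.exp_le_exp.2 (by linarith)) hθ.2⟩
  have hunion : inputLaw d ℒ (⋃ n, regularInputs d n) = 1 := by
    rw [prob_compl_eq_zero_iff₀ ?_ |>.symm]
    · refine measure_mono_null (t := (Set.univ : Set (X d)) ×ˢ
        ((Set.univ : Set ℕ) ×ˢ (Set.Iic (0 : ℝ)))) ?_ ?_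
      · intro θ hθ
        simp only [Set.mem_prod, Set.mem_univ, true_and, Set.mem_Iic]
        by_contra! hpos
        refine hθ (Set.mem_iUnion.2 ?_)
        obtain ⟨n, hn⟩ := exists_nat_ge (max ‖θ.1‖ (-Real.log θ.2.2))
        refine ⟨n, (le_max_left _ _).trans hn, ?_⟩
        rw [← Real.le_log_iff_exp_le hpos]
        linarith [(le_max_right ‖θ.1‖ (-Real.log θ.2.2)).trans hn]
      · have h0 : volume.restrict (Set.Icc (0 : ℝ) 1) (Set.Iic 0) = 0 := by
          rw [Measure.restrict_apply measurableSet_Iic]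
          refine measure_mono_null (t := {0}) ?_ (by simp)
          rintro u ⟨h1, h2, _⟩
          exact le_antisymm h1 h2
        simp [inputLaw, Measure.prod_prod, h0]
    · refine (MeasurableSet.iUnion fun n => ?_).nullMeasurableSet
      have m1 : Measurable fun θ : X d × ℕ × ℝ => ‖θ.1‖ := by fun_prop
      have m2 : Measurable fun θ : X d × ℕ × ℝ => θ.2.2 := by fun_prop
      exact (measurableSet_le m1 measurable_const).inter (measurableSet_le measurable_const m2)
  have hlim := tendsto_measure_iUnion_atTop (μ := inputLaw d ℒ) hmono
  rw [hunion] at hlim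
  have hlt : ENNReal.ofReal ρ < 1 := by
    rw [← ENNReal.ofReal_one]
    exact (ENNReal.ofReal_lt_ofReal_iff one_pos).2 hρ
  obtain ⟨n, hn⟩ := (hlim.eventually (lt_mem_nhds hlt)).exists
  exact ⟨n, hn⟩

theorem leapfrog_succ (U : X d → ℝ) (ε : ℝ) (L : ℕ) (z : X d × X d) :
    leapfrog U ε (L + 1) z = leapfrogStep U ε (leapfrog U ε L z) :=
  Function.iterate_succ_apply' _ _ _

/-- If the gradient dominates the position, leapfrog trajectories run away. -/
theorem leapfrogStep_expanding {U : X d → ℝ} {ε r : ℝ} (hr : 0 ≤ r)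
    (hg : ∀ x, r ≤ ‖x‖ → 8 * ‖x‖ ≤ ε ^ 2 * ‖gradient U x‖) {z : X d × X d}
    (h1 : r ≤ ‖z.1‖) (h2 : 3 * ‖z.1‖ ≤ ‖ε • z.2 - (ε ^ 2 / 2) • gradient U z.1‖) :
    2 * ‖z.1‖ ≤ ‖(leapfrogStep U ε z).1‖ ∧ 3 * ‖(leapfrogStep U ε z).1‖ ≤
      ‖ε • (leapfrogStep U ε z).2 - (ε ^ 2 / 2) • gradient U (leapfrogStep U ε z).1‖ := by
  obtain ⟨x, p⟩ := z
  simp only [leapfrogStep, kick, drift] at h1 h2 ⊢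
  -- `w` is the increment of the position. From `‖w‖ ≥ 3‖x‖` follow `‖y‖ ≥ 2‖x‖` and `‖w‖ ≤
  -- (3/2)‖y‖`; the next increment is `w - ε²∇U(y)`, of norm at least `8‖y‖ - ‖w‖ ≥ 3‖y‖`.
  set w := ε • p - (ε ^ 2 / 2) • gradient U x with hw
  have hx' : x + ε • (p - (ε / 2) • gradient U x) = x + w := by rw [hw]; module
  rw [hx']
  set y := x + w with hy
  have e1 : ‖w‖ - ‖x‖ ≤ ‖y‖ := by
    have := norm_sub_norm_le w (-x)
    rw [norm_neg, sub_neg_eq_add, add_comm w x] at this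
    exact this
  have e2 : 2 * ‖x‖ ≤ ‖y‖ := by linarith
  refine ⟨e2, ?_⟩
  have e3 := hg y (by linarith [norm_nonneg x])
  have e4 : ε • (p - (ε / 2) • gradient U x - (ε / 2) • gradient U y)
      - (ε ^ 2 / 2) • gradient U y = w - (ε ^ 2) • gradient U y := by rw [hw]; module
  rw [e4]
  have e5 := norm_sub_norm_le ((ε ^ 2) • gradient U y) w
  rw [norm_smul, Real.norm_of_nonneg (sq_nonneg ε)] at e5
  rw [norm_sub_rev w]
  linarith

theorem leapfrog_expanding {U : X d → ℝ} {ε r : ℝ} (hr : 0 ≤ r)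
    (hg : ∀ x, r ≤ ‖x‖ → 8 * ‖x‖ ≤ ε ^ 2 * ‖gradient U x‖) {z : X d × X d}
    (h1 : r ≤ ‖z.1‖) (h2 : ‖ε • z.2‖ ≤ ‖z.1‖) (L : ℕ) :
    2 * ‖z.1‖ ≤ ‖(leapfrog U ε (L + 1) z).1‖ ∧ 3 * ‖(leapfrog U ε (L + 1) z).1‖ ≤
      ‖ε • (leapfrog U ε (L + 1) z).2
        - (ε ^ 2 / 2) • gradient U (leapfrog U ε (L + 1) z).1‖ := by
  induction L with
  | zero =>
    refine leapfrogStep_expanding hr hg h1 ?_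
    -- Initially the gradient contributes `4‖x‖` and the momentum takes away at most `‖x‖`, leaving
    -- the required `3‖x‖`. This fixes the constant `8`.
    have e5 := norm_sub_norm_le ((ε ^ 2 / 2) • gradient U z.1) (ε • z.2)
    rw [norm_sub_rev, norm_smul, Real.norm_of_nonneg (by positivity)] at e5
    have := hg z.1 h1
    linarith
  | succ L ih =>
    rw [leapfrog_succ U ε (L + 1)]
    have h := leapfrogStep_expanding hr hg (by linarith [norm_nonneg z.1]) ih.2
    refine ⟨?_, h.2⟩
    linarith [norm_nonneg z.1, h.1, ih.1]

theorem exists_gradient_dominates {R K : ℝ} (T : TailBound α β π R K) (hα : 0 < α) (hβ : 2 < β)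
    {ε : ℝ} (hε : 0 < ε) : ∃ r, R < r ∧
      ∀ x, r ≤ ‖x‖ → 8 * ‖x‖ ≤ ε ^ 2 * ‖gradient (potential π) x‖ := by
  have hlim : Filter.Tendsto (fun r : ℝ => ε ^ 2 * α * β * r ^ (β - 2))
      Filter.atTop Filter.atTop :=
    (tendsto_rpow_atTop (by linarith)).const_mul_atTop (by positivity)
  obtain ⟨r0, hr0⟩ := Filter.eventually_atTop.1 (hlim.eventually_ge_atTop 8)
  refine ⟨max r0 (R + 1), lt_of_lt_of_le (by linarith) (le_max_right _ _), fun x hx => ?_⟩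
  have h1 : R < ‖x‖ := by linarith [(le_max_right r0 (R + 1)).trans hx]
  have hx0 : 0 < ‖x‖ := by linarith [T.one_le]
  rw [T.norm_gradient hα (by linarith) h1, show β - 1 = (β - 2) + 1 by ring,
    Real.rpow_add_one hx0.ne']
  nlinarith [hr0 ‖x‖ ((le_max_left _ _).trans hx)]

theorem exists_holding (hα : 0 < α) (hβ : 2 < β) (hd : 1 ≤ d) (h : IsExpFamily α β π) {ε : ℝ}
    (hε : 0 < ε) (n : ℕ) : ∃ r : ℝ, 0 ≤ r ∧ ∀ x, r < ‖x‖ → ∀ θ ∈ regularInputs d n,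
      update (potential π) ε x θ = x := by
  obtain ⟨R, K, T⟩ := h.exists_tailBound hd
  obtain ⟨r, hrR, hr⟩ := exists_gradient_dominates T hα hβ hε
  have hr0 : 0 ≤ r := by linarith [T.one_le]
  have hlim : Filter.Tendsto (fun s : ℝ => α * s ^ β) Filter.atTop Filter.atTop :=
    (tendsto_rpow_atTop (by linarith)).const_mul_atTop hα
  obtain ⟨r1, hr1⟩ := Filter.eventually_atTop.1 (hlim.eventually_ge_atTop ((n : ℝ) ^ 2 / 2 + n))
  refine ⟨max (max r r1) (ε * n), le_max_of_le_left (le_max_of_le_left hr0), ?_⟩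
  rintro x hx ⟨p, L, u⟩ ⟨hp, hu⟩
  simp only at hp hu
  obtain ⟨hx1, hx3⟩ := max_lt_iff.1 hx
  obtain ⟨hx1, hx2⟩ := max_lt_iff.1 hx1
  cases L with
  | zero =>
    have : (leapfrog (potential π) ε 0 (x, p)).1 = x := rfl
    simp [update, this]
  | succ L =>
    have hexp := (leapfrog_expanding (z := (x, p)) hr0 hr hx1.le (by
      rw [norm_smul, Real.norm_of_nonneg hε.le]
      exact (mul_le_mul_of_nonneg_left hp hε.le).trans hx3.le) L).1
    rw [update, if_neg]
    simp only [not_lt]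
    -- Doubling the norm raises `U` by at least `α‖x‖^β ≥ n²/2 + n`, of which the initial kinetic
    -- energy pays at most `n²/2`. The acceptance ratio is therefore at most `e^(-n) ≤ u`.
    refine le_trans (Real.exp_le_exp.2 ?_) hu
    set z' := leapfrog (potential π) ε (L + 1) (x, p)
    simp only [hamiltonian] at hexp ⊢
    rw [T.potential_eq (hrR.trans hx1), T.potential_eq (x := z'.1)
      (by linarith [norm_nonneg x])]
    have e1 : (2 * ‖x‖) ^ β ≤ ‖z'.1‖ ^ β := by gcongr
    have e2 : 2 * ‖x‖ ^ β ≤ (2 * ‖x‖) ^ β := by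
      rw [Real.mul_rpow (by norm_num) (norm_nonneg _)]
      gcongr
      calc (2 : ℝ) = 2 ^ (1 : ℝ) := by norm_num
        _ ≤ 2 ^ β := Real.rpow_le_rpow_of_exponent_le (by norm_num) (by linarith)
    have e3 := hr1 ‖x‖ hx2.le
    have e4 : ‖p‖ ^ 2 ≤ (n : ℝ) ^ 2 := by gcongr
    have e5 : α * (2 * ‖x‖ ^ β) ≤ α * ‖z'.1‖ ^ β := by
      gcongr
      exact e2.trans e1
    nlinarith [sq_nonneg ‖z'.2‖]

/-- For `β > 2` the leapfrog integrator is unstable in the tails and the chain sticks there. -/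
theorem not_geometricallyErgodic_of_two_lt (hα : 0 < α) (hβ : 2 < β) (hd : 1 ≤ d)
    (h : IsExpFamily α β π) {ε : ℝ} (hε : 0 < ε) (ℒ : Measure ℕ) [IsProbabilityMeasure ℒ] :
    ¬ GeometricallyErgodic (kernel π h.measurable ε ℒ) (target π) := by
  refine not_geometricallyErgodic_of_holding _ _ (target_singleton hd) fun ρ hρ => ?_
  obtain ⟨n, hn⟩ := exists_regularInputs (d := d) ℒ hρ
  obtain ⟨r, hr0, hr⟩ := exists_holding hα hβ hd h hε n
  refine ⟨{x | r < ‖x‖}, h.target_pos hd hα (by linarith)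
    (isOpen_lt continuous_const continuous_norm) ?_, fun x hx => hn.trans_le ?_⟩
  · obtain ⟨x, hx⟩ := exists_norm_eq hd (show 0 ≤ r + 1 by linarith)
    exact ⟨x, by simp [hx]⟩
  · rw [kernel_apply h.measurable ε ℒ x (measurableSet_singleton x)]
    exact measure_mono fun θ hθ => hr x hx θ hθ

end Holding

/-! ### Geometric ergodicity forces a lower bound on the flow out of sets. -/

section Conductance

/-- A log-convex sequence has nondecreasing ratios. If the first ratio exceeded `q`, the sequence
would outgrow `C q^n`. -/
theorem le_mul_of_sq_le_mul {a : ℕ → ℝ} {C q : ℝ} (hq : 0 < q) (h0 : ∀ n, 0 ≤ a n)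
    (hlog : ∀ n, a (n + 1) ^ 2 ≤ a n * a (n + 2)) (hb : ∀ n, a n ≤ C * q ^ n) :
    a 1 ≤ q * a 0 := by
  by_contra! hcon
  have ha0 : 0 < a 0 := by
    refine lt_of_le_of_ne (h0 0) fun h => ?_
    have := hlog 0
    rw [← h] at this hcon
    nlinarith
  set s := a 1 / a 0 with hs
  have hsq : q < s := by rwa [hs, lt_div_iff₀ ha0]
  have hs0 : 0 < s := hq.trans hsq
  have hind : ∀ n, 0 < a n ∧ s * a n ≤ a (n + 1) := by
    intro n
    induction n with
    | zero => exact ⟨ha0, by rw [hs, div_mul_cancel₀ _ ha0.ne']⟩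
    | succ n ih =>
      obtain ⟨h1, h2⟩ := ih
      have h3 : 0 < a (n + 1) := lt_of_lt_of_le (by positivity) h2
      refine ⟨h3, ?_⟩
      have h4 := hlog n
      have h5 : s * a (n + 1) * a n ≤ a n * a (n + 2) := by nlinarith
      nlinarith
  have hgeom : ∀ n, s ^ n * a 0 ≤ a n := by
    intro n
    induction n with
    | zero => simp
    | succ n ih =>
      calc s ^ (n + 1) * a 0 = s * (s ^ n * a 0) := by ring
        _ ≤ s * a n := by gcongr
        _ ≤ _ := (hind n).2
  obtain ⟨n, hn⟩ := pow_unbounded_of_one_lt (C / a 0) ((one_lt_div hq).2 hsq)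
  have h1 := (hgeom n).trans (hb n)
  rw [div_pow, lt_div_iff₀ (by positivity), div_mul_eq_mul_div, div_lt_iff₀ ha0] at hn
  linarith

variable {E : Type*} [MeasurableSpace E] {P : Kernel E E} [IsMarkovKernel P] {μ : Measure E}
  [IsProbabilityMeasure μ]

omit [IsProbabilityMeasure μ] in
theorem integral_indicator_one_mul {B : Set E} (hB : MeasurableSet B) (f : E → ℝ) :
    ∫ x, B.indicator (fun _ => (1 : ℝ)) x * f x ∂μ = ∫ x in B, f x ∂μ := by
  rw [← integral_indicator hB]
  congr 1
  ext x
  by_cases hx : x ∈ B <;> simp [hx]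

/-- A reversible chain with a uniform decay of `P^n(x, B) - μ(B)` on `B` has a large flow
out of `B`. -/
theorem flow_ge_of_decay (hsymm : (μ ⊗ₘ P).map Prod.swap = μ ⊗ₘ P) {B : Set E}
    (hB : MeasurableSet B) {ρ m : ℝ} (hρ : 0 < ρ)
    (hdecay : ∀ n, ∀ᵐ x ∂μ, x ∈ B →
      |(op P)^[n] (B.indicator fun _ => 1) x - μ.real B| ≤ m * ρ ^ n) :
    (1 - ρ) * (μ.real B * (1 - μ.real B)) ≤ ∫ x in B, op P (Bᶜ.indicator fun _ => 1) x ∂μ := by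
  set g : E → ℝ := B.indicator fun _ => 1 with hg
  have hgm : g ∈ bddMeas E := mem_bddMeas_indicator hB 1
  set b := μ.real B with hb
  have hgb : ∫ x, g x ∂μ = b := by
    rw [hg, integral_indicator hB]
    simp [hb]
  have hgg : ∀ f : E → ℝ, ∫ x, g x * f x ∂μ = ∫ x in B, f x ∂μ :=
    integral_indicator_one_mul hB
  set gc : E → ℝ := fun x => g x - b
  have hgc : gc ∈ bddMeas E := mem_bddMeas_sub_const hgm b
  set u : ℕ → E → ℝ := fun n => (op P)^[n] gc with hu
  have hum : ∀ n, u n ∈ bddMeas E := iterate_op_mem_bddMeas hgc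
  have husucc : ∀ n, u (n + 1) = op P (u n) := fun n => Function.iterate_succ_apply' _ _ _
  have hu0 : ∀ n, ∫ x, u n x ∂μ = 0 := by
    intro n
    induction n with
    | zero =>
      change ∫ x, (g x - b) ∂μ = 0
      rw [integral_sub (integrable_of_mem_bddMeas hgm _) (integrable_const _), hgb]
      simp
    | succ n ih => rw [husucc, integral_op hsymm (hum n), ih]
  -- Autocovariances of the centred indicator. Symmetry of `P` gives `⟨u k, u l⟩ = c (k + l)`, so
  -- the even-indexed ones are squared norms and, by Cauchy–Schwarz, log-convex.
  set c : ℕ → ℝ := fun n => ∫ x, gc x * u n x ∂μ with hc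
  have hkl : ∀ k l, ∫ x, u k x * u l x ∂μ = c (k + l) := by
    intro k
    induction k with
    | zero => intro l; simp [hc, hu]
    | succ k ih =>
      intro l
      rw [show k + 1 + l = k + (l + 1) by ring, ← ih, husucc, husucc,
        integral_mul_op_comm hsymm (hum k) (hum l)]
      simp_rw [mul_comm]
  have hcs : ∀ k l, c (k + l) ^ 2 ≤ c (k + k) * c (l + l) := by
    intro k l
    rw [← hkl, ← hkl, ← hkl]
    exact sq_integral_mul_le (hum k) (hum l)
  have hc_eq : ∀ n, c n = ∫ x in B, u n x ∂μ := by
    intro n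
    have : ∫ x, gc x * u n x ∂μ = (∫ x, g x * u n x ∂μ) - b * ∫ x, u n x ∂μ := by
      rw [← integral_const_mul, ← integral_sub
        (integrable_of_mem_bddMeas (mem_bddMeas_mul hgm (hum n)) _)
        ((integrable_of_mem_bddMeas (hum n) _).const_mul b)]
      congr 1
      ext x
      simp only [gc]
      ring
    rw [hc]
    simp only
    rw [this, hgg, hu0, mul_zero, sub_zero]
  have hcb : ∀ n, c (n + n) ≤ |m| * (ρ ^ 2) ^ n := by
    intro n
    rw [hc_eq]
    calc ∫ x in B, u (n + n) x ∂μ ≤ ∫ _ in B, |m| * (ρ ^ 2) ^ n ∂μ := by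
          refine setIntegral_mono_on_ae (integrable_of_mem_bddMeas (hum _) _)
            (integrable_const _) hB ?_
          filter_upwards [hdecay (n + n)] with x hx hxB
          have h1 := (abs_le.1 (hx hxB)).2
          have h2 : u (n + n) x = (op P)^[n + n] g x - b := by
            simp only [hu, gc]
            rw [iterate_op_sub_const hgm]
          rw [h2]
          refine h1.trans ?_
          rw [← pow_mul, two_mul]
          gcongr
          exact le_abs_self m
      _ = b * (|m| * (ρ ^ 2) ^ n) := by simp [hb]
      _ ≤ 1 * (|m| * (ρ ^ 2) ^ n) := by
          gcongr
          exact measureReal_le_one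
      _ = _ := one_mul _
  have hnonneg : ∀ n, 0 ≤ c (n + n) := fun n => by
    rw [← hkl]
    exact integral_nonneg fun x => mul_self_nonneg _
  -- Decay on `B` only, with any constant `m`, becomes a one-step contraction for this particular
  -- function. Then `c 1 ^ 2 ≤ c 0 * c 2` passes to odd index.
  have h2 : c 2 ≤ ρ ^ 2 * c 0 := by
    refine le_mul_of_sq_le_mul (a := fun n => c (n + n)) (C := |m|) (by positivity) hnonneg
      (fun n => ?_) hcb
    have := hcs n (n + 2)
    rwa [show n + (n + 2) = n + 1 + (n + 1) by ring] at this
  have h00 : 0 ≤ c 0 := hnonneg 0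
  have h1 : c 1 ≤ ρ * c 0 := by
    refine abs_le_of_sq_le_sq' ?_ (by positivity) |>.2
    have h3 : c 1 ^ 2 ≤ c 0 * c 2 := hcs 0 1
    nlinarith
  have hc0 : c 0 = b * (1 - b) := by
    rw [hc_eq]
    change ∫ x in B, (g x - b) ∂μ = _
    rw [integral_sub (integrable_of_mem_bddMeas hgm _) (integrable_const _),
      show ∫ x in B, g x ∂μ = b by
        rw [hg, setIntegral_indicator hB, Set.inter_self]; simp [hb]]
    simp only [integral_const, measureReal_restrict_apply_univ, smul_eq_mul, ← hb]
    ring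
  have hopc : op P (Bᶜ.indicator fun _ => 1) = fun x => (1 - b) - op P gc x := by
    have : (Bᶜ.indicator fun _ => (1 : ℝ)) = fun x => (1 - b) - gc x := by
      ext x
      by_cases hx : x ∈ B <;> simp [gc, hg, hx]
    rw [this]
    ext x
    simp only [op]
    rw [integral_sub (integrable_const _) (integrable_of_mem_bddMeas hgc _)]
    simp
  rw [hopc, integral_sub (integrable_const _)
    (integrable_of_mem_bddMeas (op_mem_bddMeas hgc) _)]
  have hc1 : ∫ x in B, op P gc x ∂μ = c 1 := (hc_eq 1).symm
  rw [hc1]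
  simp only [integral_const, measureReal_restrict_apply_univ, smul_eq_mul, ← hb]
  nlinarith

/-- Geometric ergodicity of a reversible chain gives a lower bound on the flow out of all sets. -/
theorem GeometricallyErgodic.exists_flow_ge (hsymm : (μ ⊗ₘ P).map Prod.swap = μ ⊗ₘ P)
    (h : GeometricallyErgodic P μ) : ∃ ρ : ℝ, ρ < 1 ∧ ∀ A : Set E, MeasurableSet A →
      (1 - ρ) * (μ.real A * (1 - μ.real A)) ≤ ∫ x in A, op P (Aᶜ.indicator fun _ => 1) x ∂μ := by
  obtain ⟨ρ, M, hρ0, hρ1, hM, hTV⟩ := h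
  refine ⟨ρ, hρ1, fun A hA => le_of_forall_pos_le_add fun τ hτ => ?_⟩
  have hmono : Monotone fun m : ℕ => {x | M x ≤ m} := fun m n hmn x hx =>
    le_trans (show M x ≤ m from hx) (by exact_mod_cast hmn)
  have hunion : μ (⋃ m : ℕ, {x | M x ≤ m}) = 1 := by
    rw [← measure_univ (μ := μ)]
    refine measure_congr ?_
    filter_upwards [hM] with x hx
    obtain ⟨m, hm⟩ := ENNReal.exists_nat_gt hx.ne
    exact propext ⟨fun _ => trivial, fun _ => Set.mem_iUnion.2 ⟨m, hm.le⟩⟩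
  have hlim := tendsto_measure_iUnion_atTop (μ := μ) hmono
  rw [hunion] at hlim
  have hlt : ENNReal.ofReal (1 - τ / 2) < 1 := by
    rw [← ENNReal.ofReal_one]
    exact (ENNReal.ofReal_lt_ofReal_iff one_pos).2 (by linarith)
  obtain ⟨m, hm⟩ := (hlim.eventually (lt_mem_nhds hlt)).exists
  -- `M` need not be measurable, so its sublevel set is replaced by a measurable hull. The
  -- measurable set where decay fails misses the sublevel set, hence meets the hull in a null set.
  set T := toMeasurable μ {x | M x ≤ m} with hT
  have hTm : MeasurableSet T := measurableSet_toMeasurable _ _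
  have hTμ : μ.real Tᶜ ≤ τ / 2 := by
    have h1 : 1 - τ / 2 ≤ μ.real T := by
      rw [Measure.real, hT, measure_toMeasurable]
      exact (ENNReal.ofReal_le_iff_le_toReal (measure_ne_top _ _)).1 hm.le
    rw [probReal_compl_eq_one_sub hTm]
    linarith
  -- Decay is uniform on `B`. Returning to `A` costs `μ(Tᶜ) ≤ τ / 2` twice: once in the flow and
  -- once in `μ(A)(1 - μ(A))`.
  set B := A ∩ T with hBdef
  have hB : MeasurableSet B := hA.inter hTm
  have hBi : (B.indicator fun _ => (1 : ℝ)) ∈ bddMeas E := mem_bddMeas_indicator hB 1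
  have hdecay : ∀ n, ∀ᵐ x ∂μ, x ∈ B →
      |(op P)^[n] (B.indicator fun _ => 1) x - μ.real B| ≤ m * ρ ^ n := by
    intro n
    set D := {x | |(op P)^[n] (B.indicator fun _ => 1) x - μ.real B| ≤ m * ρ ^ n} with hD
    have hDm : MeasurableSet D := by
      refine measurableSet_le ?_ measurable_const
      exact ((iterate_op_mem_bddMeas (P := P) hBi n).1.sub_const _).abs
    have hsub : {x | M x ≤ m} ⊆ D := by
      intro x hx
      have h1 := (ofReal_abs_sub_le_tvDist ((P ^ n) x) μ hB).trans (hTV x n)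
      have h2 : ENNReal.ofReal |((P ^ n) x).real B - μ.real B| ≤ ENNReal.ofReal (m * ρ ^ n) := by
        refine h1.trans ?_
        rw [ENNReal.ofReal_mul (Nat.cast_nonneg m), ENNReal.ofReal_natCast]
        gcongr
        exact hx
      have h3 := (ENNReal.ofReal_le_ofReal_iff (by positivity)).1 h2
      have h4 := integral_pow_eq (P := P) hBi n x
      rw [integral_indicator hB] at h4
      simp only [integral_const, measureReal_restrict_apply_univ, smul_eq_mul, mul_one] at h4
      rw [h4] at h3
      exact h3
    have hnull : μ (T ∩ Dᶜ) = 0 := by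
      rw [hT, Measure.measure_toMeasurable_inter hDm.compl (measure_ne_top _ _)]
      have : {x | M x ≤ m} ∩ Dᶜ = ∅ := by
        ext x
        simp only [Set.mem_inter_iff, Set.mem_compl_iff, Set.mem_empty_iff_false, iff_false]
        exact fun hx => hx.2 (hsub hx.1)
      rw [this, measure_empty]
    rw [ae_iff]
    refine measure_mono_null (fun x hx => ?_) hnull
    by_contra hcon
    refine hx fun hxB => ?_
    by_contra hxD
    exact hcon ⟨hxB.2, hxD⟩
  have hflow := flow_ge_of_decay hsymm hB hρ0 hdecay
  have hmA := mem_bddMeas_indicator hA.compl (1 : ℝ)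
  have hmB := mem_bddMeas_indicator hB.compl (1 : ℝ)
  have hmT := mem_bddMeas_indicator hTm.compl (1 : ℝ)
  have hop : ∀ x, op P (Bᶜ.indicator fun _ => 1) x
      ≤ op P (Aᶜ.indicator fun _ => 1) x + op P (Tᶜ.indicator fun _ => 1) x := by
    intro x
    simp only [op]
    rw [← integral_add (integrable_of_mem_bddMeas hmA _) (integrable_of_mem_bddMeas hmT _)]
    refine integral_mono (integrable_of_mem_bddMeas hmB _) ((integrable_of_mem_bddMeas hmA _).add
      (integrable_of_mem_bddMeas hmT _)) fun y => ?_
    by_cases h1 : y ∈ A <;> by_cases h2 : y ∈ T <;> simp [hBdef, h1, h2]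
  have hnn : ∀ S : Set E, ∀ x, 0 ≤ op P (S.indicator fun _ => 1) x := fun S x =>
    integral_nonneg fun y => Set.indicator_nonneg (fun _ _ => zero_le_one) y
  have iA := integrable_of_mem_bddMeas (op_mem_bddMeas (P := P) hmA)
  have iB := integrable_of_mem_bddMeas (op_mem_bddMeas (P := P) hmB)
  have iT := integrable_of_mem_bddMeas (op_mem_bddMeas (P := P) hmT)
  have hup : ∫ x in B, op P (Bᶜ.indicator fun _ => 1) x ∂μ
      ≤ (∫ x in A, op P (Aᶜ.indicator fun _ => 1) x ∂μ) + μ.real Tᶜ := by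
    calc _ ≤ ∫ x in B, (op P (Aᶜ.indicator fun _ => 1) x
          + op P (Tᶜ.indicator fun _ => 1) x) ∂μ :=
          integral_mono (iB _) ((iA _).add (iT _)) hop
      _ = (∫ x in B, op P (Aᶜ.indicator fun _ => 1) x ∂μ)
          + ∫ x in B, op P (Tᶜ.indicator fun _ => 1) x ∂μ := integral_add (iA _) (iT _)
      _ ≤ _ := by
          refine add_le_add ?_ ?_
          · exact setIntegral_mono_set (iA _) (ae_of_all _ fun x => hnn _ x)
              (ae_of_all _ fun x hx => hx.1)
          · refine (setIntegral_le_integral (iT _) (ae_of_all _ fun x => hnn _ x)).trans ?_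
            rw [integral_op hsymm hmT, integral_indicator hTm.compl]
            simp
  have hBA : μ.real B ≤ μ.real A := measureReal_mono Set.inter_subset_left
  have hAB : μ.real A ≤ μ.real B + μ.real Tᶜ := by
    refine (measureReal_mono (fun x hx => ?_)).trans (measureReal_union_le _ _)
    by_cases h : x ∈ T
    · exact Or.inl ⟨hx, h⟩
    · exact Or.inr h
  have hA1 : μ.real A ≤ 1 := measureReal_le_one
  have hB0 : 0 ≤ μ.real B := measureReal_nonneg
  have hA0 : 0 ≤ μ.real A := measureReal_nonneg
  have e1 : (1 - ρ) * (μ.real A * (1 - μ.real A))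
      ≤ (1 - ρ) * (μ.real B * (1 - μ.real B)) + μ.real Tᶜ := by
    have e2 : μ.real A * (1 - μ.real A) ≤ μ.real B * (1 - μ.real B) + μ.real Tᶜ := by nlinarith
    have e3 : 0 ≤ μ.real Tᶜ := measureReal_nonneg
    nlinarith
  linarith

end Conductance

/-! ### Tight increments and heavy tails for `β < 1`. -/

section Local

variable {d : ℕ} {α β : ℝ} {π : X d → ℝ}

theorem IsExpFamily.exists_gradient_bound (hd : 1 ≤ d) (hα : 0 < α) (hβ : 0 < β) (hβ1 : β < 1)
    (h : IsExpFamily α β π) : ∃ G, 0 ≤ G ∧ ∀ x, ‖gradient (potential π) x‖ ≤ G := by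
  obtain ⟨R, K, T⟩ := h.exists_tailBound hd
  obtain ⟨B, hB⟩ := (isCompact_closedBall (0 : X d) R).exists_bound_of_continuousOn
    h.continuous_gradient.continuousOn
  refine ⟨max B (α * β), le_max_of_le_right (by positivity), fun x => ?_⟩
  by_cases hx : R < ‖x‖
  · refine le_max_of_le_right ?_
    rw [T.norm_gradient hα hβ hx]
    have : ‖x‖ ^ (β - 1) ≤ 1 :=
      Real.rpow_le_one_of_one_le_of_nonpos (T.one_le.trans hx.le) (by linarith)
    nlinarith [mul_pos hα hβ]
  · exact le_max_of_le_left (hB x (by simpa using hx))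

/-- The momentum grows by at most `εG` per step. Only independence of the bound from `x` matters. -/
theorem norm_leapfrog_sub_le {U : X d → ℝ} {ε G : ℝ} (hε : 0 ≤ ε)
    (hG : ∀ x, ‖gradient U x‖ ≤ G) (L : ℕ) (x p : X d) :
    ‖(leapfrog U ε L (x, p)).1 - x‖ ≤ L * (ε * ‖p‖ + ε ^ 2 * (L * G)) := by
  have hG0 : 0 ≤ G := (norm_nonneg _).trans (hG x)
  have key : ∀ k : ℕ, ‖(leapfrog U ε k (x, p)).2‖ ≤ ‖p‖ + k * (ε * G) ∧
      ‖(leapfrog U ε k (x, p)).1 - x‖ ≤ k * (ε * ‖p‖ + ε ^ 2 * (k * G)) := by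
    intro k
    induction k with
    | zero => simp [leapfrog]
    | succ k ih =>
      rw [leapfrog_succ]
      generalize leapfrog U ε k (x, p) = z at ih ⊢
      obtain ⟨y, q⟩ := z
      simp only [leapfrogStep, kick, drift] at ih ⊢
      obtain ⟨h1, h2⟩ := ih
      have hs : ∀ y, ‖(ε / 2) • gradient U y‖ ≤ ε / 2 * G := fun y => by
        rw [norm_smul, Real.norm_of_nonneg (by positivity)]
        gcongr
        exact hG y
      have h3 : ‖q - (ε / 2) • gradient U y‖ ≤ ‖q‖ + ε / 2 * G :=
        (norm_sub_le _ _).trans (by linarith [hs y])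
      constructor
      · refine (norm_sub_le _ _).trans ?_
        have := hs (y + ε • (q - (ε / 2) • gradient U y))
        push_cast
        linarith
      · have h4 : ‖y + ε • (q - (ε / 2) • gradient U y) - x‖
            ≤ ‖y - x‖ + ε * (‖q‖ + ε / 2 * G) := by
          rw [show y + ε • (q - (ε / 2) • gradient U y) - x
            = (y - x) + ε • (q - (ε / 2) • gradient U y) by abel]
          refine (norm_add_le _ _).trans ?_
          rw [norm_smul, Real.norm_of_nonneg hε]
          gcongr
        refine h4.trans ?_
        have h5 : ε * (‖q‖ + ε / 2 * G) ≤ ε * ((‖p‖ + k * (ε * G)) + ε / 2 * G) := by gcongr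
        push_cast
        have hk : (0 : ℝ) ≤ k := Nat.cast_nonneg k
        have h6 : 0 ≤ ε ^ 2 * G := by positivity
        nlinarith [mul_nonneg hk h6]
  exact (key L).2

theorem exists_measure_lt_of_measurable {Ω : Type*} [MeasurableSpace Ω] (ν : Measure Ω)
    [IsFiniteMeasure ν] {f : Ω → ℝ} {η : ℝ≥0∞} (hf : Measurable f) (hη : 0 < η) :
    ∃ n : ℕ, ν {ω | (n : ℝ) < f ω} < η := by
  have hanti : Antitone fun n : ℕ => {ω | (n : ℝ) < f ω} := fun m n hmn ω hω =>
    lt_of_le_of_lt (Nat.cast_le.2 hmn) (show (n : ℝ) < f ω from hω)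
  have hlim := tendsto_measure_iInter_atTop (μ := ν)
    (fun n : ℕ => (measurableSet_lt measurable_const hf).nullMeasurableSet (s := {ω | (n : ℝ) < f ω}))
    hanti ⟨0, measure_ne_top _ _⟩
  have hempty : ⋂ n : ℕ, {ω | (n : ℝ) < f ω} = ∅ := by
    ext ω
    simp only [Set.mem_iInter, Set.mem_empty_iff_false, iff_false, not_forall]
    obtain ⟨n, hn⟩ := exists_nat_ge (f ω)
    exact ⟨n, not_lt.2 hn⟩
  rw [hempty, measure_empty] at hlim
  exact (hlim.eventually (gt_mem_nhds hη)).exists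

/-- The increments of the chain are uniformly tight when the gradient is bounded. -/
theorem exists_increment_bound (hd : 1 ≤ d) (hα : 0 < α) (hβ : 0 < β) (hβ1 : β < 1)
    (h : IsExpFamily α β π) {ε : ℝ} (hε : 0 < ε) (ℒ : Measure ℕ) [IsProbabilityMeasure ℒ]
    {η : ℝ} (hη : 0 < η) : ∃ W : ℝ, 0 ≤ W ∧ ∀ x, ∀ A : Set (X d), MeasurableSet A →
      (∀ y, ‖y - x‖ ≤ W → y ∈ A) → (kernel π h.measurable ε ℒ x).real Aᶜ ≤ η := by
  obtain ⟨G, hG0, hG⟩ := h.exists_gradient_bound hd hα hβ hβ1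
  have hf : Measurable fun θ : X d × ℕ × ℝ =>
      (θ.2.1 : ℝ) * (ε * ‖θ.1‖ + ε ^ 2 * (θ.2.1 * G)) := by fun_prop
  obtain ⟨n, hn⟩ := exists_measure_lt_of_measurable (inputLaw d ℒ) hf (ENNReal.ofReal_pos.2 hη)
  refine ⟨n, Nat.cast_nonneg n, fun x A hA hxA => ?_⟩
  rw [Measure.real, kernel_apply _ _ _ _ hA.compl]
  refine ENNReal.toReal_le_of_le_ofReal hη.le (le_trans (measure_mono fun θ hθ => ?_) hn.le)
  by_contra hcon
  have hcon' : (θ.2.1 : ℝ) * (ε * ‖θ.1‖ + ε ^ 2 * (θ.2.1 * G)) ≤ n := not_lt.1 hcon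
  refine hθ (hxA _ ?_)
  unfold update
  split_ifs
  · exact (norm_leapfrog_sub_le hε.le hG _ _ _).trans hcon'
  · simp

/-- For `β ≤ 1`, Bernoulli's inequality gives `‖x + v‖^β - ‖x‖^β ≤ βc‖x‖^(β-1)`, which for `β < 1`
tends to `0`; the log-density cannot drop by more than `log 2` over a bounded shift far out. -/
theorem TailBound.exists_le_two_mul {R K : ℝ} (T : TailBound α β π R K) (hα : 0 < α) (hβ : 0 < β)
    (hβ1 : β < 1) (c : ℝ) : ∃ r, R < r ∧ ∀ x v, r < ‖x‖ → r < ‖x + v‖ → ‖v‖ ≤ c →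
      π x ≤ 2 * π (x + v) := by
  have hlim : Filter.Tendsto (fun s : ℝ => α * β * c * s ^ (-(1 - β))) Filter.atTop (nhds 0) := by
    have := (tendsto_rpow_neg_atTop (show 0 < 1 - β by linarith)).const_mul (α * β * c)
    rwa [mul_zero] at this
  obtain ⟨r0, hr0⟩ := Filter.eventually_atTop.1
    (hlim.eventually (gt_mem_nhds (Real.log_pos one_lt_two)))
  refine ⟨max r0 (R + 1), lt_of_lt_of_le (by linarith) (le_max_right _ _),
    fun x v hx hxv hv => ?_⟩
  obtain ⟨h1, h2⟩ := max_lt_iff.1 hx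
  have h3 := (max_lt_iff.1 hxv).2
  have hx0 : 0 < ‖x‖ := by linarith [T.one_le]
  rw [T.eq x (by linarith), T.eq (x + v) (by linarith)]
  have hc : 0 ≤ c := (norm_nonneg v).trans hv
  have e1 : ‖x + v‖ ^ β ≤ ‖x‖ ^ β + β * c * ‖x‖ ^ (-(1 - β)) := by
    have hb : (1 + c / ‖x‖) ^ β ≤ 1 + β * (c / ‖x‖) :=
      rpow_one_add_le_one_add_mul_self (by linarith [div_nonneg hc hx0.le]) hβ.le hβ1.le
    calc ‖x + v‖ ^ β ≤ (‖x‖ * (1 + c / ‖x‖)) ^ β := by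
          have : ‖x‖ * (1 + c / ‖x‖) = ‖x‖ + c := by field_simp
          rw [this]
          gcongr
          exact (norm_add_le _ _).trans (by linarith)
      _ = ‖x‖ ^ β * (1 + c / ‖x‖) ^ β := Real.mul_rpow hx0.le (by positivity)
      _ ≤ ‖x‖ ^ β * (1 + β * (c / ‖x‖)) := by gcongr
      _ = _ := by
          rw [show -(1 - β) = β - 1 by ring, Real.rpow_sub_one hx0.ne']
          field_simp
  have e2 := (hr0 ‖x‖ h1.le).le
  have e3 : Real.exp (-α * ‖x‖ ^ β) ≤ 2 * Real.exp (-α * ‖x + v‖ ^ β) := by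
    calc Real.exp (-α * ‖x‖ ^ β) ≤ Real.exp (Real.log 2 + -α * ‖x + v‖ ^ β) := by
          apply Real.exp_le_exp.2
          nlinarith
      _ = _ := by rw [Real.exp_add, Real.exp_log two_pos]
  nlinarith [T.pos]

theorem target_le_two_mul_translate (hπ : Measurable π) {A : Set (X d)} (hA : MeasurableSet A)
    (v : X d) (h : ∀ x ∈ A, π x ≤ 2 * π (x + v)) :
    target π A ≤ 2 * target π ((fun x => x - v) ⁻¹' A) := by
  have hA' : MeasurableSet ((fun x => x - v) ⁻¹' A) := measurable_sub_const v hA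
  rw [target_apply hA, target_apply hA']
  have hm : Measurable fun x => ENNReal.ofReal (π x) := hπ.ennreal_ofReal
  have e1 : ∫⁻ x in (fun x => x - v) ⁻¹' A, ENNReal.ofReal (π x)
      = ∫⁻ x in A, ENNReal.ofReal (π (x + v)) := by
    rw [← lintegral_indicator hA', ← lintegral_indicator hA,
      ← lintegral_add_right_eq_self _ v]
    refine lintegral_congr fun x => ?_
    by_cases hx : x ∈ A
    · rw [Set.indicator_of_mem hx, Set.indicator_of_mem]
      simpa using hx
    · rw [Set.indicator_of_notMem hx, Set.indicator_of_notMem]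
      simpa using hx
  have e2 : ∫⁻ x in A, ENNReal.ofReal (π x) ≤ 2 * ∫⁻ x in A, ENNReal.ofReal (π (x + v)) := by
    have hmv : Measurable fun x => ENNReal.ofReal (π (x + v)) := hm.comp (measurable_add_const v)
    rw [← lintegral_const_mul _ hmv]
    refine setLIntegral_mono' hA fun x hx => ?_
    refine (ENNReal.ofReal_le_ofReal (h x hx)).trans (le_of_eq ?_)
    rw [ENNReal.ofReal_mul (by norm_num), ENNReal.ofReal_ofNat]
  rw [e1, mul_left_comm]
  gcongr

/-- For `β < 1` the tails are too heavy for the local moves of the chain. -/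
theorem not_geometricallyErgodic_of_lt_one (hα : 0 < α) (hβ : 0 < β) (hβ1 : β < 1) (hd : 1 ≤ d)
    (h : IsExpFamily α β π) {ε : ℝ} (hε : 0 < ε) (ℒ : Measure ℕ) [IsProbabilityMeasure ℒ] :
    ¬ GeometricallyErgodic (kernel π h.measurable ε ℒ) (target π) := by
  intro hGE
  have hprob := h.isProbabilityMeasure_target hd hα hβ
  obtain ⟨ρ, hρ, hflow⟩ := hGE.exists_flow_ge
    (compProd_kernel_symm h.measurable ε ℒ h.pos)
  obtain ⟨R, K, T⟩ := h.exists_tailBound hd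
  set P := kernel π h.measurable ε ℒ
  set μ := target π
  -- For a half-space of mass at most `1 / 2` the flow is at least `8η · (1/2) = 4η` times its mass,
  -- while tightness and thin boundary slabs will give at most `2η` times its mass.
  set η := (1 - ρ) / 8 with hη
  have hη0 : 0 < η := by rw [hη]; linarith
  obtain ⟨W, hW0, hW⟩ := exists_increment_bound hd hα hβ hβ1 h hε ℒ hη0
  obtain ⟨N, hN⟩ := exists_nat_gt (2 / η)
  obtain ⟨r0, hr0R, hr0⟩ := T.exists_le_two_mul hα hβ hβ1 (N * W)
  obtain ⟨e, he⟩ := exists_norm_eq hd zero_le_one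
  have hee : inner ℝ e e = (1 : ℝ) := by rw [real_inner_self_eq_norm_sq, he]; norm_num
  have hinner : ∀ x : X d, inner ℝ e x ≤ ‖x‖ := fun x => by
    simpa [he] using real_inner_le_norm e x
  have hmeas : Measurable fun x : X d => (inner ℝ e x : ℝ) := by fun_prop
  obtain ⟨n, hn⟩ := exists_measure_lt_of_measurable μ hmeas
    (ENNReal.ofReal_pos.2 (show (0 : ℝ) < 1 / 2 by norm_num))
  set r := max r0 n
  have hrr0 : r0 ≤ r := le_max_left _ _
  have hr_pos : 0 ≤ r := by linarith [T.one_le]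
  let H : ℝ → Set (X d) := fun t => {x | t < inner ℝ e x}
  -- Consecutive slabs of width `W`, the range of a typical move: points of `H r` beyond `S 0` leave
  -- with probability at most `η`.
  let S : ℕ → Set (X d) := fun k => {x | r + k * W < inner ℝ e x ∧ inner ℝ e x ≤ r + (k + 1) * W}
  have hH : ∀ t, MeasurableSet (H t) := fun t => measurableSet_lt measurable_const hmeas
  have hS : ∀ k, MeasurableSet (S k) := fun k =>
    (measurableSet_lt measurable_const hmeas).inter (measurableSet_le hmeas measurable_const)
  -- Translation by `kW e` carries the first slab to the `k`-th and loses at most a factor `2`. With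
  -- `N > 2 / η` disjoint slabs inside `H r`, the first has mass at most `η μ(H r)`.
  have hslab : ∀ k < N, μ.real (S 0) ≤ 2 * μ.real (S k) := by
    intro k hk
    have hkN : (k : ℝ) ≤ N := by exact_mod_cast hk.le
    have h1 := target_le_two_mul_translate h.measurable (hS 0) ((k * W) • e) (fun x hx => by
      have hx1 : r < inner ℝ e x := by simpa using hx.1
      refine hr0 x _ ?_ ?_ ?_
      · linarith [hinner x]
      · refine lt_of_lt_of_le ?_ (hinner _)
        rw [inner_add_right, inner_smul_right, hee]
        have : 0 ≤ k * W := by positivity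
        linarith
      · rw [norm_smul, he, mul_one, Real.norm_of_nonneg (by positivity)]
        gcongr)
    have h2 : (fun x => x - (k * W) • e) ⁻¹' (S 0) = S k := by
      ext x
      simp only [S, Set.mem_preimage, Set.mem_ofPred_eq, inner_sub_right, inner_smul_right, hee]
      constructor
      · rintro ⟨h3, h4⟩
        push_cast at h3 h4
        constructor <;> linarith
      · rintro ⟨h3, h4⟩
        push_cast
        constructor <;> linarith
    rw [h2] at h1
    have h3 := ENNReal.toReal_mono (by finiteness) h1
    rwa [ENNReal.toReal_mul] at h3
  have htel : ∀ k ≤ N, k * (μ.real (S 0) / 2) + μ.real (H (r + k * W)) ≤ μ.real (H r) := by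
    intro k
    induction k with
    | zero => intro _; simp
    | succ k ih =>
      intro hk
      have h1 := ih (by omega)
      have h2 := hslab k (by omega)
      have h3 : μ.real (S k) + μ.real (H (r + (k + 1) * W)) ≤ μ.real (H (r + k * W)) := by
        rw [← measureReal_union ?_ (hH _)]
        · refine measureReal_mono ?_
          rintro x (hx | hx)
          · exact hx.1
          · have : r + (k + 1) * W < inner ℝ e x := hx
            exact show r + k * W < inner ℝ e x by linarith
        · rw [Set.disjoint_left]
          exact fun x hx hx' => absurd (show r + (k + 1) * W < inner ℝ e x from hx')
            (not_lt.2 hx.2)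
      push_cast
      linarith
  have hA := hH r
  have hApos : 0 < μ.real (H r) := by
    refine ENNReal.toReal_pos (h.target_pos hd hα hβ ?_ ?_).ne' (measure_ne_top _ _)
    · exact isOpen_lt continuous_const (by fun_prop)
    · exact ⟨(r + 1) • e, show r < inner ℝ e ((r + 1) • e) by
        rw [inner_smul_right, hee]; linarith⟩
  have hAhalf : μ.real (H r) ≤ 1 / 2 := by
    refine ENNReal.toReal_le_of_le_ofReal (by norm_num) (le_trans (measure_mono fun x hx => ?_) hn.le)
    exact lt_of_le_of_lt (le_max_right r0 n) (show r < inner ℝ e x from hx)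
  have hS0 : μ.real (S 0) ≤ η * μ.real (H r) := by
    have h1 := htel N le_rfl
    have h2 : 0 ≤ μ.real (H (r + N * W)) := measureReal_nonneg
    have h3 : 2 < N * η := by rwa [div_lt_iff₀ hη0] at hN
    have h4 : 0 ≤ μ.real (S 0) := measureReal_nonneg
    nlinarith
  have hup : ∫ x in H r, op P ((H r)ᶜ.indicator fun _ => 1) x ∂μ
      ≤ η * μ.real (H r) + μ.real (S 0) := by
    have hi : (((H r)ᶜ).indicator fun _ => (1 : ℝ)) ∈ bddMeas (X d) :=
      mem_bddMeas_indicator hA.compl 1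
    have hop : ∀ x, op P ((H r)ᶜ.indicator fun _ => 1) x = (P x).real (H r)ᶜ := by
      intro x
      simp [op, integral_indicator hA.compl]
    have hSi : ((S 0).indicator fun _ => (1 : ℝ)) ∈ bddMeas (X d) :=
      mem_bddMeas_indicator (hS 0) 1
    calc _ ≤ ∫ x in H r, (η + (S 0).indicator (fun _ => 1) x) ∂μ := by
          refine setIntegral_mono_on (integrable_of_mem_bddMeas (op_mem_bddMeas hi) _)
            ((integrable_const _).add (integrable_of_mem_bddMeas hSi _)) hA fun x hx => ?_
          have hxr : r < inner ℝ e x := hx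
          rw [hop]
          by_cases hxS : inner ℝ e x ≤ r + W
          · rw [Set.indicator_of_mem (show x ∈ S 0 from ⟨by simpa using hxr, by simpa using hxS⟩)]
            have : (P x).real (H r)ᶜ ≤ 1 := measureReal_le_one
            linarith
          · have h1 := hW x (H r) hA fun y hy => by
              have h2 : inner ℝ e (x - y) ≤ ‖x - y‖ := hinner _
              rw [inner_sub_right, norm_sub_rev] at h2
              exact show r < inner ℝ e y by linarith [not_le.1 hxS]
            have h2 : 0 ≤ (S 0).indicator (fun _ => (1 : ℝ)) x :=
              Set.indicator_nonneg (fun _ _ => zero_le_one) x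
            linarith
      _ = η * μ.real (H r) + μ.real (S 0 ∩ H r) := by
          rw [integral_add (integrable_const _) (integrable_of_mem_bddMeas hSi _),
            integral_indicator (hS 0)]
          simp [Measure.real, Measure.restrict_apply (hS 0), mul_comm]
      _ ≤ _ := by
          exact add_le_add le_rfl (measureReal_mono Set.inter_subset_left)
  have := hflow (H r) hA
  have h5 : (1 - ρ) = 8 * η := by rw [hη]; ring
  rw [h5] at this
  have h6 : 0 < η * μ.real (H r) := by positivity
  nlinarith

end Local

/-! ### Inward moves in the tail are accepted when `1 ≤ β ≤ 2`. -/

section Energy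

theorem two_sub_mul_one_sub_rpow_nonneg {β t : ℝ} (h1 : 1 ≤ β) (h2 : β ≤ 2) (ht : 0 < t)
    (ht1 : t ≤ 1) : 0 ≤ β * (t - t ^ (β - 1)) + (2 - β) * (1 - t ^ β) := by
  set f : ℝ → ℝ := fun t => β * (t - t ^ (β - 1)) + (2 - β) * (1 - t ^ β)
  have hderiv : ∀ t : ℝ, 0 < t → HasDerivAt f
      (β * (1 - (β - 1) * t ^ (β - 1 - 1)) + (2 - β) * (0 - β * t ^ (β - 1))) t := by
    intro t ht
    have d1 := Real.hasDerivAt_rpow_const (p := β - 1) (Or.inl ht.ne')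
    have d2 := Real.hasDerivAt_rpow_const (p := β) (Or.inl ht.ne')
    exact (((hasDerivAt_id t).sub d1).const_mul β).add
      (((hasDerivAt_const t (1 : ℝ)).sub d2).const_mul (2 - β))
  have hanti : AntitoneOn f (Set.Ioc 0 1) := by
    refine antitoneOn_of_deriv_nonpos (convex_Ioc 0 1)
      (fun t ht => (hderiv t ht.1).continuousAt.continuousWithinAt) ?_ ?_
    · rw [interior_Ioc]
      exact fun t ht => (hderiv t ht.1).differentiableAt.differentiableWithinAt
    · rw [interior_Ioc]
      intro t ht
      have ht0 := ht.1
      rw [(hderiv t ht0).deriv]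
      -- The derivative is nonpositive iff `1 ≤ (β-1) t^(β-2) + (2-β) t^(β-1)`. With these weights
      -- the geometric mean on the right is exactly `t^0 = 1`. The function vanishes at `1`.
      have hag := Real.geom_mean_le_arith_mean2_weighted (show 0 ≤ β - 1 by linarith)
        (show 0 ≤ 2 - β by linarith) (Real.rpow_nonneg ht0.le (β - 1 - 1))
        (Real.rpow_nonneg ht0.le (β - 1)) (by ring)
      rw [← Real.rpow_mul ht0.le, ← Real.rpow_mul ht0.le, ← Real.rpow_add ht0,
        show (β - 1 - 1) * (β - 1) + (β - 1) * (2 - β) = 0 by ring, Real.rpow_zero] at hag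
      nlinarith
  have := hanti ⟨ht, ht1⟩ ⟨one_pos, le_rfl⟩ ht1
  simpa [f] using this

/-- A rearrangement of the statement that the trapezoidal rule for `β s^(β-1)` on `[q, r]` does not
exceed the integral `r^β - q^β`, by concavity. Homogeneity reduces it to `t = q / r`. -/
theorem trapezoid_rpow {β q r : ℝ} (h1 : 1 ≤ β) (h2 : β ≤ 2) (hq : 0 < q) (hqr : q ≤ r) :
    (2 - β) * (q ^ β - r ^ β) ≤ β * (r ^ (β - 1) * q - q ^ (β - 1) * r) := by
  have hr : 0 < r := hq.trans_le hqr
  have h := two_sub_mul_one_sub_rpow_nonneg h1 h2 (div_pos hq hr) ((div_le_one hr).2 hqr)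
  rw [Real.div_rpow hq.le hr.le, Real.div_rpow hq.le hr.le, Real.rpow_sub_one hq.ne',
    Real.rpow_sub_one hr.ne'] at h
  rw [Real.rpow_sub_one hq.ne', Real.rpow_sub_one hr.ne']
  have hrb : 0 < r ^ β := Real.rpow_pos_of_pos hr β
  have e : β * (r ^ β / r * q - q ^ β / q * r) - (2 - β) * (q ^ β - r ^ β)
      = r ^ β * (β * (q / r - q ^ β / q / (r ^ β / r)) + (2 - β) * (1 - q ^ β / r ^ β)) := by
    field_simp
    ring
  have := mul_nonneg hrb.le h
  linarith

variable {d : ℕ} {α β : ℝ} {π : X d → ℝ}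

theorem leapfrogStep_fst (U : X d → ℝ) (ε : ℝ) (x p : X d) :
    (leapfrogStep U ε (x, p)).1 = (x - (ε ^ 2 / 2) • gradient U x) + ε • p := by
  simp only [leapfrogStep, kick, drift]
  module

/-- The kinetic change is the trapezoidal approximation of the work along the move `w`, plus a term
in the gradient norms. For inward tail moves the latter is nonpositive, as `‖∇U‖` is nondecreasing
in the radius for `β ≥ 1`. -/
theorem kinetic_difference (g g' p : X d) (ε : ℝ) {w : X d}
    (hw : w = ε • (p - (ε / 2) • g)) :
    ‖p - (ε / 2) • g - (ε / 2) • g'‖ ^ 2 / 2 - ‖p‖ ^ 2 / 2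
      = -(1 / 2) * inner ℝ (g + g') w + ε ^ 2 / 8 * (‖g'‖ ^ 2 - ‖g‖ ^ 2) := by
  subst hw
  simp only [← real_inner_self_eq_norm_sq, inner_sub_left, inner_sub_right, inner_add_left,
    inner_smul_left, inner_smul_right, conj_trivial]
  rw [real_inner_comm p g, real_inner_comm p g', real_inner_comm g g']
  ring

/-- Inward leapfrog moves outside the ball do not increase the energy. -/
theorem TailBound.hamiltonian_le {R K : ℝ} (T : TailBound α β π R K) (hα : 0 < α) (h1 : 1 ≤ β)
    (h2 : β ≤ 2) (ε : ℝ) (x p : X d)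
    (hR : R < ‖(leapfrogStep (potential π) ε (x, p)).1‖)
    (hle : ‖(leapfrogStep (potential π) ε (x, p)).1‖ ≤ ‖x‖) :
    hamiltonian (potential π) (leapfrogStep (potential π) ε (x, p))
      ≤ hamiltonian (potential π) (x, p) := by
  set y := (leapfrogStep (potential π) ε (x, p)).1 with hy
  have hy0 : 0 < ‖y‖ := by linarith [T.one_le]
  have hx0 : 0 < ‖x‖ := hy0.trans_le hle
  have hsnd : (leapfrogStep (potential π) ε (x, p)).2
      = p - (ε / 2) • gradient (potential π) x - (ε / 2) • gradient (potential π) y := rfl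
  have hyx : y - x = ε • (p - (ε / 2) • gradient (potential π) x) := by
    rw [hy]
    simp only [leapfrogStep, kick, drift]
    abel
  have hkin := kinetic_difference (gradient (potential π) x) (gradient (potential π) y) p ε hyx
  simp only [hamiltonian]
  rw [hsnd, ← hy, T.potential_eq hR, T.potential_eq (hR.trans_le hle)]
  rw [T.norm_gradient hα (by linarith) hR, T.norm_gradient hα (by linarith) (hR.trans_le hle),
    T.gradient_eq hR, T.gradient_eq (hR.trans_le hle)] at hkin
  rw [T.gradient_eq hR, T.gradient_eq (hR.trans_le hle)]
  set q := ‖y‖ with hq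
  set r := ‖x‖ with hr
  have hgrad : (α * β * q ^ (β - 1)) ^ 2 ≤ (α * β * r ^ (β - 1)) ^ 2 := by
    have : q ^ (β - 1) ≤ r ^ (β - 1) := Real.rpow_le_rpow hy0.le hle (by linarith)
    gcongr
  have hinner : inner ℝ ((α * β * r ^ (β - 2)) • x + (α * β * q ^ (β - 2)) • y) (y - x)
      = α * β * (r ^ (β - 2) - q ^ (β - 2)) * inner ℝ x y
        - α * β * (r ^ (β - 2) * r ^ 2 - q ^ (β - 2) * q ^ 2) := by
    simp only [inner_add_left, inner_sub_right, inner_smul_left, conj_trivial,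
      real_inner_self_eq_norm_sq, real_inner_comm x y, ← hq, ← hr]
    ring
  have hc : inner ℝ x y ≤ r * q := real_inner_le_norm x y
  have hmono : r ^ (β - 2) ≤ q ^ (β - 2) :=
    Real.rpow_le_rpow_of_nonpos hy0 hle (by linarith)
  have htrap := trapezoid_rpow h1 h2 hy0 hle
  have p1 : ∀ s : ℝ, 0 < s → s ^ (β - 2) * s ^ 2 = s ^ β := fun s hs => by
    rw [← Real.rpow_natCast, ← Real.rpow_add hs]
    norm_num
  have p2 : ∀ s : ℝ, 0 < s → s ^ (β - 2) * s = s ^ (β - 1) := fun s hs => by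
    rw [← Real.rpow_add_one hs.ne']
    ring_nf
  rw [hinner, p1 r hx0, p1 q hy0] at hkin
  -- Since `β ≤ 2` the coefficient is nonnegative, so Cauchy–Schwarz makes collinear points the
  -- worst case and leaves a radial inequality.
  have e1 : α * β * ((q ^ (β - 2) - r ^ (β - 2)) * inner ℝ x y)
      ≤ α * β * ((q ^ (β - 2) - r ^ (β - 2)) * (r * q)) := by
    have : 0 ≤ q ^ (β - 2) - r ^ (β - 2) := by linarith
    gcongr
  have e2 : (q ^ (β - 2) - r ^ (β - 2)) * (r * q) = q ^ (β - 1) * r - r ^ (β - 1) * q := by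
    rw [← p2 q hy0, ← p2 r hx0]
    ring
  rw [e2] at e1
  have e3 := mul_le_mul_of_nonneg_left htrap hα.le
  have e4 := mul_le_mul_of_nonneg_left hgrad (show 0 ≤ ε ^ 2 / 8 by positivity)
  linarith

end Energy

/-! ### Gaussian moments and a second-order bound for the exponential. -/

section GaussianMoments

variable {d : ℕ}

/-- Fernique's theorem supplies a Gaussian exponential moment; completing the square compares `c‖p‖`
with it. -/
theorem integrable_exp_mul_norm (c : ℝ) :
    Integrable (fun p : X d => Real.exp (c * ‖p‖)) (stdGaussian (X d)) := by
  obtain ⟨C, hC, hint⟩ := IsGaussian.exists_integrable_exp_sq (stdGaussian (X d))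
  refine (hint.const_mul (Real.exp (c ^ 2 / (4 * C)))).mono'
    (by fun_prop) (ae_of_all _ fun p => ?_)
  rw [Real.norm_of_nonneg (Real.exp_pos _).le, ← Real.exp_add]
  refine Real.exp_le_exp.2 ?_
  have : c ^ 2 / (4 * C) + C * ‖p‖ ^ 2 - c * ‖p‖ = (c - 2 * C * ‖p‖) ^ 2 / (4 * C) := by
    field_simp
    ring
  have h : 0 ≤ (c - 2 * C * ‖p‖) ^ 2 / (4 * C) := by positivity
  linarith

theorem integrable_norm_stdGaussian :
    Integrable (fun p : X d => ‖p‖) (stdGaussian (X d)) :=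
  IsGaussian.integrable_id.norm

theorem integrable_norm_sq_mul_exp (c : ℝ) :
    Integrable (fun p : X d => ‖p‖ ^ 2 * Real.exp (c * ‖p‖)) (stdGaussian (X d)) := by
  refine ((integrable_exp_mul_norm (d := d) (1 + c)).const_mul 2).mono'
    (by fun_prop) (ae_of_all _ fun p => ?_)
  rw [Real.norm_of_nonneg (by positivity), add_mul, Real.exp_add, ← mul_assoc]
  gcongr
  have := Real.quadratic_le_exp_of_nonneg (norm_nonneg p)
  rw [one_mul]
  nlinarith [norm_nonneg p]

theorem integrable_norm_sq_stdGaussian :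
    Integrable (fun p : X d => ‖p‖ ^ 2) (stdGaussian (X d)) := by
  simpa using integrable_norm_sq_mul_exp (d := d) 0

theorem integrable_inner_stdGaussian (m : X d) :
    Integrable (fun p : X d => inner ℝ m p) (stdGaussian (X d)) :=
  (innerSL ℝ m).integrable_comp IsGaussian.integrable_id

theorem integral_inner_stdGaussian (m : X d) :
    ∫ p, inner ℝ m p ∂(stdGaussian (X d)) = 0 :=
  integral_strongDual_stdGaussian (innerSL ℝ m)

theorem exp_le_one_add_add_sq_mul (t : ℝ) :
    Real.exp t ≤ 1 + t + t ^ 2 * Real.exp |t| := by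
  have h1 : 1 ≤ Real.exp |t| := Real.one_le_exp (abs_nonneg t)
  rcases le_or_gt |t| 1 with h | h
  · have := (abs_le.1 (Real.abs_exp_sub_one_sub_id_le h)).2
    nlinarith [sq_nonneg t]
  · rcases le_or_gt 0 t with h0 | h0
    · rw [abs_of_nonneg h0] at *
      have h2 : 1 ≤ t ^ 2 := by nlinarith
      nlinarith [mul_le_mul_of_nonneg_right h2 (Real.exp_pos t).le]
    · rw [abs_of_neg h0] at *
      have : Real.exp t ≤ 1 := Real.exp_le_one_iff.2 h0.le
      nlinarith

end GaussianMoments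

/-! ### The drift of `exp (s‖x‖)` in the tails. -/

section DriftEstimate

variable {d : ℕ} {α β : ℝ} {π : X d → ℝ}

/-- Second-order expansion of the noise. The linear term has Gaussian mean zero; the others carry a
factor `1 / ‖m‖` or `s²`, and so are small beside `s c`. -/
theorem exp_norm_add_le {m p : X d} {ε s c r : ℝ} (hε : 0 ≤ ε) (hs : 0 ≤ s) (hs1 : s ≤ 1)
    (hm : 0 < ‖m‖) (hmr : ‖m‖ ≤ r - c) :
    Real.exp (s * (‖m + ε • p‖ - r)) ≤ Real.exp (-(s * c)) *
      (1 + s * (ε / ‖m‖ * inner ℝ m p + ε ^ 2 / (2 * ‖m‖) * ‖p‖ ^ 2)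
        + (s * ε) ^ 2 * (‖p‖ ^ 2 * Real.exp (ε * ‖p‖))) := by
  set v := ‖m + ε • p‖ - ‖m‖ with hv
  have hnp : ‖ε • p‖ = ε * ‖p‖ := by rw [norm_smul, Real.norm_of_nonneg hε]
  have hvabs : |v| ≤ ε * ‖p‖ := by
    have := abs_norm_sub_norm_le (m + ε • p) m
    rwa [add_sub_cancel_left, hnp] at this
  -- The right-hand side equals `v + v² / (2‖m‖)`.
  have hvle : v ≤ ε / ‖m‖ * inner ℝ m p + ε ^ 2 / (2 * ‖m‖) * ‖p‖ ^ 2 := by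
    have e1 : ‖m + ε • p‖ ^ 2 = ‖m‖ ^ 2 + 2 * (ε * inner ℝ m p) + ε ^ 2 * ‖p‖ ^ 2 := by
      rw [norm_add_sq_real, inner_smul_right, hnp]
      ring
    have e2 : ε / ‖m‖ * inner ℝ m p + ε ^ 2 / (2 * ‖m‖) * ‖p‖ ^ 2
        = (‖m + ε • p‖ ^ 2 - ‖m‖ ^ 2) / (2 * ‖m‖) := by
      rw [e1]
      field_simp
      ring
    rw [e2, le_div_iff₀ (by positivity)]
    nlinarith [sq_nonneg (‖m + ε • p‖ - ‖m‖)]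
  have hsv : |s * v| ≤ ε * ‖p‖ := by
    rw [abs_mul, abs_of_nonneg hs]
    nlinarith [abs_nonneg v]
  calc Real.exp (s * (‖m + ε • p‖ - r)) ≤ Real.exp (-(s * c) + s * v) := by
        apply Real.exp_le_exp.2
        nlinarith
    _ = Real.exp (-(s * c)) * Real.exp (s * v) := Real.exp_add _ _
    _ ≤ Real.exp (-(s * c)) * (1 + s * v + (s * v) ^ 2 * Real.exp |s * v|) := by
        gcongr
        exact exp_le_one_add_add_sq_mul _
    _ ≤ _ := by
        have e3 : (s * v) ^ 2 ≤ (s * (ε * ‖p‖)) ^ 2 := by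
          rw [← sq_abs (s * v), abs_mul, abs_of_nonneg hs]
          gcongr
        have e4 : (s * v) ^ 2 * Real.exp |s * v|
            ≤ (s * (ε * ‖p‖)) ^ 2 * Real.exp (ε * ‖p‖) := by gcongr
        have e5 : (s * (ε * ‖p‖)) ^ 2 * Real.exp (ε * ‖p‖)
          = (s * ε) ^ 2 * (‖p‖ ^ 2 * Real.exp (ε * ‖p‖)) := by ring
        rw [e5] at e4
        gcongr

theorem integrable_exp_norm_add (m : X d) {ε s : ℝ} (hε : 0 ≤ ε) (hs : 0 ≤ s) (r : ℝ) :
    Integrable (fun p : X d => Real.exp (s * (‖m + ε • p‖ - r))) (stdGaussian (X d)) := by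
  refine ((integrable_exp_mul_norm (d := d) (s * ε)).const_mul
    (Real.exp (s * (‖m‖ - r)))).mono' (by fun_prop) (ae_of_all _ fun p => ?_)
  rw [Real.norm_of_nonneg (Real.exp_pos _).le, ← Real.exp_add]
  apply Real.exp_le_exp.2
  have h1 := norm_add_le m (ε • p)
  rw [norm_smul, Real.norm_of_nonneg hε] at h1
  nlinarith

theorem integrable_accept_mul {U : X d → ℝ} (hU : Measurable U) (ε : ℝ) (L : ℕ) (x : X d)
    {f : X d → ℝ} (hf : Integrable f (stdGaussian (X d))) :
    Integrable (fun p => accept U ε L (x, p) * f p) (stdGaussian (X d)) :=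
  hf.bdd_mul ((measurable_accept ε hU L).comp measurable_prodMk_left).aestronglyMeasurable
    (ae_of_all _ fun p => by
      rw [Real.norm_of_nonneg (accept_nonneg U ε L _)]
      exact accept_le_one U ε L _)

theorem leapfrog_one_fst (U : X d → ℝ) (ε : ℝ) (x p : X d) :
    (leapfrog U ε 1 (x, p)).1 = (x - (ε ^ 2 / 2) • gradient U x) + ε • p :=
  leapfrogStep_fst U ε x p

/-- For outward moves the second factor is nonpositive and `accept ≤ 1` only helps. Inward moves
ending outside the ball have `accept = 1`. Landing in the ball requires `ε‖p‖ ≥ ‖m‖ - R`, and then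
the subtracted term is at least `1`. -/
theorem TailBound.le_accept_mul {R K : ℝ} (T : TailBound α β π R K) (hα : 0 < α) (h1 : 1 ≤ β)
    (h2 : β ≤ 2) {ε s : ℝ} (hε : 0 < ε) (hs : 0 ≤ s) {x : X d}
    (hm : R < ‖x - (ε ^ 2 / 2) • gradient (potential π) x‖) (p : X d) :
    1 - Real.exp (s * (‖(leapfrog (potential π) ε 1 (x, p)).1‖ - ‖x‖))
        - ε / (‖x - (ε ^ 2 / 2) • gradient (potential π) x‖ - R) * ‖p‖
      ≤ accept (potential π) ε 1 (x, p)
        * (1 - Real.exp (s * (‖(leapfrog (potential π) ε 1 (x, p)).1‖ - ‖x‖))) := by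
  have hy := leapfrog_one_fst (potential π) ε x p
  set m := x - (ε ^ 2 / 2) • gradient (potential π) x
  have hp : 0 ≤ ε / (‖m‖ - R) * ‖p‖ :=
    mul_nonneg (div_nonneg hε.le (by linarith)) (norm_nonneg _)
  set y := (leapfrog (potential π) ε 1 (x, p)).1 with hydef
  have ha0 := accept_nonneg (potential π) ε 1 (x, p)
  have ha1 := accept_le_one (potential π) ε 1 (x, p)
  rcases lt_or_ge ‖x‖ ‖y‖ with hxy | hxy
  · have : 1 ≤ Real.exp (s * (‖y‖ - ‖x‖)) :=
      Real.one_le_exp (mul_nonneg hs (by linarith))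
    nlinarith
  · have hle : Real.exp (s * (‖y‖ - ‖x‖)) ≤ 1 :=
      Real.exp_le_one_iff.2 (mul_nonpos_of_nonneg_of_nonpos hs (by linarith))
    rcases lt_or_ge R ‖y‖ with hRy | hRy
    · have hH : hamiltonian (potential π) (leapfrog (potential π) ε 1 (x, p))
          ≤ hamiltonian (potential π) (x, p) := T.hamiltonian_le hα h1 h2 ε x p hRy hxy
      have : accept (potential π) ε 1 (x, p) = 1 :=
        min_eq_left (Real.one_le_exp (by linarith))
      rw [this]
      linarith
    · have h3 : ‖m‖ - R ≤ ε * ‖p‖ := by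
        have h4 := norm_sub_norm_le m (-(ε • p))
        rw [norm_neg, sub_neg_eq_add, ← hy, norm_smul, Real.norm_of_nonneg hε.le] at h4
        linarith
      have h5 : 1 ≤ ε / (‖m‖ - R) * ‖p‖ := by
        rw [div_mul_eq_mul_div, le_div_iff₀ (by linarith)]
        linarith
      have : 0 ≤ accept (potential π) ε 1 (x, p) * (1 - Real.exp (s * (‖y‖ - ‖x‖))) :=
        mul_nonneg ha0 (by linarith)
      linarith [Real.exp_pos (s * (‖y‖ - ‖x‖))]

/-- In the tails the drift of the first leapfrog step is inward. -/
theorem TailBound.exists_contraction {R K : ℝ} (T : TailBound α β π R K) (hα : 0 < α)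
    (h1 : 1 ≤ β) {ε θ : ℝ} (hε : 0 < ε) (hθ : θ < 1)
    (hev : ∀ᶠ r : ℝ in Filter.atTop, ε ^ 2 / 2 * (α * β * r ^ (β - 2)) ≤ θ) (B : ℝ) :
    ∃ r, R < r ∧ ∀ x, r < ‖x‖ →
      B ≤ ‖x - (ε ^ 2 / 2) • gradient (potential π) x‖ ∧
      ‖x - (ε ^ 2 / 2) • gradient (potential π) x‖ ≤ ‖x‖ - ε ^ 2 / 2 * (α * β) := by
  obtain ⟨r0, hr0⟩ := Filter.eventually_atTop.1 hev
  refine ⟨max (max r0 (R + 1)) (B / (1 - θ)), ?_, fun x hx => ?_⟩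
  · exact lt_of_lt_of_le (by linarith) ((le_max_right r0 (R + 1)).trans (le_max_left _ _))
  · obtain ⟨hx1, hxB⟩ := max_lt_iff.1 hx
    obtain ⟨hx0, hxR⟩ := max_lt_iff.1 hx1
    have hpos : 0 < ‖x‖ := by linarith [T.one_le]
    have h2 := hr0 ‖x‖ hx0.le
    -- The tail gradient is radial, so the deterministic move rescales `x` by a factor of at least
    -- `1 - θ`: no overshoot. The shortening is `(ε²/2) αβ‖x‖^(β-1)`, bounded below because `β ≥ 1`.
    have h3 : x - (ε ^ 2 / 2) • gradient (potential π) x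
        = (1 - ε ^ 2 / 2 * (α * β * ‖x‖ ^ (β - 2))) • x := by
      rw [T.gradient_eq (by linarith)]
      module
    rw [h3, norm_smul, Real.norm_of_nonneg (by linarith)]
    constructor
    · rw [div_lt_iff₀ (by linarith)] at hxB
      nlinarith
    · have h4 : ‖x‖ ^ (β - 2) * ‖x‖ = ‖x‖ ^ (β - 1) := by
        rw [← Real.rpow_add_one hpos.ne']
        ring_nf
      have h5 : 1 ≤ ‖x‖ ^ (β - 1) :=
        Real.one_le_rpow (by linarith [T.one_le]) (by linarith)
      have h6 : ε ^ 2 / 2 * (α * β) * 1 ≤ ε ^ 2 / 2 * (α * β) * ‖x‖ ^ (β - 1) := by gcongr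
      rw [← h4] at h6
      linarith

theorem le_integral_stdGaussian {f : X d → ℝ} (hf : Integrable f (stdGaussian (X d))) (m : X d)
    (ε a₀ a₁ a₂ a₃ a₄ : ℝ)
    (hpt : ∀ p, a₀ + a₁ * inner ℝ m p + a₂ * ‖p‖ ^ 2 + a₃ * (‖p‖ ^ 2 * Real.exp (ε * ‖p‖))
      + a₄ * ‖p‖ ≤ f p) :
    a₀ + a₂ * (∫ p : X d, ‖p‖ ^ 2 ∂(stdGaussian (X d)))
      + a₃ * (∫ p : X d, ‖p‖ ^ 2 * Real.exp (ε * ‖p‖) ∂(stdGaussian (X d)))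
      + a₄ * (∫ p : X d, ‖p‖ ∂(stdGaussian (X d))) ≤ ∫ p, f p ∂(stdGaussian (X d)) := by
  have i0 := integrable_const (μ := stdGaussian (X d)) a₀
  have i1 := (integrable_inner_stdGaussian m).const_mul a₁
  have i2 := (integrable_norm_sq_stdGaussian (d := d)).const_mul a₂
  have i3 := (integrable_norm_sq_mul_exp (d := d) ε).const_mul a₃
  have i4 := (integrable_norm_stdGaussian (d := d)).const_mul a₄
  refine le_trans (le_of_eq ?_) (integral_mono ((((i0.add i1).add i2).add i3).add i4) hf hpt)
  rw [integral_add' (((i0.add i1).add i2).add i3) i4, integral_add' ((i0.add i1).add i2) i3,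
    integral_add' (i0.add i1) i2, integral_add' i0 i1]
  simp only [integral_const_mul, integral_inner_stdGaussian, integral_const, probReal_univ,
    smul_eq_mul, one_mul, mul_zero, add_zero]

theorem TailBound.le_integral_accept_mul (h : IsExpFamily α β π) {R K : ℝ}
    (T : TailBound α β π R K) (hα : 0 < α) (h1 : 1 ≤ β) (h2 : β ≤ 2) {ε s c : ℝ} (hε : 0 < ε)
    (hs : 0 ≤ s) (hs1 : s ≤ 1) {x m : X d}
    (hm : x - (ε ^ 2 / 2) • gradient (potential π) x = m) (hmR : R < ‖m‖)
    (hmx : ‖m‖ ≤ ‖x‖ - c) :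
    (1 - Real.exp (-(s * c)))
      + (-(Real.exp (-(s * c)) * (s * (ε ^ 2 / (2 * ‖m‖)))))
        * (∫ p : X d, ‖p‖ ^ 2 ∂(stdGaussian (X d)))
      + (-(Real.exp (-(s * c)) * (s * ε) ^ 2))
        * (∫ p : X d, ‖p‖ ^ 2 * Real.exp (ε * ‖p‖) ∂(stdGaussian (X d)))
      + (-(ε / (‖m‖ - R))) * (∫ p : X d, ‖p‖ ∂(stdGaussian (X d)))
      ≤ ∫ p, accept (potential π) ε 1 (x, p)
        * (1 - Real.exp (s * (‖(leapfrog (potential π) ε 1 (x, p)).1‖ - ‖x‖)))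
        ∂(stdGaussian (X d)) := by
  refine le_integral_stdGaussian ?_ m ε _ (-(Real.exp (-(s * c)) * (s * (ε / ‖m‖)))) _ _ _ ?_
  · refine integrable_accept_mul (measurable_potential h.measurable) ε 1 x ?_
    simp_rw [leapfrog_one_fst]
    exact (integrable_const _).sub (integrable_exp_norm_add _ hε.le hs _)
  · intro p
    have h4 := T.le_accept_mul hα h1 h2 hε hs (hm ▸ hmR) p
    refine le_trans ?_ h4
    have h3 := exp_norm_add_le (p := p) hε.le hs hs1 (by linarith [T.one_le]) hmx
    rw [leapfrog_one_fst, hm]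
    linarith

/-- Geometric drift of `exp (s ‖x‖)` under a single accepted leapfrog step. -/
theorem TailBound.exists_drift (h : IsExpFamily α β π) {R K : ℝ} (T : TailBound α β π R K)
    (hα : 0 < α) (h1 : 1 ≤ β) (h2 : β ≤ 2) {ε θ : ℝ} (hε : 0 < ε) (hθ : θ < 1)
    (hev : ∀ᶠ r : ℝ in Filter.atTop, ε ^ 2 / 2 * (α * β * r ^ (β - 2)) ≤ θ) :
    ∃ s lam r : ℝ, 0 < s ∧ 0 < lam ∧ R < r ∧ ∀ x, r < ‖x‖ →
      lam ≤ ∫ p, accept (potential π) ε 1 (x, p)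
        * (1 - Real.exp (s * (‖(leapfrog (potential π) ε 1 (x, p)).1‖ - ‖x‖)))
        ∂(stdGaussian (X d)) := by
  obtain ⟨c, hc⟩ : ∃ c, c = ε ^ 2 / 2 * (α * β) := ⟨_, rfl⟩
  have hc0 : 0 < c := by rw [hc]; positivity
  have hκ₁ : 0 ≤ ∫ p : X d, ‖p‖ ∂(stdGaussian (X d)) := integral_nonneg fun p => norm_nonneg p
  have hκ₂ : 0 ≤ ∫ p : X d, ‖p‖ ^ 2 ∂(stdGaussian (X d)) := integral_nonneg fun p => sq_nonneg _
  have hD : 0 ≤ ∫ p : X d, ‖p‖ ^ 2 * Real.exp (ε * ‖p‖) ∂(stdGaussian (X d)) :=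
    integral_nonneg fun p => by positivity
  have key := fun (s : ℝ) (hs : 0 ≤ s) (hs1 : s ≤ 1) (x : X d) =>
    T.le_integral_accept_mul h hα h1 h2 (c := c) (x := x) hε hs hs1 rfl
  generalize (∫ p : X d, ‖p‖ ∂(stdGaussian (X d))) = κ₁ at *
  generalize (∫ p : X d, ‖p‖ ^ 2 ∂(stdGaussian (X d))) = κ₂ at *
  generalize (∫ p : X d, ‖p‖ ^ 2 * Real.exp (ε * ‖p‖) ∂(stdGaussian (X d))) = D at *
  -- Of the gain `s c`, a quarter may go to the term of order `s²` and, for `‖m‖` large, a quarter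
  -- to the term in `1 / ‖m‖`. The remaining half gives `γ`, and half of `γ` covers proposals
  -- landing in the ball.
  obtain ⟨s, hs0, hs1, hsD⟩ : ∃ s : ℝ, 0 < s ∧ s ≤ 1 ∧ s * (ε ^ 2 * D) ≤ c / 4 := by
    refine ⟨min 1 (c / (4 * (ε ^ 2 * D + 1))), lt_min one_pos (by positivity),
      min_le_left _ _, ?_⟩
    calc _ ≤ c / (4 * (ε ^ 2 * D + 1)) * (ε ^ 2 * D + 1) := by
          gcongr
          · exact min_le_right _ _
          · linarith
      _ = c / 4 := by field_simp
  obtain ⟨γ, hγ⟩ : ∃ γ, γ = 1 - Real.exp (-(s * c / 2)) := ⟨_, rfl⟩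
  have hγ0 : 0 < γ := by
    rw [hγ, sub_pos, Real.exp_lt_one_iff]
    have : 0 < s * c := by positivity
    linarith
  obtain ⟨r, hRr, hr⟩ := T.exists_contraction hα h1 hε hθ hev
    (max (R + 1 + 2 * ε * κ₁ / γ) (2 * ε ^ 2 * κ₂ / c))
  refine ⟨s, γ / 2, r, hs0, by linarith, hRr, fun x hx => ?_⟩
  obtain ⟨hmB, hmx⟩ := hr x hx
  obtain ⟨hm1, hm2⟩ := max_le_iff.1 hmB
  have hq : 0 ≤ 2 * ε * κ₁ / γ := by positivity
  rw [← hc] at hmx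
  have key2 := key s hs0.le hs1 x (by linarith) hmx
  refine le_trans ?_ key2
  generalize ‖x - (ε ^ 2 / 2) • gradient (potential π) x‖ = M at *
  clear key key2 hev hr
  have hm0 : 0 < M := by linarith [T.one_le]
  have e1 : ε / (M - R) * κ₁ ≤ γ / 2 := by
    rw [div_mul_eq_mul_div, div_le_iff₀ (by linarith)]
    have : 2 * ε * κ₁ / γ ≤ M - R := by linarith
    rw [div_le_iff₀ hγ0] at this
    linarith
  have e2 : ε ^ 2 / (2 * M) * κ₂ ≤ c / 4 := by
    rw [div_mul_eq_mul_div, div_le_iff₀ (by positivity)]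
    rw [div_le_iff₀ hc0] at hm2
    linarith
  have e3 : s * (ε ^ 2 / (2 * M)) * κ₂ + (s * ε) ^ 2 * D ≤ s * c / 2 := by
    have e4 : s * (s * (ε ^ 2 * D)) ≤ s * (c / 4) := by gcongr
    have e5 : s * (ε ^ 2 / (2 * M) * κ₂) ≤ s * (c / 4) := by gcongr
    linarith
  have e6 : Real.exp (-(s * c)) * (1 + (s * (ε ^ 2 / (2 * M)) * κ₂ + (s * ε) ^ 2 * D))
      ≤ 1 - γ := by
    calc _ ≤ Real.exp (-(s * c)) * Real.exp (s * c / 2) := by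
          gcongr
          have := Real.add_one_le_exp (s * c / 2)
          linarith
      _ = 1 - γ := by
          rw [← Real.exp_add, hγ]
          ring_nf
  linarith

end DriftEstimate

/-! ### The drift inequality for accepted single-step moves. -/

section Drift

variable {d : ℕ} {α β : ℝ} {π : X d → ℝ}

theorem norm_leapfrog_one_fst_sub_le (U : X d → ℝ) {ε : ℝ} (hε : 0 ≤ ε) (x p : X d) :
    ‖(leapfrog U ε 1 (x, p)).1‖ - ‖x‖ ≤ ε ^ 2 / 2 * ‖gradient U x‖ + ε * ‖p‖ := by
  rw [leapfrog_one_fst]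
  have h1 := norm_add_le (x - (ε ^ 2 / 2) • gradient U x) (ε • p)
  have h2 := norm_sub_le x ((ε ^ 2 / 2) • gradient U x)
  rw [norm_smul, Real.norm_of_nonneg hε] at h1
  rw [norm_smul, Real.norm_of_nonneg (by positivity)] at h2
  linarith

theorem integrable_exp_leapfrog_one (U : X d → ℝ) {ε s : ℝ} (hε : 0 ≤ ε) (hs : 0 ≤ s) (x : X d) :
    Integrable (fun p => Real.exp (s * (‖(leapfrog U ε 1 (x, p)).1‖ - ‖x‖)))
      (stdGaussian (X d)) := by
  simp_rw [leapfrog_one_fst]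
  exact integrable_exp_norm_add _ hε hs _

/-- The drift inequality at a point. -/
theorem TailBound.exists_lintegral_drift (h : IsExpFamily α β π) {R K : ℝ}
    (T : TailBound α β π R K) (hα : 0 < α) (h1 : 1 ≤ β) (h2 : β ≤ 2) {ε θ : ℝ} (hε : 0 < ε)
    (hθ : θ < 1) (hev : ∀ᶠ r : ℝ in Filter.atTop, ε ^ 2 / 2 * (α * β * r ^ (β - 2)) ≤ θ) :
    ∃ (s r : ℝ) (lam b : NNReal), 0 < r ∧ 0 < lam ∧ ∀ x,
      ∫⁻ p, ENNReal.ofReal (accept (potential π) ε 1 (x, p)) * ENNReal.ofReal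
        (Real.exp (s * ‖(leapfrog (potential π) ε 1 (x, p)).1‖) / Real.exp (s * ‖x‖))
        ∂(stdGaussian (X d)) + lam
      ≤ ∫⁻ p, ENNReal.ofReal (accept (potential π) ε 1 (x, p)) ∂(stdGaussian (X d))
        + (Metric.closedBall (0 : X d) r).indicator (fun _ => (b : ℝ≥0∞)) x := by
  have hU := measurable_potential h.measurable
  obtain ⟨s, lam, r, hs, hlam, hRr, hdrift⟩ := T.exists_drift h hα h1 h2 hε hθ hev
  obtain ⟨G, hG⟩ := (isCompact_closedBall (0 : X d) r).exists_bound_of_continuousOn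
    h.continuous_gradient.continuousOn
  have hrpos : 0 < r := by linarith [T.one_le]
  have hexp : ∀ x p : X d, Real.exp (s * ‖(leapfrog (potential π) ε 1 (x, p)).1‖)
      / Real.exp (s * ‖x‖)
      = Real.exp (s * (‖(leapfrog (potential π) ε 1 (x, p)).1‖ - ‖x‖)) := by
    intro x p
    rw [← Real.exp_sub, mul_sub]
  have hJ : ∀ x, ∫⁻ p, ENNReal.ofReal (accept (potential π) ε 1 (x, p)) * ENNReal.ofReal
        (Real.exp (s * (‖(leapfrog (potential π) ε 1 (x, p)).1‖ - ‖x‖))) ∂(stdGaussian (X d))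
      = ENNReal.ofReal (∫ p, accept (potential π) ε 1 (x, p)
        * Real.exp (s * (‖(leapfrog (potential π) ε 1 (x, p)).1‖ - ‖x‖)) ∂(stdGaussian (X d))) := by
    intro x
    rw [ofReal_integral_eq_lintegral_ofReal (integrable_accept_mul hU ε 1 x
      (integrable_exp_leapfrog_one _ hε.le hs.le x))
      (ae_of_all _ fun p => mul_nonneg (accept_nonneg _ _ _ _) (Real.exp_pos _).le)]
    exact lintegral_congr fun p => (ENNReal.ofReal_mul (accept_nonneg _ _ _ _)).symm
  have hint1 : ∀ x, Integrable (fun p => accept (potential π) ε 1 (x, p)) (stdGaussian (X d)) :=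
    fun x => by simpa only [mul_one] using integrable_accept_mul hU ε 1 x (integrable_const (1 : ℝ))
  -- In the ball no acceptance estimate is needed: the gradient is bounded there by `G`, and a step
  -- lengthens the norm by at most `(ε²/2)G + ε‖p‖`.
  set b₁ : ℝ := Real.exp (s * (ε ^ 2 / 2 * G))
    * ∫ p : X d, Real.exp (s * ε * ‖p‖) ∂(stdGaussian (X d)) with hb₁
  refine ⟨s, r, lam.toNNReal, (b₁ + lam).toNNReal, hrpos, Real.toNNReal_pos.2 hlam, fun x => ?_⟩
  simp only [hexp, hJ]
  by_cases hx : x ∈ Metric.closedBall (0 : X d) r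
  · rw [Set.indicator_of_mem hx]
    refine le_trans ?_ le_add_self
    have hb0 : 0 ≤ b₁ := mul_nonneg (Real.exp_pos _).le
      (integral_nonneg fun p => (Real.exp_pos _).le)
    change _ + ENNReal.ofReal lam ≤ ENNReal.ofReal (b₁ + lam)
    rw [ENNReal.ofReal_add hb0 hlam.le]
    gcongr
    rw [hb₁, ← integral_const_mul]
    refine integral_mono (integrable_accept_mul hU ε 1 x
      (integrable_exp_leapfrog_one _ hε.le hs.le x))
      ((integrable_exp_mul_norm (s * ε)).const_mul _) fun p => ?_
    calc _ ≤ 1 * Real.exp (s * (‖(leapfrog (potential π) ε 1 (x, p)).1‖ - ‖x‖)) := by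
          gcongr
          exact accept_le_one _ _ _ _
      _ ≤ Real.exp (s * (ε ^ 2 / 2 * G) + s * ε * ‖p‖) := by
          rw [one_mul, mul_assoc s ε, ← mul_add]
          gcongr
          refine (norm_leapfrog_one_fst_sub_le _ hε.le x p).trans ?_
          gcongr
          exact hG x hx
      _ = _ := Real.exp_add _ _
  · rw [Set.indicator_of_notMem hx, add_zero]
    have hxr : r < ‖x‖ := by simpa using hx
    have h3 := hdrift x hxr
    simp_rw [mul_sub (accept _ _ _ _), mul_one] at h3
    rw [integral_sub (hint1 x) (integrable_accept_mul hU ε 1 x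
      (integrable_exp_leapfrog_one _ hε.le hs.le x))] at h3
    have hI : 0 ≤ ∫ p, accept (potential π) ε 1 (x, p)
        * Real.exp (s * (‖(leapfrog (potential π) ε 1 (x, p)).1‖ - ‖x‖)) ∂(stdGaussian (X d)) :=
      integral_nonneg fun p => mul_nonneg (accept_nonneg _ _ _ _) (Real.exp_pos _).le
    rw [← ofReal_integral_eq_lintegral_ofReal (hint1 x)
      (ae_of_all _ fun p => accept_nonneg _ _ _ _)]
    change _ + ENNReal.ofReal lam ≤ _
    rw [← ENNReal.ofReal_add hI hlam.le]
    exact ENNReal.ofReal_le_ofReal (by linarith)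

theorem lintegral_acceptedFlow_restrict_one (hπ : Measurable π) (ε : ℝ) (ℒ : Measure ℕ)
    [SFinite ℒ] [SFinite (target π)] {G : X d × X d → ℝ≥0∞} (hG : Measurable G) :
    ∫⁻ z, G z ∂(acceptedFlow π ε (ℒ.restrict {1}))
      = ∫⁻ x, ℒ {1} * ∫⁻ p, ENNReal.ofReal (accept (potential π) ε 1 (x, p))
        * G (x, (leapfrog (potential π) ε 1 (x, p)).1) ∂(stdGaussian (X d)) ∂(target π) := by
  rw [lintegral_acceptedFlow hπ ε _ hG]
  refine lintegral_congr fun x => ?_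
  have hm : Measurable fun p => ENNReal.ofReal (accept (potential π) ε 1 (x, p))
      * G (x, (leapfrog (potential π) ε 1 (x, p)).1) :=
    ((measurable_accept ε (measurable_potential hπ) 1).comp
      measurable_prodMk_left).ennreal_ofReal.mul
      (hG.comp (measurable_const.prodMk
        ((measurable_leapfrog _ ε 1).comp measurable_prodMk_left).fst))
  rw [← lintegral_const_mul _ hm]
  refine lintegral_congr fun p => ?_
  rw [lintegral_singleton, mul_comm]

/-- Multiply by `ℒ {1} * h x` and integrate. A small `ℒ {1}` scales both drift constants but does
not destroy the inequality. -/
theorem lintegral_drift_of_pointwise (hπ : Measurable π) (ε : ℝ) (ℒ : Measure ℕ)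
    [IsFiniteMeasure ℒ] [SFinite (target π)] {V : X d → ℝ} (hV : Measurable V) {C : Set (X d)}
    (hC : MeasurableSet C) {lam b : NNReal}
    (hpt : ∀ x, ∫⁻ p, ENNReal.ofReal (accept (potential π) ε 1 (x, p)) * ENNReal.ofReal
        (V (leapfrog (potential π) ε 1 (x, p)).1 / V x) ∂(stdGaussian (X d)) + lam
      ≤ ∫⁻ p, ENNReal.ofReal (accept (potential π) ε 1 (x, p)) ∂(stdGaussian (X d))
        + C.indicator (fun _ => (b : ℝ≥0∞)) x)
    {h : X d → ℝ≥0∞} (hh : Measurable h) :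
    ∫⁻ z, h z.1 * ENNReal.ofReal (V z.2 / V z.1) ∂(acceptedFlow π ε (ℒ.restrict {1}))
      + ((ℒ {1}).toNNReal * lam : NNReal) * ∫⁻ x, h x ∂(target π)
      ≤ ∫⁻ z, h z.1 ∂(acceptedFlow π ε (ℒ.restrict {1}))
        + ((ℒ {1}).toNNReal * b : NNReal) * ∫⁻ x in C, h x ∂(target π) := by
  have hU := measurable_potential hπ
  have hacc : ∀ x : X d, Measurable fun p => ENNReal.ofReal (accept (potential π) ε 1 (x, p)) :=
    fun x => ((measurable_accept ε hU 1).comp measurable_prodMk_left).ennreal_ofReal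
  have hG : Measurable fun z : X d × X d => h z.1 * ENNReal.ofReal (V z.2 / V z.1) :=
    (hh.comp measurable_fst).mul
      ((hV.comp measurable_snd).div (hV.comp measurable_fst)).ennreal_ofReal
  have hratio : ∀ x : X d, Measurable fun p => ENNReal.ofReal (accept (potential π) ε 1 (x, p))
      * ENNReal.ofReal (V (leapfrog (potential π) ε 1 (x, p)).1 / V x) := fun x =>
    (hacc x).mul (((hV.comp ((measurable_leapfrog _ ε 1).comp
      measurable_prodMk_left).fst).div_const _).ennreal_ofReal)
  have hl : ((ℒ {1}).toNNReal : ℝ≥0∞) = ℒ {1} := ENNReal.coe_toNNReal (measure_ne_top _ _)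
  have hF : ∫⁻ z, h z.1 ∂(acceptedFlow π ε (ℒ.restrict {1})) = ∫⁻ x, ℒ {1}
      * ∫⁻ p, ENNReal.ofReal (accept (potential π) ε 1 (x, p)) * h x ∂(stdGaussian (X d))
        ∂(target π) :=
    lintegral_acceptedFlow_restrict_one hπ ε ℒ (hh.comp measurable_fst)
  rw [lintegral_acceptedFlow_restrict_one hπ ε ℒ hG,
    hF,
    ← lintegral_const_mul _ hh, ← lintegral_const_mul _ hh, ← lintegral_indicator hC,
    ← lintegral_add_right _ (hh.const_mul _), ← lintegral_add_right _ ((hh.const_mul _).indicator hC)]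
  refine lintegral_mono fun x => ?_
  push_cast
  rw [hl]
  have e1 : ∀ p, ENNReal.ofReal (accept (potential π) ε 1 (x, p)) * (h x * ENNReal.ofReal
      (V (leapfrog (potential π) ε 1 (x, p)).1 / V x))
      = h x * (ENNReal.ofReal (accept (potential π) ε 1 (x, p)) * ENNReal.ofReal
      (V (leapfrog (potential π) ε 1 (x, p)).1 / V x)) := fun p => by ring
  have e2 : C.indicator (fun x => ℒ {1} * (b : ℝ≥0∞) * h x) x
      = ℒ {1} * (h x * C.indicator (fun _ => (b : ℝ≥0∞)) x) := by
    by_cases hx : x ∈ C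
    · simp only [Set.indicator_of_mem hx]
      ring
    · simp [Set.indicator_of_notMem hx]
  simp only [e1, e2]
  rw [lintegral_const_mul _ (hratio x), lintegral_mul_const _ (hacc x)]
  calc _ = ℒ {1} * (h x * (∫⁻ p, ENNReal.ofReal (accept (potential π) ε 1 (x, p)) * ENNReal.ofReal
        (V (leapfrog (potential π) ε 1 (x, p)).1 / V x) ∂(stdGaussian (X d)) + lam)) := by ring
    _ ≤ ℒ {1} * (h x * (∫⁻ p, ENNReal.ofReal (accept (potential π) ε 1 (x, p)) ∂(stdGaussian (X d))
        + C.indicator (fun _ => (b : ℝ≥0∞)) x)) := by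
        gcongr ℒ {1} * (h x * ?_)
        exact hpt x
    _ = _ := by ring

end Drift

/-! ### Minorization on balls by one leapfrog step. -/

section Minorization

variable {d : ℕ} {α β : ℝ} {π : X d → ℝ}

/-- Keeps only accepted moves with one leapfrog step. -/
theorem le_kernel_apply (hπ : Measurable π) (ε : ℝ) (ℒ : Measure ℕ) [IsProbabilityMeasure ℒ]
    (x : X d) {A : Set (X d)} (hA : MeasurableSet A) :
    ℒ {1} * ∫⁻ p, ENNReal.ofReal (accept (potential π) ε 1 (x, p))
        * A.indicator 1 (leapfrog (potential π) ε 1 (x, p)).1 ∂(stdGaussian (X d))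
      ≤ kernel π hπ ε ℒ x A := by
  have hU := measurable_potential hπ
  have hg : Measurable fun r : X d × ℕ =>
      A.indicator (1 : X d → ℝ≥0∞) (leapfrog (potential π) ε r.2 (x, r.1)).1 := by
    refine (measurable_one.indicator hA).comp ((measurable_leapfrog_uncurry
      (U := potential π) ε).comp
      (by fun_prop : Measurable fun r : X d × ℕ => (((x, r.1), r.2) : (X d × X d) × ℕ))).fst
  have hm : Measurable fun p => ENNReal.ofReal (accept (potential π) ε 1 (x, p))
        * A.indicator (1 : X d → ℝ≥0∞) (leapfrog (potential π) ε 1 (x, p)).1 :=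
    ((measurable_accept ε hU 1).comp measurable_prodMk_left).ennreal_ofReal.mul
      ((measurable_one.indicator hA).comp
        ((measurable_leapfrog _ ε 1).comp measurable_prodMk_left).fst)
  have hupd : Measurable (update (potential π) ε x) :=
    (measurable_update hU ε).comp measurable_prodMk_left
  rw [kernel_apply hπ ε ℒ x hA, ← lintegral_indicator_one (hupd hA), ← lintegral_const_mul _ hm]
  calc _ ≤ ∫⁻ p, ∫⁻ L, ENNReal.ofReal (accept (potential π) ε L (x, p))
        * A.indicator 1 (leapfrog (potential π) ε L (x, p)).1 ∂ℒ ∂(stdGaussian (X d)) := by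
        refine lintegral_mono fun p => ?_
        refine le_trans (le_of_eq ?_) (setLIntegral_le_lintegral {1} _)
        rw [lintegral_singleton, mul_comm]
    _ = ∫⁻ θ in {θ | (x, θ) ∈ acceptSet (potential π) ε},
        A.indicator 1 (leapfrog (potential π) ε θ.2.1 (x, θ.1)).1 ∂(inputLaw d ℒ) :=
        (lintegral_inputLaw_accept hU ε ℒ x hg).symm
    _ ≤ _ := by
        have hS : MeasurableSet {θ | (x, θ) ∈ acceptSet (potential π) ε} :=
          measurable_prodMk_left (measurableSet_acceptSet hU ε)
        rw [← lintegral_indicator hS]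
        refine lintegral_mono fun θ => ?_
        by_cases hθ : (x, θ) ∈ acceptSet (potential π) ε
        · rw [Set.indicator_of_mem (show θ ∈ {θ | (x, θ) ∈ acceptSet (potential π) ε} from hθ)]
          have : update (potential π) ε x θ = (leapfrog (potential π) ε θ.2.1 (x, θ.1)).1 :=
            if_pos hθ
          rw [← this]
          rfl
        · rw [Set.indicator_of_notMem (show θ ∉ {θ | (x, θ) ∈ acceptSet (potential π) ε} from hθ)]
          exact zero_le

theorem leapfrog_one_snd (U : X d → ℝ) (ε : ℝ) (x p : X d) :
    (leapfrog U ε 1 (x, p)).2 = p - (ε / 2) • gradient U x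
      - (ε / 2) • gradient U (leapfrog U ε 1 (x, p)).1 :=
  rfl

/-- Proposals between points of a ball have a density that is bounded below. -/
theorem IsExpFamily.exists_le_gaussDensity_mul_accept (h : IsExpFamily α β π) {ε : ℝ}
    (hε : 0 < ε) (r : ℝ) :
    ∃ c : ℝ, 0 < c ∧ ∀ x p : X d, ‖x‖ ≤ r → ‖(leapfrog (potential π) ε 1 (x, p)).1‖ ≤ r →
      c ≤ gaussDensity p * accept (potential π) ε 1 (x, p) := by
  obtain ⟨G, hG⟩ := (isCompact_closedBall (0 : X d) r).exists_bound_of_continuousOn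
    h.continuous_gradient.continuousOn
  obtain ⟨B, hB⟩ := (isCompact_closedBall (0 : X d) r).exists_bound_of_continuousOn
    h.continuous_potential.continuousOn
  -- `Q` bounds the momentum needed between two points of the ball, from `ε p = y - x +
  -- (ε²/2)∇U(x)`.
  obtain ⟨Q, hQ⟩ : ∃ Q, Q = (2 * r + ε ^ 2 / 2 * G) / ε := ⟨_, rfl⟩
  refine ⟨gaussConst d * Real.exp (-(1 / 2) * Q ^ 2) * Real.exp (-(2 * B + (Q + ε * G) ^ 2 / 2)),
    mul_pos (mul_pos gaussConst_pos (Real.exp_pos _)) (Real.exp_pos _), fun x p hx hy => ?_⟩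
  have hxC : x ∈ Metric.closedBall (0 : X d) r := by simpa using hx
  have hyC : (leapfrog (potential π) ε 1 (x, p)).1 ∈ Metric.closedBall (0 : X d) r := by
    simpa using hy
  have hGx := hG x hxC
  have hGy := hG _ hyC
  have hUx := abs_le.1 (hB x hxC)
  have hUy := abs_le.1 (hB _ hyC)
  have hpQ : ‖p‖ ≤ Q := by
    rw [hQ, le_div_iff₀ hε]
    have e : ε • p = (leapfrog (potential π) ε 1 (x, p)).1 - x
        + (ε ^ 2 / 2) • gradient (potential π) x := by
      rw [leapfrog_one_fst]
      module
    have e1 := norm_add_le ((leapfrog (potential π) ε 1 (x, p)).1 - x)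
      ((ε ^ 2 / 2) • gradient (potential π) x)
    rw [← e, norm_smul, norm_smul, Real.norm_of_nonneg hε.le,
      Real.norm_of_nonneg (by positivity)] at e1
    have e2 := norm_sub_le (leapfrog (potential π) ε 1 (x, p)).1 x
    have e3 : ε ^ 2 / 2 * ‖gradient (potential π) x‖ ≤ ε ^ 2 / 2 * G := by gcongr
    linarith
  have hp' : ‖(leapfrog (potential π) ε 1 (x, p)).2‖ ≤ Q + ε * G := by
    rw [leapfrog_one_snd]
    have e1 := norm_sub_le (p - (ε / 2) • gradient (potential π) x)
      ((ε / 2) • gradient (potential π) (leapfrog (potential π) ε 1 (x, p)).1)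
    have e2 := norm_sub_le p ((ε / 2) • gradient (potential π) x)
    rw [norm_smul, Real.norm_of_nonneg (by positivity)] at e1 e2
    have e3 : ε / 2 * ‖gradient (potential π) x‖ ≤ ε / 2 * G := by gcongr
    have e4 : ε / 2 * ‖gradient (potential π) (leapfrog (potential π) ε 1 (x, p)).1‖
      ≤ ε / 2 * G := by gcongr
    linarith
  have hp2 : ‖(leapfrog (potential π) ε 1 (x, p)).2‖ ^ 2 ≤ (Q + ε * G) ^ 2 := by gcongr
  refine mul_le_mul ?_ (le_min ?_ ?_) (Real.exp_pos _).le (gaussDensity_pos p).le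
  · unfold gaussDensity
    have := gaussConst_pos (d := d)
    have : ‖p‖ ^ 2 ≤ Q ^ 2 := by gcongr
    gcongr gaussConst d * Real.exp ?_
    linarith
  · apply Real.exp_le_one_iff.2
    have : 0 ≤ B := (norm_nonneg _).trans (hB x hxC)
    have := sq_nonneg (Q + ε * G)
    linarith
  · apply Real.exp_le_exp.2
    simp only [hamiltonian]
    have := sq_nonneg ‖p‖
    linarith

theorem volume_preimage_add_smul (m : X d) {ε : ℝ} (hε : ε ≠ 0) (S : Set (X d)) :
    volume ((fun p : X d => m + ε • p) ⁻¹' S) = ENNReal.ofReal |(ε ^ d)⁻¹| * volume S := by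
  have h1 : (fun p : X d => m + ε • p) ⁻¹' S = (ε • ·) ⁻¹' ((m + ·) ⁻¹' S) := rfl
  rw [h1, Measure.addHaar_preimage_smul _ hε, measure_preimage_add, finrank_euclideanSpace_fin]

/-- On the ball, `k` bounds the Lebesgue density of the moves from below, after the affine
substitution `p ↦ m + ε p`, and `w` bounds that of the target from above; hence `δ = k / w`. -/
theorem IsExpFamily.exists_minorization (hd : 1 ≤ d) (hα : 0 < α) (hβ : 0 < β)
    (h : IsExpFamily α β π) {ε : ℝ} (hε : 0 < ε) (r : ℝ) (ℒ : Measure ℕ) [IsProbabilityMeasure ℒ]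
    (hℒ : 0 < ℒ {1}) :
    ∃ δ : NNReal, 0 < δ ∧ ∀ x ∈ Metric.closedBall (0 : X d) r,
      δ • (target π).restrict (Metric.closedBall (0 : X d) r) ≤ kernel π h.measurable ε ℒ x := by
  have hU := measurable_potential h.measurable
  obtain ⟨c, hc, hcx⟩ := h.exists_le_gaussDensity_mul_accept hε r
  obtain ⟨B, hB⟩ := (isCompact_closedBall (0 : X d) r).exists_bound_of_continuousOn
    h.contDiff.continuous.continuousOn
  set Z := volume.withDensity (fun x => ENNReal.ofReal (π x)) Set.univ
  set w := Z⁻¹ * ENNReal.ofReal (max B 1)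
  have hw0 : w ≠ 0 := mul_ne_zero (ENNReal.inv_ne_zero.2 (h.mass_ne_top hd hα hβ))
    (ENNReal.ofReal_pos.2 (by positivity)).ne'
  have hwt : w ≠ ∞ := ENNReal.mul_ne_top (ENNReal.inv_ne_top.2 h.mass_ne_zero)
    ENNReal.ofReal_ne_top
  set k := ℒ {1} * (ENNReal.ofReal c * ENNReal.ofReal |(ε ^ d)⁻¹|)
  have hk0 : k ≠ 0 := mul_ne_zero hℒ.ne' (mul_ne_zero (ENNReal.ofReal_pos.2 hc).ne'
    (ENNReal.ofReal_pos.2 (by positivity)).ne')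
  have hkt : k ≠ ∞ := ENNReal.mul_ne_top (measure_ne_top _ _)
    (ENNReal.mul_ne_top ENNReal.ofReal_ne_top ENNReal.ofReal_ne_top)
  have hq0 : k / w ≠ 0 := ENNReal.div_ne_zero.2 ⟨hk0, hwt⟩
  have hqt : k / w ≠ ∞ := ENNReal.div_ne_top hkt hw0
  refine ⟨(k / w).toNNReal, ENNReal.toNNReal_pos hq0 hqt, fun x hx => ?_⟩
  refine Measure.le_iff.2 fun A hA => ?_
  have hAC : MeasurableSet (A ∩ Metric.closedBall (0 : X d) r) :=
    hA.inter Metric.isClosed_closedBall.measurableSet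
  have htarget : target π (A ∩ Metric.closedBall (0 : X d) r)
      ≤ w * volume (A ∩ Metric.closedBall (0 : X d) r) := by
    rw [target_apply hAC, mul_assoc]
    gcongr
    refine (setLIntegral_mono' (g := fun _ => ENNReal.ofReal (max B 1)) hAC fun y hy => ?_).trans
      (setLIntegral_const _ _).le
    exact ENNReal.ofReal_le_ofReal (((le_abs_self _).trans (hB y hy.2)).trans (le_max_left _ _))
  have hkernel : k * volume (A ∩ Metric.closedBall (0 : X d) r)
      ≤ kernel π h.measurable ε ℒ x A := by
    refine le_trans ?_ (le_kernel_apply h.measurable ε ℒ x hA)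
    rw [show k = ℒ {1} * (ENNReal.ofReal c * ENNReal.ofReal |(ε ^ d)⁻¹|) from rfl, mul_assoc,
      mul_assoc, ← volume_preimage_add_smul (x - (ε ^ 2 / 2) • gradient (potential π) x) hε.ne']
    gcongr ℒ {1} * ?_
    set f : X d → X d := fun p => x - (ε ^ 2 / 2) • gradient (potential π) x + ε • p with hf
    have hpre : MeasurableSet (f ⁻¹' (A ∩ Metric.closedBall (0 : X d) r)) :=
      (by rw [hf]; fun_prop : Measurable f) hAC
    have hm : Measurable fun p => ENNReal.ofReal (accept (potential π) ε 1 (x, p))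
        * A.indicator (1 : X d → ℝ≥0∞) (leapfrog (potential π) ε 1 (x, p)).1 :=
      ((measurable_accept ε hU 1).comp measurable_prodMk_left).ennreal_ofReal.mul
        ((measurable_one.indicator hA).comp
          ((measurable_leapfrog _ ε 1).comp measurable_prodMk_left).fst)
    rw [stdGaussian_eq_withDensity, lintegral_withDensity_eq_lintegral_mul _
      measurable_gaussDensity.ennreal_ofReal hm, ← lintegral_indicator_const hpre]
    refine lintegral_mono fun p => ?_
    by_cases hp : x - (ε ^ 2 / 2) • gradient (potential π) x + ε • p
        ∈ A ∩ Metric.closedBall (0 : X d) r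
    · rw [Set.indicator_of_mem (show p ∈ f ⁻¹' (A ∩ Metric.closedBall 0 r) from hp), Pi.mul_apply]
      rw [← leapfrog_one_fst] at hp
      rw [Set.indicator_of_mem hp.1, Pi.one_apply, mul_one,
        ← ENNReal.ofReal_mul (gaussDensity_pos p).le]
      exact ENNReal.ofReal_le_ofReal (hcx x p (by simpa using hx) (by simpa using hp.2))
    · rw [Set.indicator_of_notMem (show p ∉ f ⁻¹' (A ∩ Metric.closedBall 0 r) from hp)]
      exact zero_le
  calc _ = k / w * target π (A ∩ Metric.closedBall (0 : X d) r) := by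
        rw [Measure.smul_apply, Measure.restrict_apply hA, ENNReal.smul_def, smul_eq_mul,
          ENNReal.coe_toNNReal hqt]
    _ ≤ k / w * (w * volume (A ∩ Metric.closedBall (0 : X d) r)) := by gcongr
    _ = k * volume (A ∩ Metric.closedBall (0 : X d) r) := by
        rw [← mul_assoc, ENNReal.div_mul_cancel hw0 hwt]
    _ ≤ _ := hkernel

end Minorization

/-! ### Geometric ergodicity for `1 ≤ β ≤ 2`. -/

variable {d : ℕ} {α β : ℝ} {π : X d → ℝ}

theorem IsExpFamily.geometricallyErgodic_of_eventually_le (hd : 1 ≤ d) (hα : 0 < α)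
    (h : IsExpFamily α β π) (h1 : 1 ≤ β) (h2 : β ≤ 2) {ε θ : ℝ} (hε : 0 < ε) (hθ : θ < 1)
    (hev : ∀ᶠ r : ℝ in Filter.atTop, ε ^ 2 / 2 * (α * β * r ^ (β - 2)) ≤ θ)
    (ℒ : Measure ℕ) [IsProbabilityMeasure ℒ] (hℒ : 0 < ℒ {1}) :
    GeometricallyErgodic (kernel π h.measurable ε ℒ) (target π) := by
  have hβ : 0 < β := by linarith
  have := h.isProbabilityMeasure_target hd hα hβ
  obtain ⟨R, K, T⟩ := h.exists_tailBound hd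
  obtain ⟨s, r, lam, b, hr, hlam, hdrift⟩ := T.exists_lintegral_drift h hα h1 h2 hε hθ hev
  obtain ⟨δ, hδ, hminor⟩ := h.exists_minorization hd hα hβ hε r ℒ hℒ
  have hV : Measurable fun x : X d => Real.exp (s * ‖x‖) := by fun_prop
  have hC : MeasurableSet (Metric.closedBall (0 : X d) r) :=
    Metric.isClosed_closedBall.measurableSet
  have hDM : DriftMinorization (kernel π h.measurable ε ℒ) (target π)
      (acceptedFlow π ε (ℒ.restrict {1})) (Metric.closedBall 0 r) (fun x => Real.exp (s * ‖x‖))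
      ((ℒ {1}).toNNReal * lam) ((ℒ {1}).toNNReal * b) δ :=
    { symm := compProd_kernel_symm h.measurable ε ℒ h.pos
      symm_part := acceptedFlow_symm h.measurable ε _ h.pos
      part_le := acceptedFlow_restrict_le h.measurable ε ℒ {1}
      measurableSet := hC
      measure_pos := (h.target_pos hd hα hβ Metric.isOpen_ball
        ⟨0, Metric.mem_ball_self hr⟩).trans_le (measure_mono Metric.ball_subset_closedBall)
      measurable := hV
      pos := fun x => Real.exp_pos _
      lam_pos := mul_pos (ENNReal.toNNReal_pos hℒ.ne' (measure_ne_top _ _)) hlam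
      δ_pos := hδ
      drift := fun g hg => lintegral_drift_of_pointwise h.measurable ε ℒ hV hC hdrift hg
      minorization := hminor }
  exact hDM.geometricallyErgodic

theorem IsExpFamily.geometricallyErgodic_of_lt_two (hd : 1 ≤ d) (hα : 0 < α)
    (h : IsExpFamily α β π) (h1 : 1 ≤ β) (h2 : β < 2) {ε : ℝ} (hε : 0 < ε)
    (ℒ : Measure ℕ) [IsProbabilityMeasure ℒ] (hℒ : 0 < ℒ {1}) :
    GeometricallyErgodic (kernel π h.measurable ε ℒ) (target π) := by
  -- For `β < 2` the ratio of gradient displacement to `‖x‖` tends to `0`, so any positive `θ < 1`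
  -- would do.
  refine h.geometricallyErgodic_of_eventually_le hd hα h1 h2.le hε one_half_lt_one ?_ ℒ hℒ
  have hlim := ((tendsto_rpow_neg_atTop (show 0 < 2 - β by linarith)).const_mul
    (α * β)).const_mul (ε ^ 2 / 2)
  rw [neg_sub, mul_zero, mul_zero] at hlim
  exact hlim.eventually_le_const (by norm_num)

theorem IsExpFamily.geometricallyErgodic_of_eq_two (hd : 1 ≤ d) (hα : 0 < α)
    (h : IsExpFamily α β π) (h2 : β = 2) {ε : ℝ} (hε : 0 < ε) (hεα : ε < (√α)⁻¹)
    (ℒ : Measure ℕ) [IsProbabilityMeasure ℒ] (hℒ : 0 < ℒ {1}) :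
    GeometricallyErgodic (kernel π h.measurable ε ℒ) (target π) := by
  -- For `β = 2` that ratio is the constant `ε² α`, whence the threshold `(√α)⁻¹`.
  have hθ : ε ^ 2 * α < 1 := by
    have h3 : ε ^ 2 < (√α)⁻¹ ^ 2 := by gcongr
    rw [inv_pow, Real.sq_sqrt hα.le] at h3
    rwa [← one_div, lt_div_iff₀ hα] at h3
  refine h.geometricallyErgodic_of_eventually_le hd hα (by linarith) h2.le hε hθ ?_ ℒ hℒ
  filter_upwards with r
  rw [h2, sub_self, Real.rpow_zero]
  linarith

end HMC

theorem mainTheorem6 (d : ℕ) (hd : 1 ≤ d) (α β : ℝ) (hα : 0 < α) (hβ : 0 < β)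
    (π : HMC.X d → ℝ) (hπ : HMC.IsExpFamily α β π)
    (ℒ : MeasureTheory.Measure ℕ) [MeasureTheory.IsProbabilityMeasure ℒ] :
    (1 ≤ β → β < 2 → 0 < ℒ {1} → ∀ ε : ℝ, 0 < ε →
      HMC.GeometricallyErgodic (HMC.kernel π hπ.measurable ε ℒ) (HMC.target π)) ∧
    (β = 2 → 0 < ℒ {1} → ∃ ε₀ : ℝ, 0 < ε₀ ∧ ∀ ε : ℝ, 0 < ε → ε < ε₀ →
      HMC.GeometricallyErgodic (HMC.kernel π hπ.measurable ε ℒ) (HMC.target π)) ∧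
    (β < 1 ∨ 2 < β → ∀ ε : ℝ, 0 < ε →
      ¬ HMC.GeometricallyErgodic (HMC.kernel π hπ.measurable ε ℒ) (HMC.target π)) := by
  refine ⟨fun h1 h2 hℒ ε hε => hπ.geometricallyErgodic_of_lt_two hd hα h1 h2 hε ℒ hℒ,
    fun h2 hℒ => ⟨(√α)⁻¹, by positivity, fun ε hε hεα =>
      hπ.geometricallyErgodic_of_eq_two hd hα h2 hε hεα ℒ hℒ⟩, ?_⟩
  rintro (h1 | h2) ε hε
  · exact HMC.not_geometricallyErgodic_of_lt_one hα hβ h1 hd hπ hε ℒ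
  · exact HMC.not_geometricallyErgodic_of_two_lt hα h2 hd hπ hε ℒ
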